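/- Let $c\in\mathbb N$ be a constant. There is a randomized dynamic streaming algorithm $\mathcal A$ (a fixed word-RAM program for setup, one for an update, one for a query) and constants $W,C,p$, all depending only on $c$, such that the following holds for all integers $n\ge 2$, $1\le k\le n$ and all $\delta\in(0,1)$, where $\mathcal A$ is given $n$, $k$ and $\lceil 1/\delta\rceil$ and runs on words of $W\lceil\log_2(n/\delta)\rceil$ bits. Let $S$ be any sequence of at most $n^c$ insertions and deletions of edges on the vertex set $\{0,\dots,n-1\}$, starting from the empty graph, in which only absent edges (no loops) are inserted and only present edges are deleted; $S$ is fixed before the random choices of $\mathcal A$ are made (oblivious adversary). Suppose we are promised that at every time $i\in\{0,\dots,|S|\}$ the current graph has an inclusion-maximal matching of size at most $k$. Then $\mathcal A$ processes $S$ in one pass and, for every outcome of its random choices, * uses at most $C\,k^2\log_2^p(n/\delta)$ bits of space, * takes at most $C\,k\log_2^p(n/\delta)$ steps for each single update (and for the setup), and * at every time answers a query for the matching in at most $C\,k\log_2^p(n/\delta)$ steps, without changing its memory. With probability at least $1-\delta/n^c$, the answers at all times $i$ simultaneously are correct: each lists the edges of a maximal matching of the graph at time $i$. In particular (space $\tilde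 O(k^2)$, worst-case update and query time $\tilde O(k)$), for $k=\tilde O(\sqrt n)$ the same algorithm uses space $\tilde O(n)$ and has worst-case update and query times $\tilde O(\sqrt n)$: for all $a\in\mathbb R$, $q\in\mathbb N$ there are constants $C',p'$ such that, whenever moreover $k\le a\sqrt n\,\log_2^q n$, the space is at most $C' n\log_2^{p'}(n/\delta)$ bits and the time of each update and each query is at most $C'\sqrt n\,\log_2^{p'}(n/\delta)$. -/

import Mathlib

/-! ## A randomized word RAM with a step count -/

namespace WordRAM

/-- The arithmetic of the machine.  Subtraction is truncated at `0`; division and remainder by `0`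
return `0` and the dividend.  A comparison returns `1` or `0`. -/
inductive BinOp
  | add | sub | mul | div | mod | eq | lt | and | or | xor | shl | shr

/-- The exact value of an operation, before it is cut down to a word. -/
def BinOp.val : BinOp → ℕ → ℕ → ℕ
  | .add, a, b => a + b
  | .sub, a, b => a - b
  | .mul, a, b => a * b
  | .div, a, b => a / b
  | .mod, a, b => a % b
  | .eq, a, b => if a = b then 1 else 0
  | .lt, a, b => if a < b then 1 else 0
  | .and, a, b => a &&& b
  | .or, a, b => a ||| b
  | .xor, a, b => a ^^^ b
  | .shl, a, b => a <<< b
  | .shr, a, b => a >>> b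

/-- Expressions over the registers. -/
inductive Expr
  | const (a : ℕ)
  | reg (i : ℕ)
  | bin (o : BinOp) (e f : Expr)

/-- Value of an expression on a machine with `w`-bit words: every intermediate result is reduced
modulo `2 ^ w`. -/
def Expr.eval (w : ℕ) (ρ : ℕ → ℕ) : Expr → ℕ
  | .const a => a % 2 ^ w
  | .reg i => ρ i
  | .bin o e f => o.val (e.eval w ρ) (f.eval w ρ) % 2 ^ w

/-- Programs.  `load i e` reads the memory cell whose address is the value of `e` into register
`i`, `store e f` writes the value of `f` to the cell with address `e`, `rand i` puts a fresh
uniformly random word into register `i`, `emit e` writes to the output. -/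
inductive Cmd
  | set (i : ℕ) (e : Expr)
  | load (i : ℕ) (e : Expr)
  | store (e f : Expr)
  | rand (i : ℕ)
  | emit (e : Expr)
  | skip
  | seq (a b : Cmd)
  | cond (e : Expr) (a b : Cmd)
  | loop (e : Expr) (a : Cmd)

/-- Number of registers that an expression needs (one more than the largest index). -/
def Expr.numRegs : Expr → ℕ
  | .const _ => 0
  | .reg i => i + 1
  | .bin _ e f => max e.numRegs f.numRegs

/-- Number of registers that a program needs. -/
def Cmd.numRegs : Cmd → ℕ
  | .set i e => max (i + 1) e.numRegs
  | .load i e => max (i + 1) e.numRegs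
  | .store e f => max e.numRegs f.numRegs
  | .rand i => i + 1
  | .emit e => e.numRegs
  | .skip => 0
  | .seq a b => max a.numRegs b.numRegs
  | .cond e a b => max e.numRegs (max a.numRegs b.numRegs)
  | .loop e a => max e.numRegs a.numRegs

/-- Configuration of the machine: registers, memory, number of random words consumed so far, and
the output written so far. -/
structure Config where
  regs : ℕ → ℕ
  mem : ℕ → ℕ
  pos : ℕ
  out : List ℕ

/-- `Exec w s ω a σ t τ`: on a machine with `w`-bit words, a memory of `s` words (addresses
`0, …, s - 1`) and the sequence `ω` of random words, the program `a` started in `σ` halts in `τ`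
after `t` steps.  An access outside the memory has no execution.  Each elementary command and each
test of a condition is one step; the expressions in it have a size fixed by the program. -/
inductive Exec (w s : ℕ) (ω : ℕ → Fin (2 ^ w)) : Cmd → Config → ℕ → Config → Prop
  | set (i : ℕ) (e : Expr) (σ : Config) :
      Exec w s ω (.set i e) σ 1 { σ with regs := Function.update σ.regs i (e.eval w σ.regs) }
  | load (i : ℕ) (e : Expr) (σ : Config) (h : e.eval w σ.regs < s) :
      Exec w s ω (.load i e) σ 1
        { σ with regs := Function.update σ.regs i (σ.mem (e.eval w σ.regs)) }
  | store (e f : Expr) (σ : Config) (h : e.eval w σ.regs < s) :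
      Exec w s ω (.store e f) σ 1
        { σ with mem := Function.update σ.mem (e.eval w σ.regs) (f.eval w σ.regs) }
  | rand (i : ℕ) (σ : Config) :
      Exec w s ω (.rand i) σ 1
        { σ with regs := Function.update σ.regs i (ω σ.pos : ℕ), pos := σ.pos + 1 }
  | emit (e : Expr) (σ : Config) :
      Exec w s ω (.emit e) σ 1 { σ with out := σ.out ++ [e.eval w σ.regs] }
  | skip (σ : Config) : Exec w s ω .skip σ 1 σ
  | seq {a b : Cmd} {σ₀ σ₁ σ₂ : Config} {t₁ t₂ : ℕ} (h₁ : Exec w s ω a σ₀ t₁ σ₁)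
      (h₂ : Exec w s ω b σ₁ t₂ σ₂) : Exec w s ω (.seq a b) σ₀ (t₁ + t₂) σ₂
  | condTrue {e : Expr} {a b : Cmd} {σ₀ σ₁ : Config} {t : ℕ} (he : e.eval w σ₀.regs ≠ 0)
      (h : Exec w s ω a σ₀ t σ₁) : Exec w s ω (.cond e a b) σ₀ (t + 1) σ₁
  | condFalse {e : Expr} {a b : Cmd} {σ₀ σ₁ : Config} {t : ℕ} (he : e.eval w σ₀.regs = 0)
      (h : Exec w s ω b σ₀ t σ₁) : Exec w s ω (.cond e a b) σ₀ (t + 1) σ₁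
  | loopDone {e : Expr} {a : Cmd} {σ : Config} (he : e.eval w σ.regs = 0) :
      Exec w s ω (.loop e a) σ 1 σ
  | loopStep {e : Expr} {a : Cmd} {σ₀ σ₁ σ₂ : Config} {t₁ t₂ : ℕ} (he : e.eval w σ₀.regs ≠ 0)
      (h₁ : Exec w s ω a σ₀ t₁ σ₁) (h₂ : Exec w s ω (.loop e a) σ₁ t₂ σ₂) :
      Exec w s ω (.loop e a) σ₀ (t₁ + t₂ + 1) σ₂

/-- The machine is deterministic once the random words are fixed. -/
theorem Exec.deterministic {w s : ℕ} {ω : ℕ → Fin (2 ^ w)} {a : Cmd} {σ τ τ' : Config}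
    {t t' : ℕ} (h : Exec w s ω a σ t τ) (h' : Exec w s ω a σ t' τ') : t = t' ∧ τ = τ' := by
  induction h generalizing t' τ' with
  | set | load | store | rand | emit | skip => cases h'; exact ⟨rfl, rfl⟩
  | seq _ _ ih₁ ih₂ =>
    cases h' with
    | seq k₁ k₂ =>
      obtain ⟨rfl, rfl⟩ := ih₁ k₁
      obtain ⟨rfl, rfl⟩ := ih₂ k₂
      exact ⟨rfl, rfl⟩
  | condTrue he _ ih =>
    cases h' with
    | condTrue _ k => obtain ⟨rfl, rfl⟩ := ih k; exact ⟨rfl, rfl⟩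
    | condFalse he' _ => exact absurd he' he
  | condFalse he _ ih =>
    cases h' with
    | condTrue he' _ => exact absurd he he'
    | condFalse _ k => obtain ⟨rfl, rfl⟩ := ih k; exact ⟨rfl, rfl⟩
  | loopDone he =>
    cases h' with
    | loopDone _ => exact ⟨rfl, rfl⟩
    | loopStep he' _ _ => exact absurd he he'
  | loopStep he _ _ ih₁ ih₂ =>
    cases h' with
    | loopDone he' => exact absurd he' he
    | loopStep _ k₁ k₂ =>
      obtain ⟨rfl, rfl⟩ := ih₁ k₁
      obtain ⟨rfl, rfl⟩ := ih₂ k₂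
      exact ⟨rfl, rfl⟩

/-- Start of a procedure: the arguments are put into the registers `0, 1, …`, all other registers
are cleared and the output is emptied; memory and random source are kept. -/
def Config.call (w : ℕ) (σ : Config) (args : List ℕ) : Config :=
  { σ with regs := fun i => args.getD i 0 % 2 ^ w, out := [] }

/-- The machine before anything has happened, with cleared memory. -/
def Config.blank : Config := ⟨fun _ => 0, fun _ => 0, 0, []⟩

/-- The law of the random source: independent uniform `w`-bit words. -/
noncomputable def coins (w : ℕ) : MeasureTheory.Measure (ℕ → Fin (2 ^ w)) :=
  MeasureTheory.Measure.infinitePi fun _ : ℕ => (PMF.uniformOfFintype (Fin (2 ^ w))).toMeasure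

end WordRAM

/-! ## Dynamic graph streams and maximal matchings -/

namespace DynStream

/-- An update of a graph with vertex set `{0, …, n - 1}`. -/
inductive Update (n : ℕ)
  | insert (u v : Fin n)
  | delete (u v : Fin n)

/-- Effect of an update on the edge set. -/
def Update.apply {n : ℕ} (E : Finset (Sym2 (Fin n))) : Update n → Finset (Sym2 (Fin n))
  | .insert u v => Insert.insert s(u, v) E
  | .delete u v => E.erase s(u, v)

/-- Only an absent edge (no loop) may be inserted, only a present edge may be deleted. -/
def Update.Admissible {n : ℕ} (E : Finset (Sym2 (Fin n))) : Update n → Prop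
  | .insert u v => u ≠ v ∧ s(u, v) ∉ E
  | .delete u v => s(u, v) ∈ E

/-- The edge set after a sequence of updates of the empty graph. -/
def edges {n : ℕ} (S : List (Update n)) : Finset (Sym2 (Fin n)) :=
  S.foldl Update.apply ∅

/-- Dynamic graph streams; the edge set at time `i` is `edges (S.take i)`. -/
def IsStream {n : ℕ} (S : List (Update n)) : Prop :=
  ∀ (i : ℕ) (h : i < S.length), S[i].Admissible (edges (S.take i))

/-- `M` is a set of edges from `E`, no two of which share a vertex. -/
def IsMatching {n : ℕ} (E M : Finset (Sym2 (Fin n))) : Prop :=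
  M ⊆ E ∧ ∀ e ∈ M, ∀ f ∈ M, ∀ v, v ∈ e → v ∈ f → e = f

/-- Matchings that are maximal under inclusion. -/
def IsMaximalMatching {n : ℕ} (E M : Finset (Sym2 (Fin n))) : Prop :=
  Maximal (IsMatching E) M

/-- The promise: at every time there is a maximal matching of size at most `k`. -/
def Promise {n : ℕ} (k : ℕ) (S : List (Update n)) : Prop :=
  ∀ i ≤ S.length, ∃ M, IsMaximalMatching (edges (S.take i)) M ∧ M.card ≤ k

/-- The output `u₁, v₁, u₂, v₂, …` lists, without repetition, the edges `u₁v₁, u₂v₂, …` of a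
maximal matching of the graph with edge set `E`. -/
def ListsMaximalMatching {n : ℕ} (E : Finset (Sym2 (Fin n))) (out : List ℕ) : Prop :=
  ∃ L : List (Fin n × Fin n),
    out = L.flatMap (fun p => [(p.1 : ℕ), (p.2 : ℕ)]) ∧
    (L.map fun p => s(p.1, p.2)).Nodup ∧
    IsMaximalMatching E (L.map fun p => s(p.1, p.2)).toFinset

/-! ## Dynamic streaming algorithms -/

open WordRAM

/-- A dynamic algorithm consists of three programs: one for the preparation before the stream
starts, one that processes an update, and one that answers a query for the matching. -/
structure Algorithm where
  setup : Cmd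
  update : Cmd
  query : Cmd

/-- Number of registers of the algorithm (at least four, which carry the arguments). -/
def Algorithm.numRegs (A : Algorithm) : ℕ :=
  max 4 (max A.setup.numRegs (max A.update.numRegs A.query.numRegs))

/-- The arguments handed to the update program: `0, u, v` for an insertion and `1, u, v` for a
deletion of the edge `uv`. -/
def Update.args {n : ℕ} : Update n → List ℕ
  | .insert u v => [0, u, v]
  | .delete u v => [1, u, v]

/-- `σ i` is the configuration of the algorithm at time `i` of the stream `S`.  The setup program
gets `params`.  The setup and each single update take at most `T` steps. -/
def IsRun (A : Algorithm) {n : ℕ} (w s : ℕ) (ω : ℕ → Fin (2 ^ w)) (params : List ℕ)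
    (S : List (Update n)) (T : ℝ) (σ : ℕ → Config) : Prop :=
  (∃ t : ℕ, (t : ℝ) ≤ T ∧ Exec w s ω A.setup (Config.blank.call w params) t (σ 0)) ∧
  ∀ (i : ℕ) (h : i < S.length),
    ∃ t : ℕ, (t : ℝ) ≤ T ∧ Exec w s ω A.update ((σ i).call w S[i].args) t (σ (i + 1))

/-- In configuration `σ` the query program halts within `Q` steps with output `out`; it leaves the
memory and the random source as they were, so that queries may be asked at any time and any number
of times. -/
def Answers (A : Algorithm) (w s : ℕ) (ω : ℕ → Fin (2 ^ w)) (Q : ℝ) (σ : Config)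
    (out : List ℕ) : Prop :=
  ∃ (t : ℕ) (τ : Config), (t : ℝ) ≤ Q ∧ Exec w s ω A.query (σ.call w []) t τ ∧
    τ.mem = σ.mem ∧ τ.pos = σ.pos ∧ τ.out = out

/-- On graphs with `n` vertices, under the promise with parameter `k`, on machines with `w`-bit
words, the algorithm `A` maintains a maximal matching in at most `B` bits of space, with update
time at most `T` and query time at most `Q`.  The bounds hold for every stream of length at most
`n ^ c` that satisfies the promise and every outcome of the random choices.  The stream is fixed
before the random choices are made, and with probability at least `1 - δ / n ^ c` the answers at
all times of the stream are correct. -/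
def Maintains (A : Algorithm) (c n k : ℕ) (δ : ℝ) (w : ℕ) (B T Q : ℝ) : Prop :=
  ∃ s : ℕ, (((s + A.numRegs) * w : ℕ) : ℝ) ≤ B ∧
    ∀ S : List (Update n), IsStream S → S.length ≤ n ^ c → Promise k S →
      (∀ ω : ℕ → Fin (2 ^ w), ∃ σ : ℕ → Config,
        IsRun A w s ω [n, k, ⌈1 / δ⌉₊, w] S T σ ∧
        ∀ i ≤ S.length, ∃ out, Answers A w s ω Q (σ i) out) ∧
      coins w {ω | ¬ ∃ σ : ℕ → Config,
        IsRun A w s ω [n, k, ⌈1 / δ⌉₊, w] S T σ ∧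
        ∀ i ≤ S.length, ∃ out, Answers A w s ω Q (σ i) out ∧
          ListsMaximalMatching (edges (S.take i)) out} ≤ ENNReal.ofReal (δ / (n : ℝ) ^ c)

end DynStream

/-! ## A program logic for the word RAM -/

namespace WordRAM

/-! The endpoints of a maximal matching with at most k edges form a vertex cover X of size at most
2k. Hence every matching has at most 2k edges, and vertices outside X have degree at most 2k. The
algorithm stores one matching and w² linear sketches. Sketch t has level j = t mod w: one hash
function sends each vertex to one of 2^l = Θ(k) rows, a second one samples each vertex with
probability 2^(-j) into one of 2^l columns. The cell (r, b) keeps the number of ordered edges (x, z)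
with x in row r and z in column b, and the sums of x and of z. A cell with count one reveals its
pair, so nothing false is ever read off; the stored edges are a matching for every outcome of the
coins (`Stored`), and only maximality (`Saturated`) is a matter of luck.

An inserted edge is matched greedily. Deleting a matched edge uv frees u and v, and for each of them
the sketches are searched for a free neighbour. If the old matching was maximal, any other free
vertex has all its neighbours matched, hence degree at most 4k. So an unsuccessful search at u is
conclusive if the sketches are `Informative` about u: either every neighbour of degree at most 4k is
recovered somewhere, or one sketch recovers more than 4k neighbours, too many to be all matched
(`Informative.matched`, `reaches_deleteEdge`).

A pair sharing the cell of (u, y) forces a collision of u with X ∪ N(y) in the rows or of y with X ∪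
N(u) in the columns. With 2^l ≥ 256k and 8 deg u ≤ 2^(l+j), pairwise collision bounds give recovery
of a light y with probability at least 3/4 · 2^(-j) (`card_recoveredBy_ge`). For small deg u level 0
treats every light neighbour separately. For large deg u take the level where 2^(l+j) lies between 8
and 16 times deg u: at least 10.5k neighbours are expected to be recovered and never more than 512k,
so more than 4k are recovered with probability above 1/100 (`card_few_recoveredBy_le`). The w
independent sketches of the level all fail with probability at most (99/100)^w.

`Informative` speaks of the graph and a vertex, never of the stored matching. As the adversary is
oblivious, these events are fixed in advance, and a union bound over updates and endpoints suffices
(`coins_bad_le`, `failure_le`). A search reads w² rows of O(k) cells, and there are O(w² k²) cells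
of w bits. -/

instance : Add Expr := ⟨.bin .add⟩
instance : Sub Expr := ⟨.bin .sub⟩
instance : Mul Expr := ⟨.bin .mul⟩
instance : Mod Expr := ⟨.bin .mod⟩
instance (a : ℕ) : OfNat Expr a := ⟨.const a⟩

/-! ### Evaluation of expressions whose intermediate results fit into a word. -/

section Eval

variable {w : ℕ} {ρ : ℕ → ℕ} {e f : Expr} {a b : ℕ}

theorem eval_reg {i : ℕ} (h : ρ i = a) : (Expr.reg i).eval w ρ = a := h

theorem eval_lit (h : (OfNat.ofNat a : ℕ) < 2 ^ w) :
    (OfNat.ofNat a : Expr).eval w ρ = (OfNat.ofNat a : ℕ) := Nat.mod_eq_of_lt h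

theorem eval_add (he : e.eval w ρ = a) (hf : f.eval w ρ = b) (h : a + b < 2 ^ w) :
    (e + f).eval w ρ = a + b := by
  subst he hf; exact Nat.mod_eq_of_lt h

theorem eval_sub (he : e.eval w ρ = a) (hf : f.eval w ρ = b) (h : a - b < 2 ^ w) :
    (e - f).eval w ρ = a - b := by
  subst he hf; exact Nat.mod_eq_of_lt h

theorem eval_mul (he : e.eval w ρ = a) (hf : f.eval w ρ = b) (h : a * b < 2 ^ w) :
    (e * f).eval w ρ = a * b := by
  subst he hf; exact Nat.mod_eq_of_lt h

theorem eval_mod (he : e.eval w ρ = a) (hf : f.eval w ρ = b) (h : a % b < 2 ^ w) :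
    (e % f).eval w ρ = a % b := by
  subst he hf; exact Nat.mod_eq_of_lt h

theorem eval_lt (hw : 0 < w) (he : e.eval w ρ = a) (hf : f.eval w ρ = b) :
    (Expr.bin .lt e f).eval w ρ = if a < b then 1 else 0 := by
  subst he hf
  have : 1 < 2 ^ w := Nat.one_lt_two_pow hw.ne'
  refine Nat.mod_eq_of_lt ?_
  show (if _ then 1 else 0) < _
  split <;> omega

theorem eval_eq (hw : 0 < w) (he : e.eval w ρ = a) (hf : f.eval w ρ = b) :
    (Expr.bin .eq e f).eval w ρ = if a = b then 1 else 0 := by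
  subst he hf
  have : 1 < 2 ^ w := Nat.one_lt_two_pow hw.ne'
  refine Nat.mod_eq_of_lt ?_
  show (if _ then 1 else 0) < _
  split <;> omega

end Eval

/-! ### Syntactic frame conditions. -/

/-- The registers that a program may change. -/
def Cmd.writes : Cmd → ℕ → Bool
  | .set i _, r => i == r
  | .load i _, r => i == r
  | .store _ _, _ => false
  | .rand i, r => i == r
  | .emit _, _ => false
  | .skip, _ => false
  | .seq a b, r => a.writes r || b.writes r
  | .cond _ a b, r => a.writes r || b.writes r
  | .loop _ a, r => a.writes r

/-- Does the program contain a store? -/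
def Cmd.stores : Cmd → Bool
  | .store _ _ => true
  | .seq a b => a.stores || b.stores
  | .cond _ a b => a.stores || b.stores
  | .loop _ a => a.stores
  | _ => false

/-- Does the program draw random words? -/
def Cmd.draws : Cmd → Bool
  | .rand _ => true
  | .seq a b => a.draws || b.draws
  | .cond _ a b => a.draws || b.draws
  | .loop _ a => a.draws
  | _ => false

/-- Does the program write to the output? -/
def Cmd.emits : Cmd → Bool
  | .emit _ => true
  | .seq a b => a.emits || b.emits
  | .cond _ a b => a.emits || b.emits
  | .loop _ a => a.emits
  | _ => false

/-- What a program leaves unchanged for syntactic reasons. -/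
structure Frame (a : Cmd) (σ τ : Config) : Prop where
  regs : ∀ r, a.writes r = false → τ.regs r = σ.regs r
  mem : a.stores = false → τ.mem = σ.mem
  pos : a.draws = false → τ.pos = σ.pos
  out : a.emits = false → τ.out = σ.out

theorem Frame.refl (a : Cmd) (σ : Config) : Frame a σ σ :=
  ⟨fun _ _ => rfl, fun _ => rfl, fun _ => rfl, fun _ => rfl⟩

theorem Frame.trans {a : Cmd} {σ τ υ : Config} (h : Frame a σ τ) (h' : Frame a τ υ) :
    Frame a σ υ :=
  ⟨fun r hr => (h'.regs r hr).trans (h.regs r hr), fun hr => (h'.mem hr).trans (h.mem hr),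
    fun hr => (h'.pos hr).trans (h.pos hr), fun hr => (h'.out hr).trans (h.out hr)⟩

theorem Frame.mono {a b : Cmd} {σ τ : Config} (h : Frame a σ τ)
    (h₁ : ∀ r, b.writes r = false → a.writes r = false) (h₂ : b.stores = false → a.stores = false)
    (h₃ : b.draws = false → a.draws = false) (h₄ : b.emits = false → a.emits = false) :
    Frame b σ τ :=
  ⟨fun r hr => h.regs r (h₁ r hr), fun hr => h.mem (h₂ hr), fun hr => h.pos (h₃ hr),
    fun hr => h.out (h₄ hr)⟩

variable {w s : ℕ} {ω : ℕ → Fin (2 ^ w)}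

/-- For a concrete program `writes`, `stores`, `draws` and `emits` compute. Hence uses such as
`F.regs 3 rfl` carry a register across a subprogram whose postcondition does not mention it. -/
theorem Exec.frame {a : Cmd} {σ τ : Config} {t : ℕ} (h : Exec w s ω a σ t τ) : Frame a σ τ := by
  induction h with
  | set i e σ | load i e σ | rand i σ =>
    refine ⟨fun r hr => ?_, fun _ => rfl, ?_, fun _ => rfl⟩
    · have : r ≠ i := by rintro rfl; simp [Cmd.writes] at hr
      simp [Function.update_of_ne this]
    · simp [Cmd.draws]
  | store => exact ⟨fun _ _ => rfl, by simp [Cmd.stores], fun _ => rfl, fun _ => rfl⟩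
  | emit => exact ⟨fun _ _ => rfl, fun _ => rfl, fun _ => rfl, by simp [Cmd.emits]⟩
  | skip | loopDone => exact Frame.refl _ _
  | seq _ _ ih₁ ih₂ =>
    refine (ih₁.mono ?_ ?_ ?_ ?_).trans (ih₂.mono ?_ ?_ ?_ ?_) <;>
      simp +contextual [Cmd.writes, Cmd.stores, Cmd.draws, Cmd.emits]
  | condTrue _ _ ih | condFalse _ _ ih =>
    refine ih.mono ?_ ?_ ?_ ?_ <;>
      simp +contextual [Cmd.writes, Cmd.stores, Cmd.draws, Cmd.emits]
  | loopStep _ _ _ ih₁ ih₂ =>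
    exact Frame.trans ⟨ih₁.regs, ih₁.mem, ih₁.pos, ih₁.out⟩ ih₂

/-- Write a register. -/
def Config.setReg (σ : Config) (i v : ℕ) : Config :=
  { σ with regs := Function.update σ.regs i v }

/-- Write a memory cell. -/
def Config.setMem (σ : Config) (i v : ℕ) : Config :=
  { σ with mem := Function.update σ.mem i v }

@[simp] theorem Config.setReg_regs (σ : Config) (i v j : ℕ) :
    (σ.setReg i v).regs j = if j = i then v else σ.regs j := Function.update_apply ..
@[simp] theorem Config.setReg_mem (σ : Config) (i v : ℕ) : (σ.setReg i v).mem = σ.mem := rfl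
@[simp] theorem Config.setReg_pos (σ : Config) (i v : ℕ) : (σ.setReg i v).pos = σ.pos := rfl
@[simp] theorem Config.setReg_out (σ : Config) (i v : ℕ) : (σ.setReg i v).out = σ.out := rfl
@[simp] theorem Config.setMem_mem (σ : Config) (i v j : ℕ) :
    (σ.setMem i v).mem j = if j = i then v else σ.mem j := Function.update_apply ..
@[simp] theorem Config.setMem_regs (σ : Config) (i v : ℕ) : (σ.setMem i v).regs = σ.regs := rfl
@[simp] theorem Config.setMem_pos (σ : Config) (i v : ℕ) : (σ.setMem i v).pos = σ.pos := rfl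
@[simp] theorem Config.setMem_out (σ : Config) (i v : ℕ) : (σ.setMem i v).out = σ.out := rfl

/-! ### Total correctness with a bound on the number of steps. -/

/-- The program halts within `T` steps in a configuration that satisfies `Q`. -/
def Reaches (w s : ℕ) (ω : ℕ → Fin (2 ^ w)) (a : Cmd) (σ : Config) (T : ℕ)
    (Q : Config → Prop) : Prop :=
  ∃ t τ, t ≤ T ∧ Exec w s ω a σ t τ ∧ Q τ

/-- Sequential composition of a list of programs. -/
def block : List Cmd → Cmd
  | [] => .skip
  | a :: l => .seq a (block l)

namespace Reaches

variable {a b : Cmd} {l : List Cmd} {e f : Expr} {σ : Config} {T T₁ T₂ : ℕ}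
  {Q R : Config → Prop}

theorem weaken (h : Reaches w s ω a σ T₁ R) (hT : T₁ ≤ T)
    (hQ : ∀ τ, Frame a σ τ → R τ → Q τ) : Reaches w s ω a σ T Q := by
  obtain ⟨t, τ, ht, hx, hR⟩ := h
  exact ⟨t, τ, ht.trans hT, hx, hQ τ hx.frame hR⟩

/-- The single step is the `skip` that closes every `block`. -/
theorem nil (h : Q σ) : Reaches w s ω (block []) σ (T + 1) Q :=
  ⟨1, σ, by omega, .skip σ, h⟩

theorem skip (h : Q σ) : Reaches w s ω .skip σ (T + 1) Q := nil h

theorem cons (h : Reaches w s ω a σ T₁ R)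
    (h' : ∀ τ, Frame a σ τ → R τ → Reaches w s ω (block l) τ T₂ Q) :
    Reaches w s ω (block (a :: l)) σ (T₁ + T₂) Q := by
  obtain ⟨t, τ, ht, hx, hR⟩ := h
  obtain ⟨t', τ', ht', hx', hQ⟩ := h' τ hx.frame hR
  exact ⟨t + t', τ', by omega, .seq hx hx', hQ⟩

theorem set (i v : ℕ) (he : e.eval w σ.regs = v)
    (h : Reaches w s ω (block l) (σ.setReg i v) T Q) :
    Reaches w s ω (block (.set i e :: l)) σ (T + 1) Q := by
  subst he
  obtain ⟨t, τ, ht, hx, hQ⟩ := h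
  exact ⟨1 + t, τ, by omega, .seq (.set i e σ) hx, hQ⟩

theorem load (i v : ℕ) (he : e.eval w σ.regs = v) (hv : v < s)
    (h : Reaches w s ω (block l) (σ.setReg i (σ.mem v)) T Q) :
    Reaches w s ω (block (.load i e :: l)) σ (T + 1) Q := by
  subst he
  obtain ⟨t, τ, ht, hx, hQ⟩ := h
  exact ⟨1 + t, τ, by omega, .seq (.load i e σ hv) hx, hQ⟩

theorem store (v x : ℕ) (he : e.eval w σ.regs = v) (hv : v < s) (hf : f.eval w σ.regs = x)
    (h : Reaches w s ω (block l) (σ.setMem v x) T Q) :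
    Reaches w s ω (block (.store e f :: l)) σ (T + 1) Q := by
  subst he hf
  obtain ⟨t, τ, ht, hx, hQ⟩ := h
  exact ⟨1 + t, τ, by omega, .seq (.store e f σ hv) hx, hQ⟩

theorem rand (i : ℕ)
    (h : Reaches w s ω (block l)
      { σ with regs := Function.update σ.regs i (ω σ.pos), pos := σ.pos + 1 } T Q) :
    Reaches w s ω (block (.rand i :: l)) σ (T + 1) Q := by
  obtain ⟨t, τ, ht, hx, hQ⟩ := h
  exact ⟨1 + t, τ, by omega, .seq (.rand i σ) hx, hQ⟩

theorem emit (v : ℕ) (he : e.eval w σ.regs = v)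
    (h : Reaches w s ω (block l) { σ with out := σ.out ++ [v] } T Q) :
    Reaches w s ω (block (.emit e :: l)) σ (T + 1) Q := by
  subst he
  obtain ⟨t, τ, ht, hx, hQ⟩ := h
  exact ⟨1 + t, τ, by omega, .seq (.emit e σ) hx, hQ⟩

theorem cond (h : e.eval w σ.regs ≠ 0 → Reaches w s ω a σ T Q)
    (h' : e.eval w σ.regs = 0 → Reaches w s ω b σ T Q) :
    Reaches w s ω (.cond e a b) σ (T + 1) Q := by
  by_cases he : e.eval w σ.regs = 0
  · obtain ⟨t, τ, ht, hx, hQ⟩ := h' he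
    exact ⟨t + 1, τ, by omega, .condFalse he hx, hQ⟩
  · obtain ⟨t, τ, ht, hx, hQ⟩ := h he
    exact ⟨t + 1, τ, by omega, .condTrue he hx, hQ⟩

/-- Invariant rule with a prescribed number of rounds: each costs its body and one test, and a final
test leaves the loop. Induction on the number of rounds left. -/
theorem loop (N : ℕ) (I : ℕ → Config → Prop) (h₀ : I 0 σ)
    (hstep : ∀ i < N, ∀ τ, Frame a σ τ → I i τ →
      e.eval w τ.regs ≠ 0 ∧ Reaches w s ω a τ T (I (i + 1)))
    (hend : ∀ τ, Frame a σ τ → I N τ → e.eval w τ.regs = 0) :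
    Reaches w s ω (.loop e a) σ (N * (T + 1) + 1) (I N) := by
  have key : ∀ d i, i + d = N → ∀ τ, Frame a σ τ → I i τ →
      Reaches w s ω (.loop e a) τ (d * (T + 1) + 1) (I N) := by
    intro d
    induction d with
    | zero =>
      rintro i rfl τ hF hI
      exact ⟨1, τ, by omega, .loopDone (hend τ hF hI), hI⟩
    | succ d ih =>
      intro i hi τ hF hI
      obtain ⟨he, t, τ', ht, hx, hI'⟩ := hstep i (by omega) τ hF hI
      obtain ⟨t', τ'', ht', hx', hQ⟩ := ih (i + 1) (by omega) τ' (hF.trans hx.frame) hI'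
      refine ⟨t + t' + 1, τ'', ?_, .loopStep he hx hx', hQ⟩
      rw [Nat.add_one_mul]; omega
  exact key N 0 (by omega) σ (Frame.refl _ _) h₀

end Reaches

/-- `for r := 0, …, q - 1 do a`, where `r` and `q` are registers. -/
def forLoop (r q : ℕ) (a : Cmd) : Cmd :=
  block [.set r 0, .loop (.bin .lt (.reg r) (.reg q)) (block [a, .set r (.reg r + 1)])]

/-- A round pays for the body, the increment, the closing `skip` and the test, hence T + 3. The
invariant is required again only after the counter has advanced, hence the `setReg` in `hstep`. -/
theorem Reaches.forLoop {a : Cmd} {σ : Config} {T r q : ℕ} (hw : 0 < w) (N : ℕ)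
    (hq : σ.regs q = N) (hN : N < 2 ^ w) (hr : a.writes r = false) (hq' : a.writes q = false)
    (hrq : q ≠ r) (I : ℕ → Config → Prop) (h₀ : I 0 (σ.setReg r 0))
    (hstep : ∀ i < N, ∀ τ, Frame (forLoop r q a) σ τ → τ.regs r = i → I i τ →
      Reaches w s ω a τ T (fun υ => I (i + 1) (υ.setReg r (i + 1)))) :
    Reaches w s ω (forLoop r q a) σ (N * (T + 3) + 3) (I N) := by
  have hw' : 1 < 2 ^ w := Nat.one_lt_two_pow hw.ne'
  have hF : ∀ τ, Frame (block [a, .set r (.reg r + 1)]) (σ.setReg r 0) τ →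
      Frame (WordRAM.forLoop r q a) σ τ := by
    refine fun τ h => ⟨fun i hi => ?_, fun hi => ?_, fun hi => ?_, fun hi => ?_⟩
    · simp [WordRAM.forLoop, block, Cmd.writes] at hi
      rw [h.regs i (by simp [block, Cmd.writes, hi])]
      simp [Ne.symm hi.1]
    · exact h.mem (by simpa [WordRAM.forLoop, block, Cmd.stores] using hi)
    · exact h.pos (by simpa [WordRAM.forLoop, block, Cmd.draws] using hi)
    · exact h.out (by simpa [WordRAM.forLoop, block, Cmd.emits] using hi)
  have hqF : ∀ τ, Frame (block [a, .set r (.reg r + 1)]) (σ.setReg r 0) τ → τ.regs q = N := by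
    intro τ h
    rw [h.regs q (by simp [block, Cmd.writes, hq', hrq.symm])]
    simp [hrq, hq]
  have : Reaches w s ω (WordRAM.forLoop r q a) σ ((N * (T + 2 + 1) + 1) + 1 + 1) (I N) := by
    refine Reaches.set r 0 (eval_lit (by omega)) ?_
    refine Reaches.cons (R := fun τ => τ.regs r = N ∧ I N τ)
      (Reaches.loop N (fun i τ => τ.regs r = i ∧ I i τ) ⟨by simp, h₀⟩ ?_ ?_)
      (T₂ := 1) (fun τ _ h => Reaches.nil h.2)
    · rintro i hi τ hτ ⟨hri, hI⟩
      refine ⟨?_, ?_⟩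
      · rw [eval_lt hw (eval_reg hri) (eval_reg (hqF τ hτ)), if_pos hi]; omega
      · refine Reaches.cons (hstep i hi τ (hF τ hτ) hri hI) fun υ hυ h => ?_
        refine Reaches.set r (i + 1) (eval_add (eval_reg ?_) (eval_lit hw') (by omega)) ?_
        · rw [hυ.regs r hr, hri]
        · exact Reaches.nil ⟨by simp, h⟩
    · rintro τ hτ ⟨hri, -⟩
      rw [eval_lt hw (eval_reg hri) (eval_reg (hqF τ hτ)), if_neg (lt_irrefl _)]
  exact this.weaken (by rw [Nat.add_assoc T]) fun _ _ h => h

end WordRAM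

/-! ## Sketches of a graph by multiply-shift hashing -/

namespace DynStream

open WordRAM

/-- Multiply-shift hashing on `w`-bit words. -/
def mulShift (w a b r x : ℕ) : ℕ := (a * x + b) % 2 ^ w / 2 ^ r

/-- The row of a vertex in sketch `t`. -/
def rowOf {w : ℕ} (l : ℕ) (ω : ℕ → Fin (2 ^ w)) (t x : ℕ) : ℕ :=
  mulShift w (ω (4 * t)) (ω (4 * t + 1)) (w - l) x

/-- The column of a vertex in sketch `t`.  The vertex is sampled if this is less than `2 ^ l`. -/
def colOf {w : ℕ} (l : ℕ) (ω : ℕ → Fin (2 ^ w)) (t z : ℕ) : ℕ :=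
  mulShift w (ω (4 * t + 2)) (ω (4 * t + 3)) (w - l - t % w) z

/-- The ordered pairs that fall into a cell of sketch `t`. -/
def bucket {w : ℕ} (l : ℕ) (ω : ℕ → Fin (2 ^ w)) (P : Finset (ℕ × ℕ)) (t r b : ℕ) :
    Finset (ℕ × ℕ) :=
  P.filter fun p => rowOf l ω t p.1 = r ∧ colOf l ω t p.2 = b

/-- Index of a cell. -/
def cellIdx (l t r b : ℕ) : ℕ := (t * 2 ^ l + r) * 2 ^ l + b

/-- A cell index is a number with base-2^l digits r and b below t, and digits are unique. -/
theorem cellIdx_inj {l t r b t' r' b' : ℕ} (hr : r < 2 ^ l) (hb : b < 2 ^ l) (hr' : r' < 2 ^ l)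
    (hb' : b' < 2 ^ l) (h : cellIdx l t r b = cellIdx l t' r' b') :
    t = t' ∧ r = r' ∧ b = b' := by
  have aux : ∀ {q q' c c' : ℕ}, c < 2 ^ l → c' < 2 ^ l → q * 2 ^ l + c = q' * 2 ^ l + c' →
      q = q' ∧ c = c' := by
    intro q q' c c' hc hc' h
    have h₁ := congrArg (· / 2 ^ l) h
    have h₂ := congrArg (· % 2 ^ l) h
    simp only [Nat.add_comm (_ * _), Nat.add_mul_mod_self_right, Nat.mod_eq_of_lt hc,
      Nat.mod_eq_of_lt hc'] at h₂
    simp only [Nat.add_comm (_ * _), Nat.add_mul_div_right _ _ (Nat.two_pow_pos l),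
      Nat.div_eq_of_lt hc, Nat.div_eq_of_lt hc'] at h₁
    omega
  obtain ⟨h₁, h₂⟩ := aux hb hb' h
  obtain ⟨h₃, h₄⟩ := aux hr hr' h₁
  exact ⟨h₃, h₄, h₂⟩

theorem cellIdx_lt {l t r b M : ℕ} (ht : t < M) (hr : r < 2 ^ l) (hb : b < 2 ^ l) :
    cellIdx l t r b < M * (2 ^ l * 2 ^ l) := by
  unfold cellIdx
  have h₁ : t * 2 ^ l + r + 1 ≤ M * 2 ^ l := by
    calc t * 2 ^ l + r + 1 ≤ (t + 1) * 2 ^ l := by rw [Nat.add_one_mul]; omega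
      _ ≤ _ := Nat.mul_le_mul_right _ ht
  calc (t * 2 ^ l + r) * 2 ^ l + b < (t * 2 ^ l + r + 1) * 2 ^ l := by
        rw [Nat.add_one_mul (t * 2 ^ l + r)]; omega
    _ ≤ M * 2 ^ l * 2 ^ l := Nat.mul_le_mul_right _ h₁
    _ = _ := Nat.mul_assoc ..

/-- The relations between word length, sketch size, matching size and number of vertices under
which the programs work without overflow. -/
structure Sizes (w l k n : ℕ) : Prop where
  one_le_k : 1 ≤ k
  le_width : 256 * k ≤ 2 ^ l
  width_le : 2 ^ l ≤ 512 * k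
  le_word : l ≤ w
  four_le_word : 4 ≤ w
  space : 32 * (w * w * (2 ^ l * 2 ^ l)) ≤ 2 ^ w
  one_le_n : 1 ≤ n
  cube : 16 * (n * n * n) ≤ 2 ^ w

/-- Number of memory words. -/
def memSize (w l : ℕ) : ℕ := 16 * (w * w * (2 ^ l * 2 ^ l))

theorem Sizes.width_le_cells {w l k n : ℕ} (h : Sizes w l k n) :
    2 ^ l ≤ w * w * (2 ^ l * 2 ^ l) := by
  have := h.four_le_word
  have : 1 ≤ w * w := Nat.mul_pos (by omega) (by omega)
  have := Nat.two_pow_pos l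
  nlinarith [Nat.mul_le_mul this this]

theorem Sizes.word_sq_le_cells {w l k n : ℕ} (_h : Sizes w l k n) :
    w * w ≤ w * w * (2 ^ l * 2 ^ l) :=
  Nat.le_mul_of_pos_right _ (Nat.mul_pos (Nat.two_pow_pos l) (Nat.two_pow_pos l))

theorem Sizes.n_le_cube {w l k n : ℕ} (h : Sizes w l k n) : n ≤ n * n * n := by
  have := h.one_le_n
  nlinarith [Nat.mul_le_mul this this]

theorem Sizes.word_pos {w l k n : ℕ} (h : Sizes w l k n) : 0 < w := by
  have := h.four_le_word; omega

/-- Here the wraparound is wanted: reduction modulo 2^w is part of the hash function, so the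
operands need no bounds. -/
theorem eval_shr {w : ℕ} {ρ : ℕ → ℕ} {ea eb ex er : Expr} {a b x r : ℕ}
    (ha : ea.eval w ρ = a) (hb : eb.eval w ρ = b) (hx : ex.eval w ρ = x) (hr : er.eval w ρ = r) :
    (Expr.bin .shr (ea * ex + eb) er).eval w ρ = mulShift w a b r x := by
  subst ha hb hx hr
  show ((((_ * _) % 2 ^ w + _) % 2 ^ w) >>> _) % 2 ^ w = _
  rw [Nat.mod_add_mod, Nat.shiftRight_eq_div_pow]
  exact Nat.mod_eq_of_lt ((Nat.div_le_self _ _).trans_lt (Nat.mod_lt _ (Nat.two_pow_pos w)))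

theorem rowOf_lt {w l : ℕ} (hl : l ≤ w) (ω : ℕ → Fin (2 ^ w)) (t x : ℕ) :
    rowOf l ω t x < 2 ^ l := by
  unfold rowOf mulShift
  rw [Nat.div_lt_iff_lt_mul (Nat.two_pow_pos _), ← pow_add, Nat.add_sub_cancel' hl]
  exact Nat.mod_lt _ (Nat.two_pow_pos w)

/-- The seeds of the hash functions are in memory. -/
def SeedMem {w : ℕ} (ω : ℕ → Fin (2 ^ w)) (mem : ℕ → ℕ) : Prop :=
  ∀ t < w * w, mem (16 * t + 4) = ω (4 * t) ∧ mem (16 * t + 5) = ω (4 * t + 1) ∧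
    mem (16 * t + 6) = ω (4 * t + 2) ∧ mem (16 * t + 7) = ω (4 * t + 3)

/-- The contents of one cell: the number of pairs and the sums of their components. -/
def CellAt {w : ℕ} (l : ℕ) (ω : ℕ → Fin (2 ^ w)) (P : Finset (ℕ × ℕ)) (mem : ℕ → ℕ)
    (t r b : ℕ) : Prop :=
  mem (16 * cellIdx l t r b + 8) = ∑ _p ∈ bucket l ω P t r b, 1 ∧
  mem (16 * cellIdx l t r b + 9) = ∑ p ∈ bucket l ω P t r b, p.1 ∧
  mem (16 * cellIdx l t r b + 10) = ∑ p ∈ bucket l ω P t r b, p.2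

/-- The sketches in memory are those of the set `P` of ordered pairs. -/
def CellMem {w : ℕ} (l : ℕ) (ω : ℕ → Fin (2 ^ w)) (P : Finset (ℕ × ℕ)) (mem : ℕ → ℕ) : Prop :=
  ∀ t < w * w, ∀ r < 2 ^ l, ∀ b < 2 ^ l, CellAt l ω P mem t r b

/-- `P'` arises from `P` by insertion (`op = 0`) or deletion (`op = 1`) of `p`. -/
def Toggle (op : ℕ) (p : ℕ × ℕ) (P P' : Finset (ℕ × ℕ)) : Prop :=
  (op = 0 ∧ p ∉ P ∧ P' = insert p P) ∨ (op = 1 ∧ p ∈ P ∧ P' = P.erase p)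

theorem Toggle.op_le {op : ℕ} {p : ℕ × ℕ} {P P' : Finset (ℕ × ℕ)} (h : Toggle op p P P') :
    op ≤ 1 := by
  rcases h with h | h <;> omega

/-- One formula covers both operations, and the machine evaluates it without a branch. Adding before
subtracting twice keeps the truncated subtraction exact. -/
theorem Toggle.sum_filter {op : ℕ} {p : ℕ × ℕ} {P P' : Finset (ℕ × ℕ)} (h : Toggle op p P P')
    (q : ℕ × ℕ → Prop) [DecidablePred q] (f : ℕ × ℕ → ℕ) :
    ∑ x ∈ P'.filter q, f x =
      if q p then (∑ x ∈ P.filter q, f x) + f p - 2 * op * f p else ∑ x ∈ P.filter q, f x := by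
  rcases h with ⟨rfl, hp, rfl⟩ | ⟨rfl, hp, rfl⟩
  · rw [Finset.filter_insert]
    split_ifs with hq
    · rw [Finset.sum_insert (by simp [hp])]; omega
    · rfl
  · rw [Finset.filter_erase]
    split_ifs with hq
    · have := Finset.sum_erase_add (P.filter q) f (a := p) (by simp [hp, hq])
      omega
    · rw [Finset.erase_eq_of_notMem (by simp [hq])]

/-- A cell never holds more than n² pairs. With m = n this gives the bound n³ that `Sizes.cube`
keeps well below 2^w. -/
theorem sum_bucket_le {w l n : ℕ} {ω : ℕ → Fin (2 ^ w)} {P : Finset (ℕ × ℕ)}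
    (hP : P ⊆ Finset.range n ×ˢ Finset.range n) (t r b : ℕ) (f : ℕ × ℕ → ℕ) (m : ℕ)
    (hf : ∀ p ∈ P, f p ≤ m) : ∑ p ∈ bucket l ω P t r b, f p ≤ n * n * m := by
  calc ∑ p ∈ bucket l ω P t r b, f p ≤ ∑ p ∈ P, f p :=
        Finset.sum_le_sum_of_subset (Finset.filter_subset _ _)
    _ ≤ P.card * m := by simpa using Finset.sum_le_card_nsmul _ _ _ hf
    _ ≤ _ := Nat.mul_le_mul_right _ (by simpa using Finset.card_le_card hP)

/-- Registers that carry the parameters in all programs. -/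
structure ParamRegs (w l : ℕ) (ρ : ℕ → ℕ) : Prop where
  width : ρ 3 = 2 ^ l
  word : ρ 4 = w
  shift : ρ 5 = w - l
  reps : ρ 6 = w * w

/-! ### The program that updates the sketches -/

/-- Address of the entry of an array with the given tag. -/
def addr (e : Expr) (tag : Expr) : Expr := 16 * e + tag

/-- All arrays are interleaved with stride 16, so their disjointness is a congruence modulo 16 that
`omega` decides. Tag 0 holds parameters and the matching size (addresses 0, 16, 32, 48), tag 1 the
scratch array, tags 2 and 3 the matching, tags 4 to 7 the seeds, tags 8 to 10 the cells. -/
theorem eval_addr {w : ℕ} {ρ : ℕ → ℕ} {e tag : Expr} {i g : ℕ} (he : e.eval w ρ = i)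
    (ht : tag.eval w ρ = g) (h16 : 16 < 2 ^ w) (h : 16 * i + g < 2 ^ w) :
    (addr e tag).eval w ρ = 16 * i + g :=
  eval_add (eval_mul (eval_lit h16) he (by omega)) ht h

/-- Loads the seeds of sketch `reg 12`. -/
def loadSeeds (l : List Cmd) : List Cmd :=
  .load 13 (addr (.reg 12) 4) :: .load 14 (addr (.reg 12) 5) ::
  .load 15 (addr (.reg 12) 6) :: .load 16 (addr (.reg 12) 7) :: l

/-- The row of a vertex in sketch `reg 12`. -/
def rowExpr (x : Expr) : Expr := .bin .shr (.reg 13 * x + .reg 14) (.reg 5)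

/-- The column of a vertex in sketch `reg 12`. -/
def colExpr (z : Expr) : Expr := .bin .shr (.reg 15 * z + .reg 16) (.reg 5 - .reg 12 % .reg 4)

/-- Index of the cell in row `reg 17` of sketch `reg 12` and the given column. -/
def idxExpr (b : Expr) : Expr := (.reg 12 * .reg 3 + .reg 17) * .reg 3 + b

/-- Adds or removes a value in a cell. -/
def addToCell (tag f : Expr) (l : List Cmd) : List Cmd :=
  .load 20 (addr (.reg 19) tag) ::
  .store (addr (.reg 19) tag) (.reg 20 + f - 2 * .reg 0 * f) :: l

/-- Processes the pair `(reg 10, reg 11)` in sketch `reg 12`. -/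
def sketchStep : Cmd :=
  block <| loadSeeds
    [.set 17 (rowExpr (.reg 10)), .set 18 (colExpr (.reg 11)),
     .cond (.bin .lt (.reg 18) (.reg 3))
      (block <| .set 19 (idxExpr (.reg 18)) ::
        (addToCell 8 1 <| addToCell 9 (.reg 10) <| addToCell 10 (.reg 11) [])) .skip]

/-- Processes the pair `(reg 10, reg 11)` in all sketches. -/
def sketchPair : Cmd := forLoop 12 6 sketchStep

variable {w l k n : ℕ} {ω : ℕ → Fin (2 ^ w)}

theorem reaches_loadSeeds (hS : Sizes w l k n) {c : List Cmd} {σ : Config} {T t : ℕ}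
    {Q : Config → Prop} (ht : t < w * w) (h12 : σ.regs 12 = t) (hsd : SeedMem ω σ.mem)
    (h : Reaches w (memSize w l) ω (block c)
      ((((σ.setReg 13 (ω (4 * t))).setReg 14 (ω (4 * t + 1))).setReg 15 (ω (4 * t + 2))).setReg 16
        (ω (4 * t + 3))) T Q) :
    Reaches w (memSize w l) ω (block (loadSeeds c)) σ (T + 4) Q := by
  have h16 := hS.space
  have hc := hS.word_sq_le_cells
  have hm : memSize w l = 16 * (w * w * (2 ^ l * 2 ^ l)) := rfl
  obtain ⟨h4, h5, h6, h7⟩ := hsd t ht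
  refine Reaches.load 13 (16 * t + 4)
    (eval_addr (eval_reg h12) (eval_lit (by omega)) (by omega) (by omega)) (by omega) ?_
  refine Reaches.load 14 (16 * t + 5)
    (eval_addr (eval_reg (by simp [h12])) (eval_lit (by omega)) (by omega) (by omega))
    (by omega) ?_
  refine Reaches.load 15 (16 * t + 6)
    (eval_addr (eval_reg (by simp [h12])) (eval_lit (by omega)) (by omega) (by omega))
    (by omega) ?_
  refine Reaches.load 16 (16 * t + 7)
    (eval_addr (eval_reg (by simp [h12])) (eval_lit (by omega)) (by omega) (by omega))
    (by omega) ?_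
  simpa only [Config.setReg_mem, h4, h5, h6, h7] using h

theorem eval_rowExpr {ρ : ℕ → ℕ} {e : Expr} {t x : ℕ} (h13 : ρ 13 = ω (4 * t))
    (h14 : ρ 14 = ω (4 * t + 1)) (h5 : ρ 5 = w - l) (he : e.eval w ρ = x) :
    (rowExpr e).eval w ρ = rowOf l ω t x :=
  eval_shr (eval_reg h13) (eval_reg h14) he (eval_reg h5)

/-- The shift shrinks with the level t mod w. Its truncation at 0 matters only for levels above w -
l, which the probability estimate never uses. -/
theorem eval_colExpr {ρ : ℕ → ℕ} {e : Expr} {t z : ℕ} (hw : 0 < w) (h15 : ρ 15 = ω (4 * t + 2))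
    (h16 : ρ 16 = ω (4 * t + 3)) (h5 : ρ 5 = w - l) (h4 : ρ 4 = w) (h12 : ρ 12 = t)
    (he : e.eval w ρ = z) : (colExpr e).eval w ρ = colOf l ω t z := by
  have := Nat.mod_lt t hw
  have : w < 2 ^ w := Nat.lt_two_pow_self
  exact eval_shr (eval_reg h15) (eval_reg h16) he
    (eval_sub (eval_reg h5) (eval_mod (eval_reg h12) (eval_reg h4) (by omega)) (by omega))

theorem eval_idxExpr (hS : Sizes w l k n) {ρ : ℕ → ℕ} {e : Expr} {t r b : ℕ} (ht : t < w * w)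
    (hr : r < 2 ^ l) (hb : b < 2 ^ l) (h12 : ρ 12 = t) (h3 : ρ 3 = 2 ^ l) (h17 : ρ 17 = r)
    (he : e.eval w ρ = b) : (idxExpr e).eval w ρ = cellIdx l t r b := by
  have h16 := hS.space
  have := cellIdx_lt ht hr hb
  have h1 : cellIdx l t r b = (t * 2 ^ l + r) * 2 ^ l + b := rfl
  have h2 : t * 2 ^ l + r ≤ (t * 2 ^ l + r) * 2 ^ l := Nat.le_mul_of_pos_right _ (Nat.two_pow_pos l)
  exact eval_add (eval_mul (eval_add (eval_mul (eval_reg h12) (eval_reg h3) (by omega))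
    (eval_reg h17) (by omega)) (eval_reg h3) (by omega)) he (by omega)

theorem reaches_addToCell (hS : Sizes w l k n) {tag f : Expr} {c : List Cmd} {σ : Config}
    {T i g y x op : ℕ} {Q : Config → Prop} (hi : i < w * w * (2 ^ l * 2 ^ l)) (hg : g < 16)
    (htag : ∀ ρ, tag.eval w ρ = g) (h19 : σ.regs 19 = i) (hop : σ.regs 0 = op) (hop1 : op ≤ 1)
    (hf : ∀ v, f.eval w (σ.setReg 20 v).regs = x) (hx : x ≤ n * n * n)
    (hv : σ.mem (16 * i + g) = y) (hy : y ≤ n * n * n)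
    (h : Reaches w (memSize w l) ω (block c)
      ((σ.setReg 20 y).setMem (16 * i + g) (y + x - 2 * op * x)) T Q) :
    Reaches w (memSize w l) ω (block (addToCell tag f c)) σ (T + 2) Q := by
  subst hv
  have h16 := hS.space
  have hc := hS.cube
  have hm : memSize w l = 16 * (w * w * (2 ^ l * 2 ^ l)) := rfl
  have h2 : 2 * op * x ≤ 2 * x := Nat.mul_le_mul_right _ (by omega)
  have hn := hS.n_le_cube
  have := hS.one_le_n
  refine Reaches.load 20 (16 * i + g)
    (eval_addr (eval_reg h19) (htag _) (by omega) (by omega)) (by omega) ?_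
  refine Reaches.store (16 * i + g) _
    (eval_addr (eval_reg (by simp [h19])) (htag _) (by omega) (by omega)) (by omega)
    (eval_sub (eval_add (eval_reg (by simp; rfl)) (hf _) (by omega))
      (eval_mul (eval_mul (eval_lit (by omega)) (eval_reg (by simpa using hop)) (by omega)) (hf _)
        (by omega)) (by omega)) ?_
  exact h

/-- A pair touches one cell of a sketch, or none if its second vertex is not sampled. The last two
clauses protect the other sketches and everything with a tag below 8. -/
theorem reaches_sketchStep (hS : Sizes w l k n) {σ : Config} {t op x z : ℕ}
    {P P' : Finset (ℕ × ℕ)} (hp : ParamRegs w l σ.regs) (h12 : σ.regs 12 = t) (ht : t < w * w)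
    (h0 : σ.regs 0 = op) (h10 : σ.regs 10 = x) (h11 : σ.regs 11 = z)
    (hsd : SeedMem ω σ.mem) (hP : P ⊆ Finset.range n ×ˢ Finset.range n) (hx : x < n) (hz : z < n)
    (hT : Toggle op (x, z) P P')
    (hcell : ∀ r < 2 ^ l, ∀ b < 2 ^ l, CellAt l ω P σ.mem t r b) :
    Reaches w (memSize w l) ω sketchStep σ 17 fun τ =>
      (∀ r < 2 ^ l, ∀ b < 2 ^ l, CellAt l ω P' τ.mem t r b) ∧
      (∀ t' r b, t' ≠ t → r < 2 ^ l → b < 2 ^ l → ∀ g < 16,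
        τ.mem (16 * cellIdx l t' r b + g) = σ.mem (16 * cellIdx l t' r b + g)) ∧
      ∀ a, a % 16 < 8 → τ.mem a = σ.mem a := by
  have hrow := rowOf_lt hS.le_word ω t x
  have hsum : ∀ (r b : ℕ) (f : ℕ × ℕ → ℕ), ∑ p ∈ bucket l ω P' t r b, f p =
      if rowOf l ω t x = r ∧ colOf l ω t z = b then
        (∑ p ∈ bucket l ω P t r b, f p) + f (x, z) - 2 * op * f (x, z)
      else ∑ p ∈ bucket l ω P t r b, f p := fun r b f => hT.sum_filter _ f
  have hn := hS.n_le_cube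
  have hn1 := hS.one_le_n
  have h16 := hS.space
  have hcube := hS.cube
  refine reaches_loadSeeds hS (T := 13) ht h12 hsd ?_
  refine Reaches.set 17 (rowOf l ω t x)
    (eval_rowExpr (by simp) (by simp) (by simp [hp.shift]) (eval_reg (by simp [h10]))) ?_
  refine Reaches.set 18 (colOf l ω t z)
    (eval_colExpr hS.word_pos (by simp) (by simp) (by simp [hp.shift]) (by simp [hp.word])
      (by simp [h12]) (eval_reg (by simp [h11]))) ?_
  refine Reaches.cons (T₁ := 10) (T₂ := 1) (Reaches.cond (T := 9) (fun he => ?_) (fun he => ?_))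
    (fun τ _ h => Reaches.nil h)
  · rw [eval_lt hS.word_pos (eval_reg (a := colOf l ω t z) (by simp))
      (eval_reg (a := 2 ^ l) (by simp [hp.width]))] at he
    have hcol : colOf l ω t z < 2 ^ l := by
      by_contra hc; simp [hc] at he
    obtain ⟨m8, m9, m10⟩ := hcell _ hrow _ hcol
    have hi := cellIdx_lt ht hrow hcol
    refine Reaches.set 19 (cellIdx l t (rowOf l ω t x) (colOf l ω t z))
      (eval_idxExpr hS ht hrow hcol (by simp [h12]) (by simp [hp.width]) (by simp)
        (eval_reg (by simp))) ?_
    refine reaches_addToCell hS (g := 8) (op := op) (x := 1) hi (by omega)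
      (fun _ => eval_lit (by omega)) (by simp) (by simp [h0]) hT.op_le
      (fun _ => eval_lit (by omega)) (by omega) (by simpa using m8)
      (by simpa using sum_bucket_le hP t _ _ (fun _ => 1) n (fun _ _ => hn1)) ?_
    refine reaches_addToCell hS (g := 9) (op := op) (x := x) hi (by omega)
      (fun _ => eval_lit (by omega)) (by simp) (by simp [h0]) hT.op_le
      (fun _ => eval_reg (by simp [h10])) (by omega) (by simpa using m9)
      (sum_bucket_le hP t _ _ Prod.fst n fun p hp => by
        have := hP hp; simp at this; omega) ?_
    refine reaches_addToCell hS (g := 10) (op := op) (x := z) hi (by omega)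
      (fun _ => eval_lit (by omega)) (by simp) (by simp [h0]) hT.op_le
      (fun _ => eval_reg (by simp [h11])) (by omega) (by simpa using m10)
      (sum_bucket_le hP t _ _ Prod.snd n fun p hp => by
        have := hP hp; simp at this; omega) ?_
    refine Reaches.nil ⟨fun r hr b hb => ?_, fun t' r b ht' hr hb g hg => ?_, fun a ha => ?_⟩
    · have hc := hcell r hr b hb
      unfold CellAt at hc ⊢
      simp only [hsum]
      by_cases hrb : rowOf l ω t x = r ∧ colOf l ω t z = b
      · obtain ⟨rfl, rfl⟩ := hrb
        simp
      · rw [if_neg hrb, if_neg hrb, if_neg hrb]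
        have hne : cellIdx l t r b ≠ cellIdx l t (rowOf l ω t x) (colOf l ω t z) := fun h => by
          have := cellIdx_inj hr hb hrow hcol h
          exact hrb ⟨this.2.1.symm, this.2.2.symm⟩
        simp only [Config.setMem_mem, Config.setReg_mem]
        refine ⟨?_, ?_, ?_⟩
        · rw [if_neg (by omega), if_neg (by omega), if_neg (by omega)]; exact hc.1
        · rw [if_neg (by omega), if_neg (by omega), if_neg (by omega)]; exact hc.2.1
        · rw [if_neg (by omega), if_neg (by omega), if_neg (by omega)]; exact hc.2.2
    · have hne : cellIdx l t' r b ≠ cellIdx l t (rowOf l ω t x) (colOf l ω t z) := fun h =>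
        ht' (cellIdx_inj hr hb hrow hcol h).1
      simp only [Config.setMem_mem, Config.setReg_mem]
      rw [if_neg (by omega), if_neg (by omega), if_neg (by omega)]
    · simp only [Config.setMem_mem, Config.setReg_mem]
      rw [if_neg (by omega), if_neg (by omega), if_neg (by omega)]
  · rw [eval_lt hS.word_pos (eval_reg (a := colOf l ω t z) (by simp))
      (eval_reg (a := 2 ^ l) (by simp [hp.width]))] at he
    have hcol : ¬ colOf l ω t z < 2 ^ l := by
      intro hc; simp [hc] at he
    refine Reaches.skip ⟨fun r hr b hb => ?_, fun _ _ _ _ _ _ _ _ => rfl, fun _ _ => rfl⟩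
    have hc := hcell r hr b hb
    unfold CellAt at hc ⊢
    simp only [hsum]
    rw [if_neg (by omega), if_neg (by omega), if_neg (by omega)]
    exact hc

theorem reaches_sketchPair (hS : Sizes w l k n) {σ : Config} {op x z : ℕ}
    {P P' : Finset (ℕ × ℕ)} (hp : ParamRegs w l σ.regs)
    (h0 : σ.regs 0 = op) (h10 : σ.regs 10 = x) (h11 : σ.regs 11 = z)
    (hsd : SeedMem ω σ.mem) (hP : P ⊆ Finset.range n ×ˢ Finset.range n) (hx : x < n) (hz : z < n)
    (hT : Toggle op (x, z) P P') (hcell : CellMem l ω P σ.mem) :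
    Reaches w (memSize w l) ω sketchPair σ (w * w * 20 + 3) fun τ =>
      CellMem l ω P' τ.mem ∧ ∀ a, a % 16 < 8 → τ.mem a = σ.mem a := by
  have h16 := hS.space
  have hws := hS.word_sq_le_cells
  have hlt : w * w < 2 ^ w := by
    have := hS.word_pos
    have : 0 < w * w := Nat.mul_pos this this
    omega
  -- Invariant: the sketches already visited describe `P'`, the remaining ones still `P`.
  refine (Reaches.forLoop hS.word_pos (w * w) hp.reps hlt rfl rfl (by decide)
    (fun t τ => (∀ t' < w * w, ∀ r < 2 ^ l, ∀ b < 2 ^ l,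
      CellAt l ω (if t' < t then P' else P) τ.mem t' r b) ∧
      ∀ a, a % 16 < 8 → τ.mem a = σ.mem a) ?_ ?_).weaken le_rfl ?_
  · exact ⟨fun t' ht' r hr b hb => by simpa using hcell t' ht' r hr b hb, fun _ _ => rfl⟩
  · rintro t ht τ hF h12 ⟨hI, hlow⟩
    refine (reaches_sketchStep hS (P := P) (P' := P') (σ := τ) (t := t) (op := op) (x := x) (z := z)
      ⟨?_, ?_, ?_, ?_⟩ h12 ht ?_ ?_ ?_ ?_ hP hx hz hT ?_).weaken le_rfl ?_
    · rw [hF.regs 3 rfl, hp.width]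
    · rw [hF.regs 4 rfl, hp.word]
    · rw [hF.regs 5 rfl, hp.shift]
    · rw [hF.regs 6 rfl, hp.reps]
    · rw [hF.regs 0 rfl, h0]
    · rw [hF.regs 10 rfl, h10]
    · rw [hF.regs 11 rfl, h11]
    · intro t' ht'
      rw [hlow _ (by omega), hlow _ (by omega), hlow _ (by omega), hlow _ (by omega)]
      exact hsd t' ht'
    · intro r hr b hb
      simpa using hI t ht r hr b hb
    · rintro υ - ⟨h1, h2, h3⟩
      refine ⟨fun t' ht' r hr b hb => ?_, fun a ha => (h3 a ha).trans (hlow a ha)⟩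
      rcases lt_trichotomy t' t with h | rfl | h
      · have := hI t' ht' r hr b hb
        rw [if_pos h] at this
        rw [if_pos (by omega)]
        unfold CellAt at this ⊢
        simpa [h2 t' r b (by omega) hr hb] using this
      · simpa using h1 r hr b hb
      · have := hI t' ht' r hr b hb
        rw [if_neg (by omega)] at this
        rw [if_neg (by omega)]
        unfold CellAt at this ⊢
        simpa [h2 t' r b (by omega) hr hb] using this
  · rintro τ - ⟨h, hlow⟩
    refine ⟨fun t ht r hr b hb => ?_, hlow⟩
    simpa [ht] using h t ht r hr b hb

end DynStream

/-! ### The program that looks for a free neighbour -/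

namespace DynStream

open WordRAM

/-- In sketch `t` the neighbour `y` of `u` can be read off from its cell. -/
def Recovered {w : ℕ} (l : ℕ) (ω : ℕ → Fin (2 ^ w)) (P : Finset (ℕ × ℕ)) (t u y : ℕ) : Prop :=
  colOf l ω t y < 2 ^ l ∧ bucket l ω P t (rowOf l ω t u) (colOf l ω t y) = {(u, y)}

theorem Recovered.mem {w l : ℕ} {ω : ℕ → Fin (2 ^ w)} {P : Finset (ℕ × ℕ)} {t u y : ℕ}
    (h : Recovered l ω P t u y) : (u, y) ∈ P :=
  Finset.filter_subset _ _ (h.2.symm ▸ Finset.mem_singleton_self _ :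
    (u, y) ∈ bucket l ω P t (rowOf l ω t u) (colOf l ω t y))

/-- The entry computed from the cell in column `b` and the row of `u`: one more than the recovered
neighbour of `u`, or `0`. -/
def candidate {w : ℕ} (l : ℕ) (ω : ℕ → Fin (2 ^ w)) (P : Finset (ℕ × ℕ)) (t u b : ℕ) : ℕ :=
  (if ∑ _p ∈ bucket l ω P t (rowOf l ω t u) b, 1 = 1 then 1 else 0) *
  (if ∑ p ∈ bucket l ω P t (rowOf l ω t u) b, p.1 = u then 1 else 0) *
  (∑ p ∈ bucket l ω P t (rowOf l ω t u) b, p.2 + 1)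

theorem Recovered.candidate_eq {w l : ℕ} {ω : ℕ → Fin (2 ^ w)} {P : Finset (ℕ × ℕ)} {t u y : ℕ}
    (h : Recovered l ω P t u y) : candidate l ω P t u (colOf l ω t y) = y + 1 := by
  simp [candidate, h.2]

/-- No false positives, whatever the seeds: with count one the two sums are the components of the
only pair in the cell, and the test on the first component identifies it as a pair at u. -/
theorem recovered_of_candidate {w l : ℕ} {ω : ℕ → Fin (2 ^ w)} {P : Finset (ℕ × ℕ)} {t u b : ℕ}
    (hb : b < 2 ^ l) (h : candidate l ω P t u b ≠ 0) :
    ∃ y, candidate l ω P t u b = y + 1 ∧ colOf l ω t y = b ∧ Recovered l ω P t u y := by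
  unfold candidate at h ⊢
  split_ifs at h ⊢ with h₁ h₂
  · rw [← Finset.card_eq_sum_ones, Finset.card_eq_one] at h₁
    obtain ⟨p, hp⟩ := h₁
    simp only [hp, Finset.sum_singleton] at h₂ ⊢
    have hmem : p ∈ bucket l ω P t (rowOf l ω t u) b := hp ▸ Finset.mem_singleton_self _
    have hcol : colOf l ω t p.2 = b := (Finset.mem_filter.1 hmem).2.2
    refine ⟨p.2, by simp, hcol, by rwa [hcol], ?_⟩
    rw [hcol, hp, ← h₂]
  all_goals simp at h

/-- A vertex occurs among the first `m` edges of the stored matching. -/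
def Matched (mem : ℕ → ℕ) (m x : ℕ) : Prop :=
  ∃ i < m, mem (16 * i + 2) = x ∨ mem (16 * i + 3) = x

/-- Writes the candidate of column `reg 18` to the temporary array. -/
def collectStep : Cmd :=
  block [.set 19 (idxExpr (.reg 18)), .load 20 (addr (.reg 19) 8), .load 21 (addr (.reg 19) 9),
    .load 22 (addr (.reg 19) 10),
    .store (addr (.reg 18) 1)
      (.bin .eq (.reg 20) 1 * .bin .eq (.reg 21) (.reg 10) * (.reg 22 + 1))]

/-- Removes a matched vertex from the temporary array. -/
def unmarkStep (tag : Expr) : Cmd :=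
  block [.load 20 (addr (.reg 18) tag), .set 19 (colExpr (.reg 20)),
    .cond (.bin .lt (.reg 19) (.reg 3))
      (block [.load 21 (addr (.reg 19) 1),
        .cond (.bin .eq (.reg 21) (.reg 20 + 1)) (block [.store (addr (.reg 19) 1) 0]) .skip])
      .skip]

/-- Takes over a remaining candidate. -/
def pickStep : Cmd :=
  block [.load 20 (addr (.reg 18) 1), .cond (.reg 20) (block [.set 23 (.reg 20)]) .skip]

/-- Looks for a free neighbour of `reg 10` in sketch `reg 12`. -/
def findStep : Cmd :=
  block <| loadSeeds [.set 17 (rowExpr (.reg 10)), forLoop 18 3 collectStep,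
    forLoop 18 7 (unmarkStep 2), forLoop 18 7 (unmarkStep 3), forLoop 18 3 pickStep]

/-- Puts one more than a free neighbour of `reg 10` into `reg 23`, or `0` if none is found. -/
def findFree : Cmd := block [.set 23 0, forLoop 12 6 findStep]

variable {w l k n : ℕ} {ω : ℕ → Fin (2 ^ w)}

theorem Sizes.width_lt (hS : Sizes w l k n) : 2 ^ l < 2 ^ w := by
  have h16 := hS.space
  have hws := hS.width_le_cells
  have := Nat.two_pow_pos l
  omega

theorem reaches_collect (hS : Sizes w l k n) {σ : Config} {t u : ℕ} {P : Finset (ℕ × ℕ)}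
    (h3 : σ.regs 3 = 2 ^ l) (h12 : σ.regs 12 = t) (ht : t < w * w) (h10 : σ.regs 10 = u)
    (h17 : σ.regs 17 = rowOf l ω t u) (hP : P ⊆ Finset.range n ×ˢ Finset.range n)
    (hcell : CellMem l ω P σ.mem) :
    Reaches w (memSize w l) ω (forLoop 18 3 collectStep) σ (2 ^ l * 9 + 3) fun τ =>
      (∀ b < 2 ^ l, τ.mem (16 * b + 1) = candidate l ω P t u b) ∧
      ∀ a, a % 16 ≠ 1 → τ.mem a = σ.mem a := by
  have hrow := rowOf_lt hS.le_word ω t u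
  have h16 := hS.space
  have hwc := hS.width_le_cells
  have hm : memSize w l = 16 * (w * w * (2 ^ l * 2 ^ l)) := rfl
  have hcube := hS.cube
  have hn := hS.n_le_cube
  have hn1 := hS.one_le_n
  refine Reaches.forLoop hS.word_pos (2 ^ l) h3 hS.width_lt rfl rfl (by decide)
    (fun i τ => (∀ b < i, τ.mem (16 * b + 1) = candidate l ω P t u b) ∧
      ∀ a, a % 16 ≠ 1 → τ.mem a = σ.mem a) ⟨fun _ h => absurd h (by omega), fun _ _ => rfl⟩ ?_
  rintro i hi τ hF h18 ⟨hI, hlow⟩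
  obtain ⟨m8, m9, m10⟩ := hcell t ht _ hrow i hi
  have hidx := cellIdx_lt ht hrow hi
  rw [← hlow _ (by omega)] at m8 m9 m10
  have hle : ∑ p ∈ bucket l ω P t (rowOf l ω t u) i, p.2 ≤ n * n * n :=
    sum_bucket_le hP t _ _ Prod.snd n fun p hp => by
        have := hP hp; simp at this; omega
  refine Reaches.set 19 (cellIdx l t (rowOf l ω t u) i)
    (eval_idxExpr hS ht hrow hi (by rw [hF.regs 12 rfl, h12]) (by rw [hF.regs 3 rfl, h3])
      (by rw [hF.regs 17 rfl, h17]) (eval_reg h18)) ?_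
  refine Reaches.load 20 (16 * cellIdx l t (rowOf l ω t u) i + 8)
    (eval_addr (eval_reg (by simp)) (eval_lit (by omega)) (by omega) (by omega)) (by omega) ?_
  refine Reaches.load 21 (16 * cellIdx l t (rowOf l ω t u) i + 9)
    (eval_addr (eval_reg (by simp)) (eval_lit (by omega)) (by omega) (by omega)) (by omega) ?_
  refine Reaches.load 22 (16 * cellIdx l t (rowOf l ω t u) i + 10)
    (eval_addr (eval_reg (by simp)) (eval_lit (by omega)) (by omega) (by omega)) (by omega) ?_
  -- The product of the two flags is at most 1, so the entry is at most n³ + 1 and does not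
  -- overflow.
  have hite : ∀ (p q : Prop) [Decidable p] [Decidable q],
      (if p then 1 else 0) * (if q then 1 else 0) ≤ 1 := by
    intros; split_ifs <;> simp
  refine Reaches.store (16 * i + 1) (candidate l ω P t u i)
    (eval_addr (eval_reg (by simp [h18])) (eval_lit (by omega)) (by omega) (by omega)) (by omega)
    (eval_mul (eval_mul (eval_eq hS.word_pos (eval_reg (by simp [m8])) (eval_lit (by omega)))
      (eval_eq hS.word_pos (eval_reg (by simp [m9])) (eval_reg (by simp [hF.regs 10 rfl, h10])))
      (lt_of_le_of_lt (hite _ _) (by omega)))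
      (eval_add (eval_reg (by simp [m10])) (eval_lit (by omega)) (by omega))
      (lt_of_le_of_lt (Nat.mul_le_mul_right _ (hite _ _)) (by omega))) ?_
  refine Reaches.nil (T := 0) ⟨fun b hb => ?_, fun a ha => ?_⟩
  · simp only [Config.setMem_mem, Config.setReg_mem]
    by_cases hbi : b = i
    · subst hbi; simp
    · rw [if_neg (by omega)]; exact hI b (by omega)
  · simp only [Config.setMem_mem, Config.setReg_mem]
    rw [if_neg (by omega)]; exact hlow a ha

/-- A matched vertex can only sit in its own column, so one hash evaluation per matched vertex
removes it. This costs O(m), where comparing all columns with all matched vertices would cost a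
factor k more. The clauses say that entries are kept or zeroed, that only listed vertices are lost,
and that every listed vertex is lost. -/
theorem reaches_unmark (hS : Sizes w l k n) {σ : Config} {t m g : ℕ} {tag : Expr} {c : ℕ → ℕ}
    (hp : ParamRegs w l σ.regs) (h12 : σ.regs 12 = t) (h7 : σ.regs 7 = m) (hm : m ≤ 2 ^ l)
    (hg : g < 16) (hg1 : g ≠ 1)
    (htag : ∀ ρ, tag.eval w ρ = g) (h15 : σ.regs 15 = ω (4 * t + 2))
    (h16' : σ.regs 16 = ω (4 * t + 3))
    (harr : ∀ i < m, σ.mem (16 * i + g) < n) (hc : ∀ b < 2 ^ l, σ.mem (16 * b + 1) = c b) :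
    Reaches w (memSize w l) ω (forLoop 18 7 (unmarkStep tag)) σ (m * 12 + 3) fun τ =>
      (∀ b < 2 ^ l, τ.mem (16 * b + 1) = 0 ∨ τ.mem (16 * b + 1) = c b) ∧
      (∀ b < 2 ^ l, τ.mem (16 * b + 1) = c b ∨
        ∃ i < m, c b = σ.mem (16 * i + g) + 1 ∧ colOf l ω t (σ.mem (16 * i + g)) = b) ∧
      (∀ i < m, ∀ b < 2 ^ l, colOf l ω t (σ.mem (16 * i + g)) = b →
        c b = σ.mem (16 * i + g) + 1 → τ.mem (16 * b + 1) = 0) ∧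
      ∀ a, a % 16 ≠ 1 → τ.mem a = σ.mem a := by
  have h16 := hS.space
  have hwc := hS.width_le_cells
  have hmm : memSize w l = 16 * (w * w * (2 ^ l * 2 ^ l)) := rfl
  have hcube := hS.cube
  have hn := hS.n_le_cube
  have hn1 := hS.one_le_n
  have hwl := hS.width_lt
  refine Reaches.forLoop hS.word_pos m h7 (by omega) rfl rfl (by decide)
    (fun j τ => (∀ b < 2 ^ l, τ.mem (16 * b + 1) = 0 ∨ τ.mem (16 * b + 1) = c b) ∧
      (∀ b < 2 ^ l, τ.mem (16 * b + 1) = c b ∨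
        ∃ i < j, c b = σ.mem (16 * i + g) + 1 ∧ colOf l ω t (σ.mem (16 * i + g)) = b) ∧
      (∀ i < j, ∀ b < 2 ^ l, colOf l ω t (σ.mem (16 * i + g)) = b →
        c b = σ.mem (16 * i + g) + 1 → τ.mem (16 * b + 1) = 0) ∧
      ∀ a, a % 16 ≠ 1 → τ.mem a = σ.mem a)
    ⟨fun b hb => .inr (hc b hb), fun b hb => .inl (hc b hb), fun _ h => absurd h (by omega),
      fun _ _ => rfl⟩ ?_
  rintro j hj τ hF h18 ⟨hI₁, hI₂, hI₃, hlow⟩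
  have hx : τ.mem (16 * j + g) = σ.mem (16 * j + g) := hlow _ (by omega)
  have hxn := harr j hj
  generalize hxe : σ.mem (16 * j + g) = x at *
  refine Reaches.load 20 (16 * j + g) (eval_addr (eval_reg h18) (htag _) (by omega) (by omega))
    (by omega) ?_
  rw [hx]
  refine Reaches.set 19 (colOf l ω t x)
    (eval_colExpr hS.word_pos (by simp [hF.regs 15 rfl, h15]) (by simp [hF.regs 16 rfl, h16'])
      (by simp [hF.regs 5 rfl, hp.shift]) (by simp [hF.regs 4 rfl, hp.word])
      (by simp [hF.regs 12 rfl, h12]) (eval_reg (by simp))) ?_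
  -- Shared by the two cases without an erasure: the vertex is not sampled, or its column holds a
  -- different entry.
  have hkeep : (colOf l ω t x < 2 ^ l → τ.mem (16 * colOf l ω t x + 1) ≠ x + 1) →
      ∀ υ : Config, υ.mem = τ.mem →
      (∀ b < 2 ^ l, υ.mem (16 * b + 1) = 0 ∨ υ.mem (16 * b + 1) = c b) ∧
      (∀ b < 2 ^ l, υ.mem (16 * b + 1) = c b ∨
        ∃ i < j + 1, c b = σ.mem (16 * i + g) + 1 ∧ colOf l ω t (σ.mem (16 * i + g)) = b) ∧
      (∀ i < j + 1, ∀ b < 2 ^ l, colOf l ω t (σ.mem (16 * i + g)) = b →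
        c b = σ.mem (16 * i + g) + 1 → υ.mem (16 * b + 1) = 0) ∧
      ∀ a, a % 16 ≠ 1 → υ.mem a = σ.mem a := by
    intro hne υ hυ
    rw [hυ]
    refine ⟨hI₁, fun b hb => (hI₂ b hb).imp_right ?_, fun i hi b hb h₁ h₂ => ?_, hlow⟩
    · rintro ⟨i, hi, h⟩
      exact ⟨i, by omega, h⟩
    · rcases Nat.lt_succ_iff_lt_or_eq.1 hi with hi | rfl
      · exact hI₃ i hi b hb h₁ h₂
      · rw [hxe] at h₁ h₂
        subst h₁
        exact (hI₁ _ hb).resolve_right fun h => hne hb (h.trans h₂)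
  refine Reaches.cons (T₁ := 6) (T₂ := 1) (Reaches.cond (T := 5) (fun he => ?_) (fun he => ?_))
    (fun τ _ h => Reaches.nil h)
  · rw [eval_lt hS.word_pos (eval_reg (a := colOf l ω t x) (by simp))
      (eval_reg (a := 2 ^ l) (by simp [hF.regs 3 rfl, hp.width]))] at he
    have hcol : colOf l ω t x < 2 ^ l := by
      by_contra hc; simp [hc] at he
    refine Reaches.load 21 (16 * colOf l ω t x + 1)
      (eval_addr (eval_reg (by simp)) (eval_lit (by omega)) (by omega) (by omega)) (by omega) ?_
    refine Reaches.cons (T₁ := 3) (T₂ := 1) (Reaches.cond (T := 2) (fun he => ?_) (fun he => ?_))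
      (fun τ _ h => Reaches.nil h)
    all_goals
      rw [eval_eq hS.word_pos (eval_reg (a := τ.mem (16 * colOf l ω t x + 1)) (by simp))
        (eval_add (a := x) (b := 1) (eval_reg (by simp)) (eval_lit (by omega)) (by omega))] at he
    · have heq : τ.mem (16 * colOf l ω t x + 1) = x + 1 := by
        by_contra hc; simp [hc] at he
      have hcx : c (colOf l ω t x) = x + 1 := by
        rcases hI₁ _ hcol with h | h <;> omega
      refine Reaches.store (16 * colOf l ω t x + 1) 0
        (eval_addr (eval_reg (by simp)) (eval_lit (by omega)) (by omega) (by omega)) (by omega)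
        (eval_lit (by omega)) ?_
      refine Reaches.nil ⟨fun b hb => ?_, fun b hb => ?_, fun i hi b hb h₁ h₂ => ?_, fun a ha => ?_⟩
      all_goals simp only [Config.setMem_mem, Config.setReg_mem]
      · split_ifs
        · exact .inl rfl
        · exact hI₁ b hb
      · by_cases hb' : b = colOf l ω t x
        · subst hb'
          exact .inr ⟨j, by omega, by rw [hxe, hcx], by rw [hxe]⟩
        · rw [if_neg (by omega)]
          refine (hI₂ b hb).imp_right ?_
          rintro ⟨i, hi, h⟩
          exact ⟨i, by omega, h⟩
      · by_cases hb' : b = colOf l ω t x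
        · simp [hb']
        · rw [if_neg (by omega)]
          refine hI₃ i ?_ b hb h₁ h₂
          rcases Nat.lt_succ_iff_lt_or_eq.1 hi with hi | rfl
          · exact hi
          · rw [hxe] at h₁; exact absurd h₁.symm hb'
      · rw [if_neg (by omega)]; exact hlow a ha
    · have heq : τ.mem (16 * colOf l ω t x + 1) ≠ x + 1 := by
        intro hc; simp [hc] at he
      exact Reaches.skip (hkeep (fun _ => heq) _ rfl)
  · rw [eval_lt hS.word_pos (eval_reg (a := colOf l ω t x) (by simp))
      (eval_reg (a := 2 ^ l) (by simp [hF.regs 3 rfl, hp.width]))] at he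
    have hcol : ¬ colOf l ω t x < 2 ^ l := by
      intro hc; simp [hc] at he
    exact Reaches.skip (hkeep (fun h => absurd h hcol) _ rfl)

/-- The last nonzero entry wins. If there is none, register 23 keeps what an earlier sketch has
found. -/
theorem reaches_pick (hS : Sizes w l k n) {σ : Config} (h3 : σ.regs 3 = 2 ^ l) :
    Reaches w (memSize w l) ω (forLoop 18 3 pickStep) σ (2 ^ l * 8 + 3) fun τ =>
      (τ.regs 23 = σ.regs 23 ∧ ∀ b < 2 ^ l, σ.mem (16 * b + 1) = 0) ∨
      ∃ b < 2 ^ l, σ.mem (16 * b + 1) ≠ 0 ∧ τ.regs 23 = σ.mem (16 * b + 1) := by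
  have h16 := hS.space
  have hwc := hS.width_le_cells
  have hmm : memSize w l = 16 * (w * w * (2 ^ l * 2 ^ l)) := rfl
  have hcube := hS.cube
  have hn := hS.n_le_cube
  have hn1 := hS.one_le_n
  refine Reaches.forLoop hS.word_pos (2 ^ l) h3 hS.width_lt rfl rfl (by decide)
    (fun i τ => (τ.regs 23 = σ.regs 23 ∧ ∀ b < i, σ.mem (16 * b + 1) = 0) ∨
      ∃ b < i, σ.mem (16 * b + 1) ≠ 0 ∧ τ.regs 23 = σ.mem (16 * b + 1))
    (.inl ⟨by simp, fun _ h => absurd h (by omega)⟩) ?_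
  intro i hi τ hF h18 hI
  refine Reaches.load 20 (16 * i + 1)
    (eval_addr (eval_reg h18) (eval_lit (by omega)) (by omega) (by omega)) (by omega) ?_
  have hmem : τ.mem = σ.mem := hF.mem rfl
  rw [hmem]
  refine Reaches.cons (T₁ := 3) (T₂ := 1) (Reaches.cond (T := 2) (fun he => ?_) (fun he => ?_))
    (fun τ _ h => Reaches.nil h)
  all_goals rw [eval_reg (a := σ.mem (16 * i + 1)) (by simp)] at he
  · refine Reaches.set 23 (σ.mem (16 * i + 1)) (eval_reg (by simp)) (Reaches.nil (.inr ?_))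
    exact ⟨i, by omega, he, by simp⟩
  · refine Reaches.skip ?_
    simp only [Config.setReg_regs]
    rcases hI with ⟨h₁, h₂⟩ | ⟨b, hb, h⟩
    · refine .inl ⟨by simpa using h₁, fun b hb => ?_⟩
      rcases Nat.lt_succ_iff_lt_or_eq.1 hb with hb | rfl
      · exact h₂ b hb
      · exact he
    · exact .inr ⟨b, by omega, by simpa using h⟩

theorem reaches_findStep (hS : Sizes w l k n) {σ : Config} {t m u : ℕ} {P : Finset (ℕ × ℕ)}
    (hp : ParamRegs w l σ.regs) (h12 : σ.regs 12 = t) (ht : t < w * w) (h7 : σ.regs 7 = m)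
    (hm : m ≤ 2 ^ l) (h10 : σ.regs 10 = u) (hP : P ⊆ Finset.range n ×ˢ Finset.range n)
    (hsd : SeedMem ω σ.mem) (hcell : CellMem l ω P σ.mem)
    (hA : ∀ i < m, σ.mem (16 * i + 2) < n) (hB : ∀ i < m, σ.mem (16 * i + 3) < n) :
    Reaches w (memSize w l) ω findStep σ (2 ^ l * 17 + m * 24 + 18) fun τ =>
      ((τ.regs 23 = σ.regs 23 ∧ ∀ y, Recovered l ω P t u y → Matched σ.mem m y) ∨
        ∃ y, τ.regs 23 = y + 1 ∧ Recovered l ω P t u y ∧ ¬ Matched σ.mem m y) ∧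
      ∀ a, a % 16 ≠ 1 → τ.mem a = σ.mem a := by
  have h2w : 16 < 2 ^ w := by
    have := hS.space
    have := hS.width_le_cells
    have := Nat.two_pow_pos l
    omega
  suffices h : Reaches w (memSize w l) ω findStep σ
      ((2 ^ l * 9 + 3 + ((m * 12 + 3) + ((m * 12 + 3) + ((2 ^ l * 8 + 3) + 1)))) + 1 + 4) fun τ =>
      ((τ.regs 23 = σ.regs 23 ∧ ∀ y, Recovered l ω P t u y → Matched σ.mem m y) ∨
        ∃ y, τ.regs 23 = y + 1 ∧ Recovered l ω P t u y ∧ ¬ Matched σ.mem m y) ∧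
      ∀ a, a % 16 ≠ 1 → τ.mem a = σ.mem a from h.weaken (by omega) fun _ _ h => h
  refine reaches_loadSeeds hS ht h12 hsd ?_
  refine Reaches.set 17 (rowOf l ω t u)
    (eval_rowExpr (by simp) (by simp) (by simp [hp.shift]) (eval_reg (by simp [h10]))) ?_
  refine Reaches.cons (reaches_collect hS (P := P) (t := t) (u := u) (by simp [hp.width])
    (by simp [h12]) ht (by simp [h10]) (by simp) hP hcell) ?_
  rintro τ₁ F₁ ⟨c₁, low₁⟩
  simp only [Config.setReg_mem] at low₁
  refine Reaches.cons (reaches_unmark hS (t := t) (m := m) (g := 2) (c := candidate l ω P t u)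
    ⟨by simp [F₁.regs 3 rfl, hp.width], by simp [F₁.regs 4 rfl, hp.word],
      by simp [F₁.regs 5 rfl, hp.shift], by simp [F₁.regs 6 rfl, hp.reps]⟩
    (by simp [F₁.regs 12 rfl, h12]) (by simp [F₁.regs 7 rfl, h7]) hm (by omega) (by omega)
    (fun _ => eval_lit (by omega)) (by simp [F₁.regs 15 rfl]) (by simp [F₁.regs 16 rfl])
    (fun i hi => by rw [low₁ _ (by omega)]; exact hA i hi) c₁) ?_
  rintro τ₂ F₂ ⟨z₂, m₂, d₂, low₂⟩
  -- The second pass, for the second endpoints, starts from whatever the first pass has left in the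
  -- scratch array.
  refine Reaches.cons (reaches_unmark hS (t := t) (m := m) (g := 3)
    (c := fun b => τ₂.mem (16 * b + 1))
    ⟨by simp [F₂.regs 3 rfl, F₁.regs 3 rfl, hp.width],
      by simp [F₂.regs 4 rfl, F₁.regs 4 rfl, hp.word],
      by simp [F₂.regs 5 rfl, F₁.regs 5 rfl, hp.shift],
      by simp [F₂.regs 6 rfl, F₁.regs 6 rfl, hp.reps]⟩
    (by simp [F₂.regs 12 rfl, F₁.regs 12 rfl, h12]) (by simp [F₂.regs 7 rfl, F₁.regs 7 rfl, h7]) hm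
    (by omega) (by omega) (fun _ => eval_lit (by omega)) (by simp [F₂.regs 15 rfl, F₁.regs 15 rfl])
    (by simp [F₂.regs 16 rfl, F₁.regs 16 rfl])
    (fun i hi => by rw [low₂ _ (by omega), low₁ _ (by omega)]; exact hB i hi)
    (fun _ _ => rfl)) ?_
  rintro τ₃ F₃ ⟨z₃, m₃, d₃, low₃⟩
  refine Reaches.cons (reaches_pick hS
    (by simp [F₃.regs 3 rfl, F₂.regs 3 rfl, F₁.regs 3 rfl, hp.width])) ?_
  intro τ₄ F₄ h₄
  refine Reaches.nil (T := 0) ⟨?_, fun a ha => ?_⟩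
  · have e2 : ∀ i, τ₁.mem (16 * i + 2) = σ.mem (16 * i + 2) := fun i => low₁ _ (by omega)
    have e3 : ∀ i, τ₂.mem (16 * i + 3) = σ.mem (16 * i + 3) := fun i => by
      rw [low₂ _ (by omega), low₁ _ (by omega)]
    simp only [e2, e3] at *
    rcases h₄ with ⟨h23, hz⟩ | ⟨b, hb, hne, h23⟩
    · refine .inl ⟨?_, fun y hy => ?_⟩
      · rw [h23, F₃.regs 23 rfl, F₂.regs 23 rfl, F₁.regs 23 rfl]; simp
      · have hcy := hy.candidate_eq
        rcases m₃ _ hy.1 with h | ⟨i, hi, h, -⟩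
        · rcases m₂ _ hy.1 with h' | ⟨i, hi, h', -⟩
          · have := hz _ hy.1
            omega
          · exact ⟨i, hi, .inl (by omega)⟩
        · refine ⟨i, hi, .inr ?_⟩
          rcases z₂ _ hy.1 with h' | h' <;> omega
    · right
      have h₃ : τ₃.mem (16 * b + 1) = τ₂.mem (16 * b + 1) := (z₃ b hb).resolve_left hne
      have h₂ : τ₂.mem (16 * b + 1) = candidate l ω P t u b :=
        (z₂ b hb).resolve_left (h₃ ▸ hne)
      obtain ⟨y, hy, hcol, hrec⟩ := recovered_of_candidate (P := P) (ω := ω) (t := t) (u := u) hb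
        (by rw [← h₂, ← h₃]; exact hne)
      refine ⟨y, by rw [h23, h₃, h₂, hy], hrec, ?_⟩
      rintro ⟨i, hi, h | h⟩
      · have := d₂ i hi b hb (by rw [h, hcol]) (by rw [h, hy])
        omega
      · exact hne (d₃ i hi b hb (by rw [h, hcol]) (by rw [h, h₂, hy]))
  · rw [F₄.mem rfl, low₃ a ha, low₂ a ha, low₁ a ha]

/-- Once a free neighbour is found, later sketches may replace it by another one but never reset
register 23 to 0. Only the scratch array changes, so every sketch is examined under the same
invariants. -/
theorem reaches_findFree (hS : Sizes w l k n) {σ : Config} {m u : ℕ} {P : Finset (ℕ × ℕ)}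
    (hp : ParamRegs w l σ.regs) (h7 : σ.regs 7 = m)
    (hm : m ≤ 2 ^ l) (h10 : σ.regs 10 = u) (hP : P ⊆ Finset.range n ×ˢ Finset.range n)
    (hsd : SeedMem ω σ.mem) (hcell : CellMem l ω P σ.mem)
    (hA : ∀ i < m, σ.mem (16 * i + 2) < n) (hB : ∀ i < m, σ.mem (16 * i + 3) < n) :
    Reaches w (memSize w l) ω findFree σ (w * w * (2 ^ l * 17 + m * 24 + 21) + 5) fun τ =>
      ((τ.regs 23 = 0 ∧ ∀ t < w * w, ∀ y, Recovered l ω P t u y → Matched σ.mem m y) ∨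
        ∃ t < w * w, ∃ y, τ.regs 23 = y + 1 ∧ Recovered l ω P t u y ∧ ¬ Matched σ.mem m y) ∧
      ∀ a, a % 16 ≠ 1 → τ.mem a = σ.mem a := by
  have hlt : w * w < 2 ^ w := by
    have h16 := hS.space
    have hws := hS.word_sq_le_cells
    have := hS.word_pos
    have : 0 < w * w := Nat.mul_pos this this
    omega
  refine Reaches.set (T := w * w * (2 ^ l * 17 + m * 24 + 21) + 4) 23 0
    (eval_lit (Nat.two_pow_pos w)) ?_
  refine Reaches.cons (T₁ := w * w * (2 ^ l * 17 + m * 24 + 21) + 3) (T₂ := 1)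
    (Reaches.forLoop (T := 2 ^ l * 17 + m * 24 + 18) hS.word_pos (w * w) (by simp [hp.reps])
      hlt rfl rfl (by decide)
    (fun j τ =>
      ((τ.regs 23 = 0 ∧ ∀ t < j, ∀ y, Recovered l ω P t u y → Matched σ.mem m y) ∨
        ∃ t < j, ∃ y, τ.regs 23 = y + 1 ∧ Recovered l ω P t u y ∧ ¬ Matched σ.mem m y) ∧
      ∀ a, a % 16 ≠ 1 → τ.mem a = σ.mem a)
    ⟨.inl ⟨by simp, fun _ h => absurd h (by omega)⟩, fun _ _ => rfl⟩ ?_)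
    (fun _ _ h => Reaches.nil (T := 0) h)
  rintro t ht τ F h12 ⟨hI, hlow⟩
  have hM : ∀ y, Matched τ.mem m y ↔ Matched σ.mem m y := by
    intro y
    unfold Matched
    have e2 : ∀ i, τ.mem (16 * i + 2) = σ.mem (16 * i + 2) := fun i => hlow _ (by omega)
    have e3 : ∀ i, τ.mem (16 * i + 3) = σ.mem (16 * i + 3) := fun i => hlow _ (by omega)
    simp only [e2, e3]
  refine (reaches_findStep hS (P := P) (u := u) (m := m) (t := t)
    ⟨by simp [F.regs 3 rfl, hp.width], by simp [F.regs 4 rfl, hp.word],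
      by simp [F.regs 5 rfl, hp.shift], by simp [F.regs 6 rfl, hp.reps]⟩ h12 ht
    (by simp [F.regs 7 rfl, h7]) hm (by simp [F.regs 10 rfl, h10]) hP ?_ ?_ ?_ ?_).weaken le_rfl ?_
  · intro t' ht'
    rw [hlow _ (by omega), hlow _ (by omega), hlow _ (by omega), hlow _ (by omega)]
    exact hsd t' ht'
  · intro t' ht' r hr b hb
    unfold CellAt
    rw [hlow _ (by omega), hlow _ (by omega), hlow _ (by omega)]
    exact hcell t' ht' r hr b hb
  · intro i hi; rw [hlow _ (by omega)]; exact hA i hi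
  · intro i hi; rw [hlow _ (by omega)]; exact hB i hi
  · rintro υ - ⟨h, hl⟩
    refine ⟨?_, fun a ha => (hl a ha).trans (hlow a ha)⟩
    simp only [hM] at h
    rcases h with ⟨h23, hy⟩ | ⟨y, h⟩
    · rcases hI with ⟨h0, hall⟩ | ⟨t', ht', y, h0, h⟩
      · refine .inl ⟨by simp [h23, h0], fun t' ht' y hy' => ?_⟩
        rcases Nat.lt_succ_iff_lt_or_eq.1 ht' with ht' | rfl
        · exact hall t' ht' y hy'
        · exact hy y hy'
      · exact .inr ⟨t', by omega, y, by simp [h23, h0], h⟩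
    · exact .inr ⟨t, by omega, y, by simpa using h⟩

end DynStream

/-! ## The dynamic algorithm -/

namespace DynStream

open WordRAM

/-! ### Stored matchings -/

/-- The first `m` stored edges form a matching in `P`. -/
structure Stored (P : Finset (ℕ × ℕ)) (mem : ℕ → ℕ) (m : ℕ) : Prop where
  edge : ∀ i < m, (mem (16 * i + 2), mem (16 * i + 3)) ∈ P
  disjoint : ∀ i < m, ∀ j < m, i ≠ j → mem (16 * i + 2) ≠ mem (16 * j + 2) ∧
    mem (16 * i + 2) ≠ mem (16 * j + 3) ∧ mem (16 * i + 3) ≠ mem (16 * j + 3)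

/-- The stored matching is maximal. -/
def Saturated (P : Finset (ℕ × ℕ)) (mem : ℕ → ℕ) (m : ℕ) : Prop :=
  ∀ x y, (x, y) ∈ P → Matched mem m x ∨ Matched mem m y

/-- Symmetric irreflexive relations on `{0, …, n - 1}` with a vertex cover of size at most
`2 * k`. -/
structure CoveredGraph (n k : ℕ) (P : Finset (ℕ × ℕ)) : Prop where
  subset : P ⊆ Finset.range n ×ˢ Finset.range n
  symm : ∀ x y, (x, y) ∈ P → (y, x) ∈ P
  irrefl : ∀ x, (x, x) ∉ P
  cover : ∃ X : Finset ℕ, X.card ≤ 2 * k ∧ ∀ x y, (x, y) ∈ P → x ∈ X ∨ y ∈ X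

/-- Send each stored edge to an endpoint in the cover, preferring the first. Disjointness makes this
injective, so the bound needs no maximality of the stored matching. -/
theorem Stored.le_of_covered {n k m : ℕ} {P : Finset (ℕ × ℕ)} {mem : ℕ → ℕ}
    (h : Stored P mem m) (hP : CoveredGraph n k P) : m ≤ 2 * k := by
  obtain ⟨X, hX, hcov⟩ := hP.cover
  classical
  have := Finset.card_le_card_of_injOn (s := Finset.range m) (t := X)
    (fun i => if mem (16 * i + 2) ∈ X then mem (16 * i + 2) else mem (16 * i + 3)) ?_ ?_
  · rw [Finset.card_range] at this; omega
  · intro i hi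
    rcases hcov _ _ (h.edge i (by simpa using hi)) with h' | h'
    · simp [h']
    · by_cases h'' : mem (16 * i + 2) ∈ X <;> simp [h', h'']
  · intro i hi j hj hij
    by_contra hne
    have hi' : i < m := by simpa using hi
    have hj' : j < m := by simpa using hj
    have h₁ := h.disjoint i hi' j hj' hne
    have h₂ := h.disjoint j hj' i hi' (Ne.symm hne)
    dsimp only at hij
    split_ifs at hij
    · exact h₁.1 hij
    · exact h₁.2.1 hij
    · exact h₂.2.1 hij.symm
    · exact h₁.2.2 hij

/-- Used twice: to bound the degree of a free vertex by means of a maximal matching, and to see that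
more than 4k recovered neighbours cannot all be matched. -/
theorem card_le_of_matched {mem : ℕ → ℕ} {m : ℕ} (Y : Finset ℕ) (hY : ∀ y ∈ Y, Matched mem m y) :
    Y.card ≤ 2 * m := by
  have hsub : Y ⊆ (Finset.range m).image (fun i => mem (16 * i + 2)) ∪
      (Finset.range m).image (fun i => mem (16 * i + 3)) := by
    intro y hy
    obtain ⟨i, hi, h | h⟩ := hY y hy
    · exact Finset.mem_union_left _ (Finset.mem_image.2 ⟨i, by simpa using hi, h⟩)
    · exact Finset.mem_union_right _ (Finset.mem_image.2 ⟨i, by simpa using hi, h⟩)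
  refine (Finset.card_le_card hsub).trans ((Finset.card_union_le _ _).trans ?_)
  have h₁ := Finset.card_image_le (s := Finset.range m) (f := fun i => mem (16 * i + 2))
  have h₂ := Finset.card_image_le (s := Finset.range m) (f := fun i => mem (16 * i + 3))
  rw [Finset.card_range] at h₁ h₂
  omega

theorem matched_congr {mem mem' : ℕ → ℕ} {m x : ℕ}
    (h : ∀ i < m, mem' (16 * i + 2) = mem (16 * i + 2) ∧ mem' (16 * i + 3) = mem (16 * i + 3)) :
    Matched mem' m x ↔ Matched mem m x := by
  unfold Matched
  refine exists_congr fun i => and_congr_right fun hi => ?_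
  rw [(h i hi).1, (h i hi).2]

theorem Stored.congr {P : Finset (ℕ × ℕ)} {mem mem' : ℕ → ℕ} {m : ℕ} (hs : Stored P mem m)
    (h : ∀ i < m, mem' (16 * i + 2) = mem (16 * i + 2) ∧ mem' (16 * i + 3) = mem (16 * i + 3)) :
    Stored P mem' m := by
  refine ⟨fun i hi => ?_, fun i hi j hj hij => ?_⟩
  · rw [(h i hi).1, (h i hi).2]; exact hs.edge i hi
  · rw [(h i hi).1, (h i hi).2, (h j hj).1, (h j hj).2]; exact hs.disjoint i hi j hj hij

theorem matched_append {mem mem' : ℕ → ℕ} {m x y z : ℕ}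
    (h : ∀ i < m, mem' (16 * i + 2) = mem (16 * i + 2) ∧ mem' (16 * i + 3) = mem (16 * i + 3))
    (hx : mem' (16 * m + 2) = x) (hy : mem' (16 * m + 3) = y) :
    Matched mem' (m + 1) z ↔ Matched mem m z ∨ z = x ∨ z = y := by
  rw [← matched_congr h]
  constructor
  · rintro ⟨i, hi, hz⟩
    rcases Nat.lt_succ_iff_lt_or_eq.1 hi with hi | rfl
    · exact .inl ⟨i, hi, hz⟩
    · right; rw [hx, hy] at hz; exact hz.imp Eq.symm Eq.symm
  · rintro (⟨i, hi, hz⟩ | rfl | rfl)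
    · exact ⟨i, by omega, hz⟩
    · exact ⟨m, by omega, .inl hx⟩
    · exact ⟨m, by omega, .inr hy⟩

theorem Stored.append {P : Finset (ℕ × ℕ)} {mem mem' : ℕ → ℕ} {m x y : ℕ} (hs : Stored P mem m)
    (h : ∀ i < m, mem' (16 * i + 2) = mem (16 * i + 2) ∧ mem' (16 * i + 3) = mem (16 * i + 3))
    (hx : mem' (16 * m + 2) = x) (hy : mem' (16 * m + 3) = y) (hxy : (x, y) ∈ P)
    (hmx : ¬ Matched mem m x) (hmy : ¬ Matched mem m y) : Stored P mem' (m + 1) := by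
  have hs' := hs.congr h
  rw [← matched_congr h] at hmx hmy
  have hne : ∀ i < m, mem' (16 * i + 2) ≠ x ∧ mem' (16 * i + 3) ≠ x ∧ mem' (16 * i + 2) ≠ y ∧
      mem' (16 * i + 3) ≠ y := fun i hi =>
    ⟨fun e => hmx ⟨i, hi, .inl e⟩, fun e => hmx ⟨i, hi, .inr e⟩, fun e => hmy ⟨i, hi, .inl e⟩,
      fun e => hmy ⟨i, hi, .inr e⟩⟩
  refine ⟨fun i hi => ?_, fun i hi j hj hij => ?_⟩
  · rcases Nat.lt_succ_iff_lt_or_eq.1 hi with hi | rfl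
    · exact hs'.edge i hi
    · rwa [hx, hy]
  · rcases Nat.lt_succ_iff_lt_or_eq.1 hi with hi | rfl <;>
    rcases Nat.lt_succ_iff_lt_or_eq.1 hj with hj | rfl
    · exact hs'.disjoint i hi j hj hij
    · rw [hx, hy]; exact ⟨(hne i hi).1, (hne i hi).2.2.1, (hne i hi).2.2.2⟩
    · rw [hx, hy]; exact ⟨(hne j hj).1.symm, (hne j hj).2.1.symm, (hne j hj).2.2.2.symm⟩
    · exact absurd rfl hij

/-- Removal of edge `p` from a stored matching: the last edge takes its place. -/
structure Removal (mem mem' : ℕ → ℕ) (m p : ℕ) : Prop where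
  keep : ∀ i < m, i ≠ p →
    mem' (16 * i + 2) = mem (16 * i + 2) ∧ mem' (16 * i + 3) = mem (16 * i + 3)
  move : p < m → mem' (16 * p + 2) = mem (16 * m + 2) ∧ mem' (16 * p + 3) = mem (16 * m + 3)

/-- Slot i now holds what slot j held before, where j is the former last slot if i was vacated.
Statements about the new matching are thereby pulled back to the old one. -/
theorem Removal.source {mem mem' : ℕ → ℕ} {m p i : ℕ} (h : Removal mem mem' m p) (hi : i < m) :
    ∃ j < m + 1, j ≠ p ∧ j = (if i = p then m else i) ∧
      mem' (16 * i + 2) = mem (16 * j + 2) ∧ mem' (16 * i + 3) = mem (16 * j + 3) := by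
  by_cases hip : i = p
  · subst hip
    exact ⟨m, by omega, by omega, by simp, h.move hi⟩
  · exact ⟨i, by omega, hip, by simp [hip], h.keep i hi hip⟩

theorem Removal.stored {P P' : Finset (ℕ × ℕ)} {mem mem' : ℕ → ℕ} {m p : ℕ}
    (h : Removal mem mem' m p) (hs : Stored P mem (m + 1)) (hp : p < m + 1)
    (hP : ∀ x y, (x, y) ∈ P → x ≠ mem (16 * p + 2) → x ≠ mem (16 * p + 3) → (x, y) ∈ P') :
    Stored P' mem' m := by
  refine ⟨fun i hi => ?_, fun i hi i' hi' hii => ?_⟩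
  · obtain ⟨j, hj, hjp, -, h2, h3⟩ := h.source hi
    rw [h2, h3]
    have := hs.disjoint j hj p hp hjp
    exact hP _ _ (hs.edge j hj) this.1 this.2.1
  · obtain ⟨j, hj, hjp, hji, h2, h3⟩ := h.source hi
    obtain ⟨j', hj', hjp', hji', h2', h3'⟩ := h.source hi'
    rw [h2, h3, h2', h3']
    refine hs.disjoint j hj j' hj' ?_
    split_ifs at hji hji' <;> omega

theorem Removal.matched {P : Finset (ℕ × ℕ)} {mem mem' : ℕ → ℕ} {m p z : ℕ}
    (h : Removal mem mem' m p) (hs : Stored P mem (m + 1)) (hp : p < m + 1) :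
    Matched mem' m z ↔
      Matched mem (m + 1) z ∧ z ≠ mem (16 * p + 2) ∧ z ≠ mem (16 * p + 3) := by
  constructor
  · rintro ⟨i, hi, hz⟩
    obtain ⟨j, hj, hjp, -, h2, h3⟩ := h.source hi
    rw [h2, h3] at hz
    have h₁ := hs.disjoint j hj p hp hjp
    have h₂ := hs.disjoint p hp j hj (Ne.symm hjp)
    refine ⟨⟨j, hj, hz⟩, ?_⟩
    rcases hz with rfl | rfl
    · exact ⟨h₁.1, h₁.2.1⟩
    · exact ⟨Ne.symm h₂.2.1, h₁.2.2⟩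
  · rintro ⟨⟨i, hi, hz⟩, hz2, hz3⟩
    have hip : i ≠ p := by
      rintro rfl
      rcases hz with rfl | rfl
      · exact hz2 rfl
      · exact hz3 rfl
    rcases Nat.lt_succ_iff_lt_or_eq.1 hi with hi | rfl
    · have := h.keep i hi hip
      exact ⟨i, hi, by rwa [this.1, this.2]⟩
    · have hp' : p < i := by omega
      have := h.move hp'
      exact ⟨p, hp', by rwa [this.1, this.2]⟩

/-! ### Programs on the stored matching -/

/-- Appends the edge `xy`. -/
def appendEdge (x y : Expr) : Cmd :=
  block [.store (addr (.reg 7) 2) x, .store (addr (.reg 7) 3) y, .set 7 (.reg 7 + 1),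
    .store 48 (.reg 7)]

/-- Tries to match the vertex in register `x`. -/
def rematch (x : ℕ) : Cmd :=
  block [.set 10 (.reg x), findFree,
    .cond (.reg 23) (appendEdge (.reg 10) (.reg 23 - 1)) .skip]

/-- Counts in `reg 23` occurrences of `reg 1` and `reg 2` in the stored edge `reg 18`. -/
def scanStep : Cmd :=
  block [.load 20 (addr (.reg 18) 2), .load 21 (addr (.reg 18) 3),
    .set 23 (.reg 23 + (.bin .eq (.reg 20) (.reg 1) + .bin .eq (.reg 20) (.reg 2) +
      (.bin .eq (.reg 21) (.reg 1) + .bin .eq (.reg 21) (.reg 2))))]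

/-- Matches the new edge if its end points are free. -/
def insertEdge : Cmd :=
  block [.set 23 0, forLoop 18 7 scanStep, .cond (.reg 23) .skip (appendEdge (.reg 1) (.reg 2))]

/-- Compares the stored edge `reg 18` with the edge `(reg 1, reg 2)`. -/
def locateStep : Cmd :=
  block [.load 20 (addr (.reg 18) 2), .load 21 (addr (.reg 18) 3),
    .cond (.bin .eq (.reg 20) (.reg 1) * .bin .eq (.reg 21) (.reg 2) +
      .bin .eq (.reg 20) (.reg 2) * .bin .eq (.reg 21) (.reg 1))
      (block [.set 24 (.reg 18 + 1)]) .skip]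

/-- Removes the stored edge `reg 24 - 1`. -/
def removeEdge : Cmd :=
  block [.set 7 (.reg 7 - 1), .load 20 (addr (.reg 7) 2), .load 21 (addr (.reg 7) 3),
    .store (addr (.reg 24 - 1) 2) (.reg 20), .store (addr (.reg 24 - 1) 3) (.reg 21),
    .store 48 (.reg 7)]

/-- Repairs the matching after a deletion. -/
def deleteEdge : Cmd :=
  block [.set 24 0, forLoop 18 7 locateStep,
    .cond (.reg 24) (block [removeEdge, rematch 1, rematch 2]) .skip]

/-- The update program. -/
def updateProgram : Cmd :=
  block [.load 3 0, .load 4 16, .load 5 32, .load 7 48, .set 6 (.reg 4 * .reg 4),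
    .set 10 (.reg 1), .set 11 (.reg 2), sketchPair,
    .set 10 (.reg 2), .set 11 (.reg 1), sketchPair,
    .cond (.reg 0) deleteEdge insertEdge]

/-- Everything in memory but the matching and the temporary array. -/
structure BaseMem {w : ℕ} (l : ℕ) (ω : ℕ → Fin (2 ^ w)) (P : Finset (ℕ × ℕ)) (mem : ℕ → ℕ) :
    Prop where
  width : mem 0 = 2 ^ l
  word : mem 16 = w
  shift : mem 32 = w - l
  seeds : SeedMem ω mem
  cells : CellMem l ω P mem

variable {w l k n : ℕ} {ω : ℕ → Fin (2 ^ w)}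

/-- Searching and repairing write only tags 1 to 3 and address 48. -/
theorem BaseMem.congr {P : Finset (ℕ × ℕ)} {mem mem' : ℕ → ℕ} (h : BaseMem l ω P mem)
    (h' : ∀ a, a % 16 = 0 ∨ 4 ≤ a % 16 → a ≠ 48 → mem' a = mem a) : BaseMem l ω P mem' := by
  refine ⟨?_, ?_, ?_, fun t ht => ?_, fun t ht r hr b hb => ?_⟩
  · rw [h' _ (by omega) (by omega)]; exact h.width
  · rw [h' _ (by omega) (by omega)]; exact h.word
  · rw [h' _ (by omega) (by omega)]; exact h.shift
  · rw [h' _ (by omega) (by omega), h' _ (by omega) (by omega), h' _ (by omega) (by omega),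
      h' _ (by omega) (by omega)]
    exact h.seeds t ht
  · unfold CellAt
    rw [h' _ (by omega) (by omega), h' _ (by omega) (by omega), h' _ (by omega) (by omega)]
    exact h.cells t ht r hr b hb

theorem Sizes.two_k_lt (hS : Sizes w l k n) : 2 * k + 4 ≤ w * w * (2 ^ l * 2 ^ l) := by
  have := hS.width_le_cells
  have := hS.le_width
  have := hS.one_le_k
  omega

theorem reaches_appendEdge (hS : Sizes w l k n) {σ : Config} {m x y : ℕ} {ex ey : Expr}
    (h7 : σ.regs 7 = m) (hm : m ≤ 2 * k) (hx : ex.eval w σ.regs = x) (hy : ey.eval w σ.regs = y) :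
    Reaches w (memSize w l) ω (appendEdge ex ey) σ 5 fun τ =>
      τ.regs 7 = m + 1 ∧ τ.mem (16 * m + 2) = x ∧ τ.mem (16 * m + 3) = y ∧ τ.mem 48 = m + 1 ∧
      ∀ a, a ≠ 16 * m + 2 → a ≠ 16 * m + 3 → a ≠ 48 → τ.mem a = σ.mem a := by
  have h16 := hS.space
  have hwc := hS.two_k_lt
  have hmm : memSize w l = 16 * (w * w * (2 ^ l * 2 ^ l)) := rfl
  refine Reaches.store (16 * m + 2) x
    (eval_addr (eval_reg h7) (eval_lit (by omega)) (by omega) (by omega)) (by omega) hx ?_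
  refine Reaches.store (16 * m + 3) y
    (eval_addr (eval_reg (by simp [h7])) (eval_lit (by omega)) (by omega) (by omega)) (by omega)
    hy ?_
  refine Reaches.set 7 (m + 1) (eval_add (eval_reg (by simp [h7])) (eval_lit (by omega))
    (by omega)) ?_
  refine Reaches.store 48 (m + 1) (eval_lit (by omega)) (by omega) (eval_reg (by simp)) ?_
  refine Reaches.nil (T := 0) ⟨by simp, ?_, ?_, by simp, fun a h₁ h₂ h₃ => ?_⟩
  all_goals simp only [Config.setMem_mem, Config.setReg_mem]
  · rw [if_neg (by omega), if_neg (by omega), if_pos trivial]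
  · rw [if_neg (by omega), if_pos trivial]
  · rw [if_neg h₃, if_neg h₂, if_neg h₁]

/-- The memory invariant, with the register that holds the size of the matching. -/
structure Live {w : ℕ} (l : ℕ) (ω : ℕ → Fin (2 ^ w)) (P : Finset (ℕ × ℕ)) (σ : Config) (m : ℕ) :
    Prop where
  params : ParamRegs w l σ.regs
  count : σ.regs 7 = m
  base : BaseMem l ω P σ.mem
  size : σ.mem 48 = m
  stored : Stored P σ.mem m

/-- Whether or not the sketches are any good, the stored edges remain a matching: either u gets a
verified free neighbour, or all its recovered neighbours are already matched. -/
theorem reaches_rematch (hS : Sizes w l k n) {σ : Config} {r m u : ℕ} {P : Finset (ℕ × ℕ)}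
    (hP : CoveredGraph n k P) (h : Live l ω P σ m) (hr : σ.regs r = u)
    (hu : ¬ Matched σ.mem m u) :
    Reaches w (memSize w l) ω (rematch r) σ (w * w * (2 ^ l * 17 + m * 24 + 21) + 13) fun τ =>
      ∃ m', Live l ω P τ m' ∧
        (((∀ z, Matched τ.mem m' z ↔ Matched σ.mem m z) ∧
          ∀ t < w * w, ∀ y, Recovered l ω P t u y → Matched σ.mem m y) ∨
        ∃ y, (u, y) ∈ P ∧ ¬ Matched σ.mem m y ∧
          ∀ z, Matched τ.mem m' z ↔ Matched σ.mem m z ∨ z = u ∨ z = y) := by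
  have hm := h.stored.le_of_covered hP
  have hkB := hS.le_width
  have h1 : 1 < 2 ^ w := Nat.one_lt_two_pow hS.word_pos.ne'
  have hlt : ∀ i < m, σ.mem (16 * i + 2) < n ∧ σ.mem (16 * i + 3) < n := by
    intro i hi
    simpa using hP.subset (h.stored.edge i hi)
  have hcube := hS.cube
  have hn := hS.n_le_cube
  refine Reaches.set (T := w * w * (2 ^ l * 17 + m * 24 + 21) + 12) 10 u (eval_reg hr) ?_
  refine Reaches.cons (T₁ := w * w * (2 ^ l * 17 + m * 24 + 21) + 5) (T₂ := 7)
    (reaches_findFree hS (P := P) (m := m) (u := u)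
    ⟨by simp [h.params.width], by simp [h.params.word], by simp [h.params.shift],
      by simp [h.params.reps]⟩ (by simp [h.count]) (by omega) (by simp) hP.subset h.base.seeds
      h.base.cells (fun i hi => (hlt i hi).1) (fun i hi => (hlt i hi).2)) ?_
  rintro τ F ⟨hres, hlow⟩
  simp only [Config.setReg_mem] at hres hlow
  have h10 : τ.regs 10 = u := by rw [F.regs 10 rfl]; simp
  have h7 : τ.regs 7 = m := by rw [F.regs 7 rfl]; simp [h.count]
  have hp : ParamRegs w l τ.regs :=
    ⟨by simp [F.regs 3 rfl, h.params.width], by simp [F.regs 4 rfl, h.params.word],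
      by simp [F.regs 5 rfl, h.params.shift], by simp [F.regs 6 rfl, h.params.reps]⟩
  have hsame : ∀ i < m, τ.mem (16 * i + 2) = σ.mem (16 * i + 2) ∧
      τ.mem (16 * i + 3) = σ.mem (16 * i + 3) := fun i _ =>
    ⟨hlow _ (by omega), hlow _ (by omega)⟩
  refine Reaches.cons (T₁ := 6) (T₂ := 1) (Reaches.cond (T := 5) (fun he => ?_) (fun he => ?_))
    (fun τ _ h => Reaches.nil h)
  · rcases hres with ⟨h0, -⟩ | ⟨t, -, y, h23, hrec, hy⟩
    · exact absurd h0 he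
    have hyn : y < n := by
      have := hP.subset hrec.mem
      simp at this
      exact this.2
    refine (reaches_appendEdge hS (x := u) (y := y) h7 hm (eval_reg h10)
      (by simpa using eval_sub (eval_reg h23) (eval_lit h1) (by simp; omega))).weaken le_rfl ?_
    rintro υ G ⟨g7, gx, gy, g48, gsame⟩
    have hsame' : ∀ i < m, υ.mem (16 * i + 2) = σ.mem (16 * i + 2) ∧
        υ.mem (16 * i + 3) = σ.mem (16 * i + 3) := fun i hi => by
      rw [gsame _ (by omega) (by omega) (by omega), gsame _ (by omega) (by omega) (by omega)]
      exact hsame i hi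
    refine ⟨m + 1, ⟨⟨by simp [G.regs 3 rfl, hp.width], by simp [G.regs 4 rfl, hp.word],
      by simp [G.regs 5 rfl, hp.shift], by simp [G.regs 6 rfl, hp.reps]⟩, g7,
      h.base.congr fun a ha ha' => ?_, g48, ?_⟩, ?_⟩
    · rw [gsame a (by omega) (by omega) ha', hlow a (by omega)]
    · exact h.stored.append hsame' gx gy hrec.mem hu hy
    · exact .inr ⟨y, hrec.mem, hy, fun z => matched_append hsame' gx gy⟩
  · rcases hres with ⟨-, hall⟩ | ⟨t, -, y, h23, -⟩
    · refine Reaches.skip ⟨m, ⟨hp, h7, h.base.congr fun a ha _ => hlow a (by omega), ?_,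
        h.stored.congr hsame⟩, .inl ⟨fun z => matched_congr hsame, hall⟩⟩
      rw [hlow _ (by omega)]; exact h.size
    · have : τ.regs 23 = 0 := he
      omega

/-! ### Informative sketches, and insertions. -/

/-- The neighbours of a vertex. -/
def nbrs (P : Finset (ℕ × ℕ)) (u : ℕ) : Finset ℕ := (P.filter fun p => p.1 = u).image Prod.snd

theorem mem_nbrs {P : Finset (ℕ × ℕ)} {u y : ℕ} : y ∈ nbrs P u ↔ (u, y) ∈ P := by
  unfold nbrs
  simp only [Finset.mem_image, Finset.mem_filter]
  constructor
  · rintro ⟨⟨a, b⟩, ⟨h, rfl⟩, rfl⟩; exact h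
  · intro h; exact ⟨(u, y), ⟨h, rfl⟩, rfl⟩

open Classical in
/-- The sketches are informative about the neighbourhood of `u`. -/
def Informative {w : ℕ} (l k : ℕ) (ω : ℕ → Fin (2 ^ w)) (P : Finset (ℕ × ℕ)) (u : ℕ) : Prop :=
  (∀ y ∈ nbrs P u, (nbrs P y).card ≤ 4 * k → ∃ t < w * w, Recovered l ω P t u y) ∨
  ∃ t < w * w, 4 * k < ((nbrs P u).filter fun y => Recovered l ω P t u y).card

/-- The second alternative of `Informative` is incompatible with `hall`: more than 4k recovered
neighbours would have to be among at most 2m ≤ 4k matched vertices. So the first alternative holds,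
and it gives the claim. -/
theorem Informative.matched {P : Finset (ℕ × ℕ)} {u m : ℕ} {mem : ℕ → ℕ}
    (h : Informative l k ω P u) (hm : m ≤ 2 * k)
    (hall : ∀ t < w * w, ∀ y, Recovered l ω P t u y → Matched mem m y) :
    ∀ y, (u, y) ∈ P → (nbrs P y).card ≤ 4 * k → Matched mem m y := by
  rcases h with h | ⟨t, ht, h⟩
  · intro y hy hd
    obtain ⟨t, ht, hr⟩ := h y (mem_nbrs.2 hy) hd
    exact hall t ht y hr
  · classical
    have := h.trans_le (card_le_of_matched (mem := mem) (m := m) _ fun y hy =>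
      hall t ht y (Finset.mem_filter.1 hy).2)
    omega

theorem reaches_insertEdge (hS : Sizes w l k n) {σ : Config} {m u v : ℕ} {P : Finset (ℕ × ℕ)}
    (hP : CoveredGraph n k P) (h : Live l ω P σ m) (h1 : σ.regs 1 = u) (h2 : σ.regs 2 = v)
    (huv : (u, v) ∈ P) :
    Reaches w (memSize w l) ω insertEdge σ (m * 7 + 11) fun τ =>
      ∃ m', Live l ω P τ m' ∧ (∀ z, Matched σ.mem m z → Matched τ.mem m' z) ∧
        (Matched τ.mem m' u ∨ Matched τ.mem m' v) := by
  have hm := h.stored.le_of_covered hP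
  have h16 := hS.space
  have hwc := hS.two_k_lt
  have hmm : memSize w l = 16 * (w * w * (2 ^ l * 2 ^ l)) := rfl
  have hw := hS.word_pos
  refine Reaches.set (T := m * 7 + 10) 23 0 (eval_lit (by omega)) ?_
  refine Reaches.cons (T₁ := m * 7 + 3) (T₂ := 7)
    (Reaches.forLoop (T := 4) hw m (by simp [h.count]) (by omega) rfl rfl (by decide)
      -- The bound 4i excludes that the counter wraps around to 0 although an endpoint is matched.
      (fun i τ => τ.regs 23 ≤ 4 * i ∧ (τ.regs 23 = 0 ↔ ¬ Matched σ.mem i u ∧ ¬ Matched σ.mem i v))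
      ?_ ?_) ?_
  · simp [Matched]
  · rintro i hi τ F h18 ⟨hle, hiff⟩
    have hmem : τ.mem = σ.mem := F.mem rfl
    refine Reaches.load 20 (16 * i + 2)
      (eval_addr (eval_reg h18) (eval_lit (by omega)) (by omega) (by omega)) (by omega) ?_
    refine Reaches.load 21 (16 * i + 3)
      (eval_addr (eval_reg (by simp [h18])) (eval_lit (by omega)) (by omega) (by omega))
      (by omega) ?_
    rw [hmem]
    have g1 : τ.regs 1 = u := by rw [F.regs 1 rfl]; simp [h1]
    have g2 : τ.regs 2 = v := by rw [F.regs 2 rfl]; simp [h2]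
    have hite : ∀ (p : Prop) [Decidable p], (if p then 1 else 0) ≤ 1 := by
      intros; split_ifs <;> simp
    have i1 := hite (σ.mem (16 * i + 2) = u)
    have i2 := hite (σ.mem (16 * i + 2) = v)
    have i3 := hite (σ.mem (16 * i + 3) = u)
    have i4 := hite (σ.mem (16 * i + 3) = v)
    refine Reaches.set 23 _ (eval_add (eval_reg (a := τ.regs 23) (by simp)) (eval_add
      (eval_add (eval_eq hw (eval_reg (a := σ.mem (16 * i + 2)) (by simp [hmem]))
        (eval_reg (a := u) (by simp [g1])))
        (eval_eq hw (eval_reg (a := σ.mem (16 * i + 2)) (by simp [hmem]))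
        (eval_reg (a := v) (by simp [g2]))) (by omega))
      (eval_add (eval_eq hw (eval_reg (a := σ.mem (16 * i + 3)) (by simp [hmem]))
        (eval_reg (a := u) (by simp [g1])))
        (eval_eq hw (eval_reg (a := σ.mem (16 * i + 3)) (by simp [hmem]))
        (eval_reg (a := v) (by simp [g2]))) (by omega)) (by omega)) (by omega)) ?_
    refine Reaches.nil (T := 0) ⟨?_, ?_⟩
    · simp only [Config.setReg_regs, if_true, if_false, Nat.reduceEqDiff]
      omega
    · have hsucc : ∀ z, Matched σ.mem (i + 1) z ↔
          Matched σ.mem i z ∨ z = σ.mem (16 * i + 2) ∨ z = σ.mem (16 * i + 3) := fun z =>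
        matched_append (fun _ _ => ⟨rfl, rfl⟩) rfl rfl
      simp only [Config.setReg_regs, if_true, if_false, Nat.reduceEqDiff, hsucc,
        Nat.add_eq_zero_iff, hiff, ite_eq_right_iff, one_ne_zero, imp_false, not_or]
      constructor
      · rintro ⟨⟨a, b⟩, ⟨c, d⟩, e, f⟩
        exact ⟨⟨a, Ne.symm c, Ne.symm e⟩, b, Ne.symm d, Ne.symm f⟩
      · rintro ⟨⟨a, c, e⟩, b, d, f⟩
        exact ⟨⟨a, b⟩, ⟨Ne.symm c, Ne.symm d⟩, Ne.symm e, Ne.symm f⟩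
  · rintro τ F ⟨-, hiff⟩
    have hmem : τ.mem = σ.mem := F.mem rfl
    have hp : ParamRegs w l τ.regs :=
      ⟨by simp [F.regs 3 rfl, h.params.width], by simp [F.regs 4 rfl, h.params.word],
        by simp [F.regs 5 rfl, h.params.shift], by simp [F.regs 6 rfl, h.params.reps]⟩
    have h7 : τ.regs 7 = m := by simp [F.regs 7 rfl, h.count]
    refine Reaches.cons (T₁ := 6) (T₂ := 1) (Reaches.cond (T := 5) (fun he => ?_) (fun he => ?_))
      (fun τ _ h => Reaches.nil h)
    · refine Reaches.skip ⟨m, ⟨hp, h7, hmem ▸ h.base, hmem ▸ h.size, hmem ▸ h.stored⟩,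
        fun z hz => by rwa [hmem], ?_⟩
      have he' : ¬ τ.regs 23 = 0 := he
      rw [hiff] at he'
      rw [hmem]
      tauto
    · have he' : τ.regs 23 = 0 := he
      rw [hiff] at he'
      refine (reaches_appendEdge hS (x := u) (y := v) h7 hm
        (eval_reg (by simp [F.regs 1 rfl, h1])) (eval_reg (by simp [F.regs 2 rfl, h2]))).weaken
        le_rfl ?_
      rintro υ G ⟨g7, gx, gy, g48, gsame⟩
      rw [hmem] at gsame
      have hsame' : ∀ i < m, υ.mem (16 * i + 2) = σ.mem (16 * i + 2) ∧
          υ.mem (16 * i + 3) = σ.mem (16 * i + 3) := fun i hi =>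
        ⟨gsame _ (by omega) (by omega) (by omega), gsame _ (by omega) (by omega) (by omega)⟩
      refine ⟨m + 1, ⟨⟨by simp [G.regs 3 rfl, hp.width], by simp [G.regs 4 rfl, hp.word],
        by simp [G.regs 5 rfl, hp.shift], by simp [G.regs 6 rfl, hp.reps]⟩, g7,
        h.base.congr fun a ha ha' => ?_, g48, ?_⟩, fun z hz => ?_, .inl ?_⟩
      · rw [gsame a (by omega) (by omega) ha']
      · exact h.stored.append hsame' gx gy huv he'.1 he'.2
      · rw [matched_append hsame' gx gy]; exact .inl hz
      · rw [matched_append hsame' gx gy]; exact .inr (.inl rfl)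

end DynStream

/-! ### Deletions and the complete update. -/

namespace DynStream

open WordRAM

variable {w l k n : ℕ} {ω : ℕ → Fin (2 ^ w)}

theorem reaches_locate (hS : Sizes w l k n) {σ : Config} {m u v : ℕ} (h7 : σ.regs 7 = m)
    (hm : m ≤ 2 * k) (h1 : σ.regs 1 = u) (h2 : σ.regs 2 = v) (h24 : σ.regs 24 = 0) :
    Reaches w (memSize w l) ω (forLoop 18 7 locateStep) σ (m * 9 + 3) fun τ =>
      (τ.regs 24 = 0 ∧ ∀ i < m, ¬ (σ.mem (16 * i + 2) = u ∧ σ.mem (16 * i + 3) = v) ∧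
        ¬ (σ.mem (16 * i + 2) = v ∧ σ.mem (16 * i + 3) = u)) ∨
      ∃ p < m, τ.regs 24 = p + 1 ∧ ((σ.mem (16 * p + 2) = u ∧ σ.mem (16 * p + 3) = v) ∨
        (σ.mem (16 * p + 2) = v ∧ σ.mem (16 * p + 3) = u)) := by
  have h16 := hS.space
  have hwc := hS.two_k_lt
  have hmm : memSize w l = 16 * (w * w * (2 ^ l * 2 ^ l)) := rfl
  have hw := hS.word_pos
  refine Reaches.forLoop (T := 6) hw m h7 (by omega) rfl rfl (by decide)
    (fun j τ => (τ.regs 24 = 0 ∧ ∀ i < j, ¬ (σ.mem (16 * i + 2) = u ∧ σ.mem (16 * i + 3) = v) ∧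
        ¬ (σ.mem (16 * i + 2) = v ∧ σ.mem (16 * i + 3) = u)) ∨
      ∃ p < j, τ.regs 24 = p + 1 ∧ ((σ.mem (16 * p + 2) = u ∧ σ.mem (16 * p + 3) = v) ∨
        (σ.mem (16 * p + 2) = v ∧ σ.mem (16 * p + 3) = u)))
    (.inl ⟨by simp [h24], fun _ h => absurd h (by omega)⟩) ?_
  rintro i hi τ F h18 hI
  have hmem : τ.mem = σ.mem := F.mem rfl
  refine Reaches.load 20 (16 * i + 2)
    (eval_addr (eval_reg h18) (eval_lit (by omega)) (by omega) (by omega)) (by omega) ?_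
  refine Reaches.load 21 (16 * i + 3)
    (eval_addr (eval_reg (by simp [h18])) (eval_lit (by omega)) (by omega) (by omega))
    (by omega) ?_
  have g1 : τ.regs 1 = u := by rw [F.regs 1 rfl]; simp [h1]
  have g2 : τ.regs 2 = v := by rw [F.regs 2 rfl]; simp [h2]
  have hite : ∀ (p q : Prop) [Decidable p] [Decidable q],
      (if p then 1 else 0) * (if q then 1 else 0) ≤ 1 := by
    intros; split_ifs <;> simp
  have i1 := hite (σ.mem (16 * i + 2) = u) (σ.mem (16 * i + 3) = v)
  have i2 := hite (σ.mem (16 * i + 2) = v) (σ.mem (16 * i + 3) = u)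
  rw [hmem]
  refine Reaches.cons (T₁ := 3) (T₂ := 1) (Reaches.cond (T := 2) (fun he => ?_) (fun he => ?_))
    (fun τ _ h => Reaches.nil h)
  all_goals
    rw [eval_add (eval_mul
        (eval_eq hw (eval_reg (a := σ.mem (16 * i + 2)) (by simp))
          (eval_reg (a := u) (by simp [g1])))
        (eval_eq hw (eval_reg (a := σ.mem (16 * i + 3)) (by simp [hmem]))
          (eval_reg (a := v) (by simp [g2]))) (by omega))
      (eval_mul
        (eval_eq hw (eval_reg (a := σ.mem (16 * i + 2)) (by simp))
          (eval_reg (a := v) (by simp [g2])))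
        (eval_eq hw (eval_reg (a := σ.mem (16 * i + 3)) (by simp [hmem]))
          (eval_reg (a := u) (by simp [g1]))) (by omega)) (by omega)] at he
  · refine Reaches.set 24 (i + 1) (eval_add (eval_reg (by simp [h18])) (eval_lit (by omega))
      (by omega)) (Reaches.nil (.inr ⟨i, by omega, by simp, ?_⟩))
    by_contra hcon
    rw [not_or] at hcon
    refine he ?_
    simp only [Nat.add_eq_zero_iff, mul_eq_zero, ite_eq_right_iff, one_ne_zero, imp_false]
    tauto
  · refine Reaches.skip ?_
    simp only [Config.setReg_regs]
    rcases hI with ⟨h₁, h₂⟩ | ⟨b, hb, h⟩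
    · refine .inl ⟨by simpa using h₁, fun b hb => ?_⟩
      rcases Nat.lt_succ_iff_lt_or_eq.1 hb with hb | rfl
      · exact h₂ b hb
      · simp only [Nat.add_eq_zero_iff, mul_eq_zero, ite_eq_right_iff, one_ne_zero, imp_false]
          at he
        tauto
    · exact .inr ⟨b, by omega, by simpa using h⟩

/-- The last edge fills the gap. If it is itself the one removed, p = m, the copy goes onto itself
and `Removal.move` is vacuous. -/
theorem reaches_removeEdge (hS : Sizes w l k n) {σ : Config} {m p : ℕ} (h7 : σ.regs 7 = m + 1)
    (hm : m + 1 ≤ 2 * k) (h24 : σ.regs 24 = p + 1) (hp : p < m + 1) :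
    Reaches w (memSize w l) ω removeEdge σ 7 fun τ =>
      Removal σ.mem τ.mem m p ∧ τ.regs 7 = m ∧ τ.mem 48 = m ∧
      ∀ a, a % 16 = 0 ∨ 4 ≤ a % 16 → a ≠ 48 → τ.mem a = σ.mem a := by
  have h16 := hS.space
  have hwc := hS.two_k_lt
  have hmm : memSize w l = 16 * (w * w * (2 ^ l * 2 ^ l)) := rfl
  have hpe : ∀ ρ : ℕ → ℕ, ρ 24 = p + 1 → (.reg 24 - 1 : Expr).eval w ρ = p := fun ρ hρ =>
    eval_sub (a := p + 1) (b := 1) (eval_reg hρ) (eval_lit (by omega)) (by omega)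
  refine Reaches.set 7 m (eval_sub (eval_reg h7) (eval_lit (by omega)) (by omega)) ?_
  refine Reaches.load 20 (16 * m + 2)
    (eval_addr (eval_reg (by simp)) (eval_lit (by omega)) (by omega) (by omega)) (by omega) ?_
  refine Reaches.load 21 (16 * m + 3)
    (eval_addr (eval_reg (by simp)) (eval_lit (by omega)) (by omega) (by omega)) (by omega) ?_
  refine Reaches.store (16 * p + 2) (σ.mem (16 * m + 2))
    (eval_addr (hpe _ (by simp [h24])) (eval_lit (by omega)) (by omega) (by omega)) (by omega)
    (eval_reg (by simp)) ?_
  refine Reaches.store (16 * p + 3) (σ.mem (16 * m + 3))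
    (eval_addr (hpe _ (by simp [h24])) (eval_lit (by omega)) (by omega) (by omega)) (by omega)
    (eval_reg (by simp)) ?_
  refine Reaches.store 48 m (eval_lit (by omega)) (by omega) (eval_reg (by simp)) ?_
  refine Reaches.nil (T := 0) ⟨⟨fun i hi hip => ?_, fun hpm => ?_⟩, by simp, by simp,
    fun a ha ha' => ?_⟩
  all_goals simp only [Config.setMem_mem, Config.setReg_mem]
  · rw [if_neg (by omega), if_neg (by omega), if_neg (by omega), if_neg (by omega),
      if_neg (by omega), if_neg (by omega)]
    exact ⟨rfl, rfl⟩
  · rw [if_neg (by omega), if_neg (by omega), if_pos trivial, if_neg (by omega), if_pos trivial]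
    exact ⟨rfl, rfl⟩
  · rw [if_neg (by omega), if_neg (by omega), if_neg (by omega)]

/-- Time for the repair of the matching. -/
def repairTime (w l k : ℕ) : ℕ := 2 * (w * w * (2 ^ l * 17 + 2 * k * 24 + 21)) + 2 * k * 9 + 50

/-- Only edges at u or v can lose their matched endpoint. Any other free vertex was free before, so
by the old maximality its degree is at most 4k; an informative sketch cannot overlook such a
neighbour. `Live` holds unconditionally, since the size bound must hold for every outcome. -/
theorem reaches_deleteEdge (hS : Sizes w l k n) {σ : Config} {m u v : ℕ} {P P' : Finset (ℕ × ℕ)}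
    (hP : CoveredGraph n k P) (hP' : CoveredGraph n k P')
    (hPP' : ∀ x y, (x, y) ∈ P' ↔ (x, y) ∈ P ∧ (x, y) ≠ (u, v) ∧ (x, y) ≠ (v, u))
    (hp : ParamRegs w l σ.regs) (h7 : σ.regs 7 = m) (hbase : BaseMem l ω P' σ.mem)
    (hsize : σ.mem 48 = m) (hst : Stored P σ.mem m) (h1 : σ.regs 1 = u) (h2 : σ.regs 2 = v) :
    Reaches w (memSize w l) ω deleteEdge σ (repairTime w l k) fun τ =>
      ∃ m', Live l ω P' τ m' ∧ (Saturated P σ.mem m → Informative l k ω P' u →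
        Informative l k ω P' v → Saturated P' τ.mem m') := by
  have hm := hst.le_of_covered hP
  set R := w * w * (2 ^ l * 17 + 2 * k * 24 + 21) with hR
  have hR' : ∀ m' ≤ 2 * k, w * w * (2 ^ l * 17 + m' * 24 + 21) ≤ R := fun m' hm' =>
    Nat.mul_le_mul_left _ (by omega)
  suffices h : Reaches w (memSize w l) ω deleteEdge σ
      (((m * 9 + 3) + ((7 + ((R + 13) + ((R + 13) + 1)) + 1) + 1)) + 1) fun τ =>
      ∃ m', Live l ω P' τ m' ∧ (Saturated P σ.mem m → Informative l k ω P' u →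
        Informative l k ω P' v → Saturated P' τ.mem m') from
    h.weaken (by unfold repairTime; omega) fun _ _ h => h
  refine Reaches.set 24 0 (eval_lit (Nat.two_pow_pos w)) ?_
  refine Reaches.cons (reaches_locate hS (m := m) (u := u) (v := v) (by simp [h7]) hm (by simp [h1])
    (by simp [h2]) (by simp)) ?_
  intro τ F hloc
  have hmem : τ.mem = σ.mem := F.mem rfl
  simp only [Config.setReg_mem] at hloc
  have g7 : τ.regs 7 = m := by simp [F.regs 7 rfl, h7]
  have gp : ParamRegs w l τ.regs :=
    ⟨by simp [F.regs 3 rfl, hp.width], by simp [F.regs 4 rfl, hp.word],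
      by simp [F.regs 5 rfl, hp.shift], by simp [F.regs 6 rfl, hp.reps]⟩
  refine Reaches.cons (T₂ := 1) (Reaches.cond (fun he => ?_) (fun he => ?_))
    (fun τ _ h => Reaches.nil h)
  · rcases hloc with ⟨h0, -⟩ | ⟨p, hpm, h24, huv⟩
    · exact absurd h0 he
    obtain ⟨m, rfl⟩ : ∃ m', m = m' + 1 := ⟨m - 1, by omega⟩
    refine Reaches.cons (reaches_removeEdge hS g7 hm h24 hpm) ?_
    rintro τ₁ F₁ ⟨hrem, r7, r48, rsame⟩
    rw [hmem] at hrem rsame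
    have hM₁ : ∀ z, Matched τ₁.mem m z ↔ Matched σ.mem (m + 1) z ∧ z ≠ u ∧ z ≠ v := by
      intro z
      rw [hrem.matched hst hpm]
      rcases huv with ⟨e₁, e₂⟩ | ⟨e₁, e₂⟩ <;> rw [e₁, e₂]
      tauto
    have hst₁ : Stored P' τ₁.mem m := by
      refine hrem.stored hst hpm fun x y hxy hx hx' => ?_
      rw [hPP']
      refine ⟨hxy, ?_, ?_⟩ <;>
      · rintro h
        rw [Prod.mk.injEq] at h
        rcases huv with ⟨e₁, e₂⟩ | ⟨e₁, e₂⟩ <;> rw [e₁] at hx <;> rw [e₂] at hx' <;> tauto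
    have L₁ : Live l ω P' τ₁ m :=
      ⟨⟨by simp [F₁.regs 3 rfl, gp.width], by simp [F₁.regs 4 rfl, gp.word],
        by simp [F₁.regs 5 rfl, gp.shift], by simp [F₁.regs 6 rfl, gp.reps]⟩, r7,
        hbase.congr rsame, r48, hst₁⟩
    refine Reaches.cons ((reaches_rematch hS (r := 1) (u := u) hP' L₁
      (by simp [F₁.regs 1 rfl, F.regs 1 rfl, h1]) (by rw [hM₁]; tauto)).weaken
      (Nat.add_le_add_right (hR' m (by omega)) 13) fun _ _ h => h) ?_
    rintro τ₂ F₂ ⟨m₂, L₂, h₂⟩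
    -- The search at u cannot have used v, because uv is no longer an edge.
    have hvfree : ¬ Matched τ₂.mem m₂ v := by
      have hv₁ : ¬ Matched τ₁.mem m v := by rw [hM₁]; tauto
      rcases h₂ with ⟨h₂, -⟩ | ⟨y, huy, -, h₂⟩
      · rwa [h₂]
      · rw [h₂]
        rw [hPP'] at huy
        have huv' : (u, v) ∈ P := by
          have := hst.edge p hpm
          rcases huv with ⟨e₁, e₂⟩ | ⟨e₁, e₂⟩ <;> rw [e₁, e₂] at this
          · exact this
          · exact hP.symm _ _ this
        rintro (h | rfl | rfl)
        · exact hv₁ h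
        · exact hP.irrefl _ huv'
        · exact huy.2.1 rfl
    have hm₂ := L₂.stored.le_of_covered hP'
    refine Reaches.cons ((reaches_rematch hS (r := 2) (u := v) hP' L₂
      (by simp [F₂.regs 2 rfl, F₁.regs 2 rfl, F.regs 2 rfl, h2]) hvfree).weaken
      (Nat.add_le_add_right (hR' m₂ hm₂) 13) fun _ _ h => h) ?_
    rintro τ₃ F₃ ⟨m₃, L₃, h₃⟩
    refine Reaches.nil (T := 0) ⟨m₃, L₃, fun hsat hu hv => ?_⟩
    have up₂ : ∀ z, Matched τ₁.mem m z → Matched τ₂.mem m₂ z := by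
      intro z hz
      rcases h₂ with ⟨h₂, -⟩ | ⟨y, -, -, h₂⟩ <;> rw [h₂]
      · exact hz
      · exact .inl hz
    have up₃ : ∀ z, Matched τ₂.mem m₂ z → Matched τ₃.mem m₃ z := by
      intro z hz
      rcases h₃ with ⟨h₃, -⟩ | ⟨y, -, -, h₃⟩ <;> rw [h₃]
      · exact hz
      · exact .inl hz
    -- A free vertex is light: its neighbours lie among the at most 2(m + 1) ≤ 4k vertices of the
    -- old maximal matching.
    have heavy : ∀ y, y ≠ u → y ≠ v → ¬ Matched τ₁.mem m y → (nbrs P' y).card ≤ 4 * k := by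
      intro y hyu hyv hy
      refine (card_le_of_matched (mem := σ.mem) (m := m + 1) _ fun x hx => ?_).trans (by omega)
      rw [mem_nbrs, hPP'] at hx
      refine (hsat y x hx.1).resolve_left fun h => hy ?_
      rw [hM₁]
      exact ⟨h, hyu, hyv⟩
    -- An uncovered edge at u or v ends in a free light vertex, which was free already when the
    -- search at u or v reported failure.
    have key : ∀ x y, (x, y) ∈ P' → (x = u ∨ x = v) → Matched τ₃.mem m₃ x ∨ Matched τ₃.mem m₃ y := by
      intro x y hxy hx
      by_contra hcon
      rw [not_or] at hcon
      have hy₂ : ¬ Matched τ₂.mem m₂ y := fun h => hcon.2 (up₃ y h)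
      have hy₁ : ¬ Matched τ₁.mem m y := fun h => hy₂ (up₂ y h)
      have hxy' := (hPP' x y).1 hxy
      have hyu : y ≠ u := by
        rintro rfl
        rcases hx with rfl | rfl
        · exact hP.irrefl _ hxy'.1
        · exact hxy'.2.2 rfl
      have hyv : y ≠ v := by
        rintro rfl
        rcases hx with rfl | rfl
        · exact hxy'.2.1 rfl
        · exact hP.irrefl _ hxy'.1
      have hdeg := heavy y hyu hyv hy₁
      rcases hx with rfl | rfl
      · rcases h₂ with ⟨-, hall⟩ | ⟨z, -, -, h₂⟩
        · exact hy₁ (hu.matched (by omega) hall y hxy hdeg)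
        · exact hcon.1 (up₃ _ ((h₂ _).2 (.inr (.inl rfl))))
      · rcases h₃ with ⟨-, hall⟩ | ⟨z, -, -, h₃⟩
        · exact hy₂ (hv.matched (by omega) hall y hxy hdeg)
        · exact hcon.1 ((h₃ _).2 (.inr (.inl rfl)))
    intro x y hxy
    by_cases hx : x = u ∨ x = v
    · exact key x y hxy hx
    by_cases hy : y = u ∨ y = v
    · exact (key y x (hP'.symm _ _ hxy) hy).symm
    have hxy' := (hPP' x y).1 hxy
    rw [not_or] at hx hy
    refine (hsat x y hxy'.1).imp (fun h => up₃ _ (up₂ _ ?_)) (fun h => up₃ _ (up₂ _ ?_))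
    · rw [hM₁]; exact ⟨h, hx⟩
    · rw [hM₁]; exact ⟨h, hy⟩
  -- The deleted edge was not in the matching, so the matching stays valid and maximal as it is.
  · rcases hloc with ⟨-, hall⟩ | ⟨p, -, h24, -⟩
    · refine Reaches.skip (T := _) ⟨m, ⟨gp, g7, hmem ▸ hbase, hmem ▸ hsize, ?_⟩, ?_⟩
      · rw [hmem]
        refine ⟨fun i hi => ?_, hst.disjoint⟩
        rw [hPP']
        have := hall i hi
        refine ⟨hst.edge i hi, ?_, ?_⟩ <;> rw [Ne, Prod.mk.injEq]
        · exact this.1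
        · exact this.2
      · intro hsat _ _ x y hxy
        rw [hmem]
        exact hsat x y ((hPP' x y).1 hxy).1
    · have : τ.regs 24 = 0 := he
      omega

/-- Time bound for an update. -/
def updateTime (w l k : ℕ) : ℕ := 2 * (w * w * 20) + repairTime w l k + 30

/-- The memory invariant between updates. -/
structure Invariant {w : ℕ} (l : ℕ) (ω : ℕ → Fin (2 ^ w)) (P : Finset (ℕ × ℕ)) (mem : ℕ → ℕ)
    (m : ℕ) : Prop where
  base : BaseMem l ω P mem
  size : mem 48 = m
  stored : Stored P mem m

/-- Effect of an update (`op = 0`: insertion, `op = 1`: deletion) on the set of ordered pairs. -/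
def EdgeStep (op u v : ℕ) (P P' : Finset (ℕ × ℕ)) : Prop :=
  (op = 0 ∧ (u, v) ∉ P ∧ P' = insert (v, u) (insert (u, v) P)) ∨
  (op = 1 ∧ (u, v) ∈ P ∧ P' = (P.erase (u, v)).erase (v, u))

theorem reaches_update (hS : Sizes w l k n) {σ : Config} {op u v m : ℕ} {P P' : Finset (ℕ × ℕ)}
    (hP : CoveredGraph n k P) (hP' : CoveredGraph n k P') (hstep : EdgeStep op u v P P')
    (hun : u < n) (hvn : v < n) (huv : u ≠ v) (h0 : σ.regs 0 = op) (h1 : σ.regs 1 = u)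
    (h2 : σ.regs 2 = v) (h : Invariant l ω P σ.mem m) :
    Reaches w (memSize w l) ω updateProgram σ (updateTime w l k) fun τ =>
      ∃ m', Invariant l ω P' τ.mem m' ∧ (Saturated P σ.mem m →
        (op = 1 → Informative l k ω P' u ∧ Informative l k ω P' v) →
        Saturated P' τ.mem m') := by
  have h16 := hS.space
  have hwc := hS.two_k_lt
  have hws := hS.word_sq_le_cells
  have hmm : memSize w l = 16 * (w * w * (2 ^ l * 2 ^ l)) := rfl
  have hm := h.stored.le_of_covered hP
  -- Between the two toggles the relation contains only one orientation of the edge and is not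
  -- symmetric; the sketch lemmas therefore ask only that it lives on vertices below n.
  obtain ⟨P₁, hT₁, hT₂, hP₁⟩ : ∃ P₁, Toggle op (u, v) P P₁ ∧ Toggle op (v, u) P₁ P' ∧
      P₁ ⊆ Finset.range n ×ˢ Finset.range n := by
    have hne : (v, u) ≠ (u, v) := by
      rw [Ne, Prod.mk.injEq]; exact fun h => huv h.2
    rcases hstep with ⟨rfl, huv', rfl⟩ | ⟨rfl, huv', rfl⟩
    · refine ⟨insert (u, v) P, .inl ⟨rfl, huv', rfl⟩, .inl ⟨rfl, ?_, rfl⟩, ?_⟩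
      · rw [Finset.mem_insert, not_or]
        exact ⟨hne, fun h => huv' (hP.symm _ _ h)⟩
      · exact (Finset.subset_insert _ _).trans hP'.subset
    · refine ⟨P.erase (u, v), .inr ⟨rfl, huv', rfl⟩, .inr ⟨rfl, ?_, rfl⟩, ?_⟩
      · rw [Finset.mem_erase]
        exact ⟨hne, hP.symm _ _ huv'⟩
      · exact (Finset.erase_subset _ _).trans hP.subset
  suffices hsuff : Reaches w (memSize w l) ω updateProgram σ
      (((w * w * 20 + 3) + (((w * w * 20 + 3) + ((repairTime w l k + 1) + 1)) + 2)) + 7) fun τ =>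
      ∃ m', Invariant l ω P' τ.mem m' ∧ (Saturated P σ.mem m →
        (op = 1 → Informative l k ω P' u ∧ Informative l k ω P' v) →
        Saturated P' τ.mem m') from
    hsuff.weaken (by unfold updateTime; omega) fun _ _ h => h
  refine Reaches.load 3 0 (eval_lit (by omega)) (by omega) ?_
  refine Reaches.load 4 16 (eval_lit (by omega)) (by omega) ?_
  refine Reaches.load 5 32 (eval_lit (by omega)) (by omega) ?_
  refine Reaches.load 7 48 (eval_lit (by omega)) (by omega) ?_
  simp only [Config.setReg_mem, h.base.width, h.base.word, h.base.shift, h.size]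
  refine Reaches.set 6 (w * w) (eval_mul (eval_reg (by simp)) (eval_reg (by simp)) (by omega)) ?_
  refine Reaches.set 10 u (eval_reg (by simp [h1])) ?_
  refine Reaches.set 11 v (eval_reg (by simp [h2])) ?_
  refine Reaches.cons (reaches_sketchPair hS (P := P) (P' := P₁) (op := op) (x := u) (z := v)
    ⟨by simp, by simp, by simp, by simp⟩
    (by simp [h0]) (by simp) (by simp) h.base.seeds hP.subset hun hvn hT₁ h.base.cells) ?_
  rintro τ₁ F₁ ⟨c₁, low₁⟩
  simp only [Config.setReg_mem] at low₁
  refine Reaches.set 10 v (eval_reg (by simp [F₁.regs 2 rfl, h2])) ?_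
  refine Reaches.set 11 u (eval_reg (by simp [F₁.regs 1 rfl, h1])) ?_
  have hseed₁ : SeedMem ω τ₁.mem := by
    intro t ht
    rw [low₁ _ (by omega), low₁ _ (by omega), low₁ _ (by omega), low₁ _ (by omega)]
    exact h.base.seeds t ht
  refine Reaches.cons (reaches_sketchPair hS (P := P₁) (P' := P') (op := op) (x := v) (z := u)
    ⟨by simp [F₁.regs 3 rfl], by simp [F₁.regs 4 rfl], by simp [F₁.regs 5 rfl],
      by simp [F₁.regs 6 rfl]⟩
    (by simp [F₁.regs 0 rfl, h0]) (by simp) (by simp) hseed₁ hP₁ hvn hun hT₂ c₁) ?_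
  rintro τ₂ F₂ ⟨c₂, low₂⟩
  simp only [Config.setReg_mem] at low₂
  have low : ∀ a, a % 16 < 8 → τ₂.mem a = σ.mem a := fun a ha => by rw [low₂ a ha, low₁ a ha]
  have hseed₂ : SeedMem ω τ₂.mem := by
    intro t ht
    rw [low _ (by omega), low _ (by omega), low _ (by omega), low _ (by omega)]
    exact h.base.seeds t ht
  have hbase₂ : BaseMem l ω P' τ₂.mem :=
    ⟨by rw [low _ (by omega), h.base.width], by rw [low _ (by omega), h.base.word],
      by rw [low _ (by omega), h.base.shift], hseed₂, c₂⟩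
  have hp₂ : ParamRegs w l τ₂.regs :=
    ⟨by simp [F₂.regs 3 rfl, F₁.regs 3 rfl], by simp [F₂.regs 4 rfl, F₁.regs 4 rfl],
      by simp [F₂.regs 5 rfl, F₁.regs 5 rfl], by simp [F₂.regs 6 rfl, F₁.regs 6 rfl]⟩
  have h7 : τ₂.regs 7 = m := by simp [F₂.regs 7 rfl, F₁.regs 7 rfl]
  have g0 : τ₂.regs 0 = op := by simp [F₂.regs 0 rfl, F₁.regs 0 rfl, h0]
  have g1 : τ₂.regs 1 = u := by simp [F₂.regs 1 rfl, F₁.regs 1 rfl, h1]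
  have g2 : τ₂.regs 2 = v := by simp [F₂.regs 2 rfl, F₁.regs 2 rfl, h2]
  have hsame : ∀ i < m, τ₂.mem (16 * i + 2) = σ.mem (16 * i + 2) ∧
      τ₂.mem (16 * i + 3) = σ.mem (16 * i + 3) := fun i _ =>
    ⟨low _ (by omega), low _ (by omega)⟩
  have hst₂ := h.stored.congr hsame
  have hsize₂ : τ₂.mem 48 = m := by rw [low _ (by omega), h.size]
  have hM₂ : ∀ z, Matched τ₂.mem m z ↔ Matched σ.mem m z := fun z => matched_congr hsame
  refine Reaches.cons (T₂ := 1) (Reaches.cond (fun he => ?_) (fun he => ?_))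
    (fun τ _ h => Reaches.nil h)
  · rcases hstep with ⟨h0', -⟩ | ⟨-, huv', hPeq⟩
    · exact absurd (g0.trans h0') he
    refine (reaches_deleteEdge hS hP hP' (u := u) (v := v) (fun x y => ?_) hp₂ h7 hbase₂ hsize₂
      hst₂ g1 g2).weaken le_rfl ?_
    · rw [hPeq, Finset.mem_erase, Finset.mem_erase]; tauto
    · rintro τ - ⟨m', L, hL⟩
      refine ⟨m', ⟨L.base, L.size, L.stored⟩, fun hsat hinf => ?_⟩
      have hop : op = 1 := by
        have := hT₁.op_le
        have he' : op ≠ 0 := fun h => he (g0.trans h)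
        omega
      exact hL (fun x y hxy => by rw [hM₂, hM₂]; exact hsat x y hxy) (hinf hop).1 (hinf hop).2
  · rcases hstep with ⟨-, huv', hPeq⟩ | ⟨h1', -⟩
    · have hsub : ∀ p ∈ P, p ∈ P' := fun p hp => by
        rw [hPeq]; exact Finset.mem_insert_of_mem (Finset.mem_insert_of_mem hp)
      have L₂ : Live l ω P' τ₂ m :=
        ⟨hp₂, h7, hbase₂, hsize₂, fun i hi => hsub _ (hst₂.edge i hi), hst₂.disjoint⟩
      refine (reaches_insertEdge hS hP' L₂ g1 g2 (by rw [hPeq]; simp)).weaken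
        (by unfold repairTime; omega) ?_
      rintro τ - ⟨m', L, hup, hnew⟩
      refine ⟨m', ⟨L.base, L.size, L.stored⟩, fun hsat _ x y hxy => ?_⟩
      rw [hPeq, Finset.mem_insert, Finset.mem_insert, Prod.mk.injEq, Prod.mk.injEq] at hxy
      rcases hxy with ⟨rfl, rfl⟩ | ⟨rfl, rfl⟩ | hxy
      · exact hnew.symm
      · exact hnew
      · exact (hsat x y hxy).imp (fun h => hup _ ((hM₂ _).2 h)) (fun h => hup _ ((hM₂ _).2 h))
    · have : τ₂.regs 0 = 0 := he
      omega

/-! ### Setup and query -/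

/-- Emits the stored edge `reg 18`. -/
def emitStep : Cmd :=
  block [.load 20 (addr (.reg 18) 2), .emit (.reg 20), .load 20 (addr (.reg 18) 3),
    .emit (.reg 20)]

/-- The query program. -/
def queryProgram : Cmd := block [.load 7 48, forLoop 18 7 emitStep]

theorem reaches_query (hS : Sizes w l k n) {σ : Config} {m : ℕ} (hm : m ≤ 2 * k)
    (h48 : σ.mem 48 = m) (hout : σ.out = []) :
    Reaches w (memSize w l) ω queryProgram σ (m * 8 + 5) fun τ =>
      τ.mem = σ.mem ∧ τ.pos = σ.pos ∧ τ.out = (List.range m).flatMap fun i =>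
        [σ.mem (16 * i + 2), σ.mem (16 * i + 3)] := by
  have h16 := hS.space
  have hwc := hS.two_k_lt
  have hmm : memSize w l = 16 * (w * w * (2 ^ l * 2 ^ l)) := rfl
  suffices h : Reaches w (memSize w l) ω queryProgram σ (m * 8 + 5) fun τ =>
      τ.out = (List.range m).flatMap fun i => [σ.mem (16 * i + 2), σ.mem (16 * i + 3)] from
    h.weaken le_rfl fun τ F h => ⟨F.mem rfl, F.pos rfl, h⟩
  refine Reaches.load (T := m * 8 + 4) 7 48 (eval_lit (by omega)) (by omega) ?_
  rw [h48]
  refine Reaches.cons (T₁ := m * 8 + 3) (T₂ := 1)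
    (Reaches.forLoop (T := 5) hS.word_pos m (by simp) (by omega) rfl rfl (by decide)
      (fun j τ => τ.out = (List.range j).flatMap fun i =>
        [σ.mem (16 * i + 2), σ.mem (16 * i + 3)]) (by simp [hout]) ?_)
    (fun _ _ h => Reaches.nil h)
  intro i hi τ F h18 hI
  have hmem : τ.mem = σ.mem := F.mem rfl
  refine Reaches.load 20 (16 * i + 2)
    (eval_addr (eval_reg h18) (eval_lit (by omega)) (by omega) (by omega)) (by omega) ?_
  refine Reaches.emit (σ.mem (16 * i + 2)) (eval_reg (by simp [hmem])) ?_
  refine Reaches.load 20 (16 * i + 3)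
    (eval_addr (eval_reg (by simp [h18])) (eval_lit (by omega)) (by omega) (by omega))
    (by omega) ?_
  refine Reaches.emit (σ.mem (16 * i + 3)) (eval_reg (by simp [hmem])) ?_
  refine Reaches.nil (T := 0) ?_
  simp [hI, List.range_succ]

/-- Draws the seeds of sketch `reg 12`. -/
def seedStep : Cmd :=
  block [.rand 13, .store (addr (.reg 12) 4) (.reg 13), .rand 13,
    .store (addr (.reg 12) 5) (.reg 13), .rand 13, .store (addr (.reg 12) 6) (.reg 13),
    .rand 13, .store (addr (.reg 12) 7) (.reg 13)]

/-- The setup program. -/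
def setupProgram : Cmd :=
  block [.set 4 (.reg 3), .set 3 1, .set 5 (.reg 4),
    .loop (.bin .lt (.reg 3) (256 * .reg 1))
      (block [.set 3 (.reg 3 + .reg 3), .set 5 (.reg 5 - 1)]),
    .store 0 (.reg 3), .store 16 (.reg 4), .store 32 (.reg 5), .set 6 (.reg 4 * .reg 4),
    forLoop 12 6 seedStep]

/-- Doubling from 1 as long as the value is below 256k ends at 2^l with l the ceiling of the
logarithm. Cleared memory already is the family of sketches of the empty graph. -/
theorem reaches_setup (hS : Sizes w l k n) (hl : l = Nat.clog 2 (256 * k)) {σ : Config}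
    (h1 : σ.regs 1 = k) (h3 : σ.regs 3 = w) (hmem : ∀ a, σ.mem a = 0) (hpos : σ.pos = 0) :
    Reaches w (memSize w l) ω setupProgram σ (w * 4 + w * w * 12 + 20) fun τ =>
      Invariant l ω ∅ τ.mem 0 := by
  have h16 := hS.space
  have hwc := hS.two_k_lt
  have hws := hS.word_sq_le_cells
  have hwB := hS.width_le_cells
  have hBk := hS.width_le
  have hkB := hS.le_width
  have hmm : memSize w l = 16 * (w * w * (2 ^ l * 2 ^ l)) := rfl
  have hww : w < 2 ^ w := Nat.lt_two_pow_self
  have hw := hS.word_pos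
  have hlw := hS.le_word
  have hk1 := hS.one_le_k
  suffices h : Reaches w (memSize w l) ω setupProgram σ
      ((l * (3 + 1) + 1 + (((w * w * 12 + 3) + 1) + 4)) + 3) fun τ =>
      Invariant l ω ∅ τ.mem 0 from h.weaken (by omega) fun _ _ h => h
  refine Reaches.set 4 w (eval_reg h3) ?_
  refine Reaches.set 3 1 (eval_lit (by omega)) ?_
  refine Reaches.set 5 w (eval_reg (by simp)) ?_
  refine Reaches.cons (Reaches.loop l (fun i τ => τ.regs 3 = 2 ^ i ∧ τ.regs 5 = w - i)
    (by simp) ?_ ?_) ?_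
  · rintro i hi τ F ⟨g3, g5⟩
    have hi' : 2 ^ i < 256 * k := by
      rw [hl] at hi
      exact (Nat.lt_clog_iff_pow_lt (by omega)).1 hi
    have hsucc : 2 ^ (i + 1) ≤ 2 ^ l := Nat.pow_le_pow_right (by omega) hi
    have h2 : 2 ^ (i + 1) = 2 ^ i + 2 ^ i := by rw [pow_succ]; omega
    refine ⟨?_, ?_⟩
    · rw [eval_lt hw (eval_reg g3) (eval_mul (eval_lit (by omega))
        (eval_reg (a := k) (by simp [F.regs 1 rfl, h1])) (by omega)), if_pos hi']
      omega
    · refine Reaches.set 3 (2 ^ (i + 1)) (h2 ▸ eval_add (eval_reg g3) (eval_reg g3) (by omega)) ?_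
      refine Reaches.set 5 (w - (i + 1)) (eval_sub (a := w - i) (b := 1) (eval_reg (by simp [g5]))
        (eval_lit (by omega)) (by omega)) ?_
      exact Reaches.nil (T := 0) (by simp)
  · rintro τ F ⟨g3, -⟩
    rw [eval_lt hw (eval_reg g3) (eval_mul (eval_lit (by omega))
        (eval_reg (a := k) (by simp [F.regs 1 rfl, h1])) (by omega)), if_neg (by omega)]
  rintro τ F ⟨g3, g5⟩
  have hmem' : ∀ a, τ.mem a = 0 := fun a => by rw [F.mem rfl]; simp [hmem]
  have hpos' : τ.pos = 0 := by rw [F.pos rfl]; simp [hpos]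
  have g4 : τ.regs 4 = w := by simp [F.regs 4 rfl]
  refine Reaches.store 0 (2 ^ l) (eval_lit (by omega)) (by omega) (eval_reg g3) ?_
  refine Reaches.store 16 w (eval_lit (by omega)) (by omega) (eval_reg (by simp [g4])) ?_
  refine Reaches.store 32 (w - l) (eval_lit (by omega)) (by omega) (eval_reg (by simp [g5])) ?_
  refine Reaches.set 6 (w * w) (eval_mul (eval_reg (by simp [g4])) (eval_reg (by simp [g4]))
    (by omega)) ?_
  refine Reaches.cons (T₁ := w * w * 12 + 3) (T₂ := 1) (Reaches.forLoop (T := 9) hw (w * w) (by simp) (by omega) rfl rfl (by decide)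
    (fun j υ => υ.pos = 4 * j ∧ υ.mem 0 = 2 ^ l ∧ υ.mem 16 = w ∧ υ.mem 32 = w - l ∧ υ.mem 48 = 0 ∧
      (∀ a, 8 ≤ a % 16 → υ.mem a = 0) ∧
      ∀ t < j, υ.mem (16 * t + 4) = ω (4 * t) ∧ υ.mem (16 * t + 5) = ω (4 * t + 1) ∧
        υ.mem (16 * t + 6) = ω (4 * t + 2) ∧ υ.mem (16 * t + 7) = ω (4 * t + 3)) ?_ ?_) ?_
  · refine ⟨by simp [hpos'], by simp, by simp, by simp, by simp [hmem'], fun a ha => ?_,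
      fun _ h => absurd h (by omega)⟩
    simp only [Config.setReg_mem, Config.setMem_mem]
    rw [if_neg (by omega), if_neg (by omega), if_neg (by omega), hmem']
  · rintro t ht υ G g12 ⟨p, a0, a16, a32, a48, hi, hsd⟩
    refine Reaches.rand 13 (Reaches.store (16 * t + 4) (ω (4 * t))
      (eval_addr (eval_reg (by simp [g12])) (eval_lit (by omega)) (by omega) (by omega)) (by omega)
      (eval_reg (by simp [p])) ?_)
    refine Reaches.rand 13 (Reaches.store (16 * t + 5) (ω (4 * t + 1))
      (eval_addr (eval_reg (by simp [g12])) (eval_lit (by omega)) (by omega) (by omega)) (by omega)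
      (eval_reg (by simp [p])) ?_)
    refine Reaches.rand 13 (Reaches.store (16 * t + 6) (ω (4 * t + 2))
      (eval_addr (eval_reg (by simp [g12])) (eval_lit (by omega)) (by omega) (by omega)) (by omega)
      (eval_reg (by simp [p])) ?_)
    refine Reaches.rand 13 (Reaches.store (16 * t + 7) (ω (4 * t + 3))
      (eval_addr (eval_reg (by simp [g12])) (eval_lit (by omega)) (by omega) (by omega)) (by omega)
      (eval_reg (by simp [p])) ?_)
    refine Reaches.nil (T := 0) ⟨by simp [p]; omega, ?_, ?_, ?_, ?_, fun a ha => ?_,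
      fun t' ht' => ?_⟩
    all_goals simp only [Config.setReg_mem, Config.setMem_mem]
    · rw [if_neg (by omega), if_neg (by omega), if_neg (by omega), if_neg (by omega), a0]
    · rw [if_neg (by omega), if_neg (by omega), if_neg (by omega), if_neg (by omega), a16]
    · rw [if_neg (by omega), if_neg (by omega), if_neg (by omega), if_neg (by omega), a32]
    · rw [if_neg (by omega), if_neg (by omega), if_neg (by omega), if_neg (by omega), a48]
    · rw [if_neg (by omega), if_neg (by omega), if_neg (by omega), if_neg (by omega), hi a ha]
    · by_cases htt : t' = t
      · subst htt; simp
      · have := hsd t' (by omega)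
        rw [if_neg (by omega), if_neg (by omega), if_neg (by omega), if_neg (by omega),
          if_neg (by omega), if_neg (by omega), if_neg (by omega), if_neg (by omega),
          if_neg (by omega), if_neg (by omega), if_neg (by omega), if_neg (by omega),
          if_neg (by omega), if_neg (by omega), if_neg (by omega), if_neg (by omega)]
        exact this
  · rintro υ - ⟨-, a0, a16, a32, a48, hi, hsd⟩
    refine Reaches.nil ⟨⟨a0, a16, a32, hsd, fun t ht r hr b hb => ?_⟩, a48,
      ⟨fun _ h => absurd h (by omega), fun _ h => absurd h (by omega)⟩⟩
    unfold CellAt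
    rw [hi _ (by omega), hi _ (by omega), hi _ (by omega)]
    simp [bucket]

end DynStream

/-! ## Probability that a neighbour is recovered -/

namespace DynStream

open WordRAM

/-! ### Multiply-shift hashing is pairwise independent -/

/-- As a varies, multiplication by 2^t · o hits each attainable residue exactly 2^t times, and an
interval of length 2^r contains only 2^(r-t) residues congruent to c modulo 2^t. -/
theorem card_mul_shift_le {w r t : ℕ} (hr : r ≤ w) (ht : t ≤ r) (c o β : ℕ) (ho : Odd o) :
    (Finset.univ.filter fun a : Fin (2 ^ w) =>
      (c + a * (2 ^ t * o)) % 2 ^ w / 2 ^ r = β).card ≤ 2 ^ r := by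
  have hcop : Nat.Coprime (2 ^ w) o := (Nat.coprime_two_left.2 ho).pow_left w
  have hwt : 2 ^ w = 2 ^ t * 2 ^ (w - t) := by rw [← pow_add]; congr 1; omega
  have hrt : 2 ^ r = 2 ^ t * 2 ^ (r - t) := by rw [← pow_add]; congr 1; omega
  set e : Fin (2 ^ w) → ℕ := fun a => a * o % 2 ^ w with he
  set V : Fin (2 ^ w) → ℕ := fun a => (c + a * (2 ^ t * o)) % 2 ^ w with hV
  have hcard : (Finset.range (2 ^ (r - t)) ×ˢ Finset.range (2 ^ t)).card = 2 ^ r := by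
    rw [Finset.card_product, Finset.card_range, Finset.card_range, hrt, Nat.mul_comm]
  refine le_of_le_of_eq ?_ hcard
  -- Low bits of `V a` come from c, middle bits from the first component, high bits from β. So `V a`
  -- is known, hence a · o modulo 2^(w-t); the second component supplies the top t bits of a · o,
  -- and o is invertible.
  refine Finset.card_le_card_of_injOn
    (fun a => (V a / 2 ^ t % 2 ^ (r - t), e a / 2 ^ (w - t))) (fun a _ => ?_) ?_
  · simp only [Finset.coe_product, Finset.coe_range, Set.mem_prod, Set.mem_Iio]
    refine ⟨Nat.mod_lt _ (Nat.two_pow_pos _), ?_⟩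
    rw [Nat.div_lt_iff_lt_mul (Nat.two_pow_pos _), ← hwt]
    exact Nat.mod_lt _ (Nat.two_pow_pos _)
  · intro a ha a' ha' h
    simp only [Prod.mk.injEq] at h
    obtain ⟨h₁, h₂⟩ := h
    have hva : V a / 2 ^ r = β := by simpa using ha
    have hva' : V a' / 2 ^ r = β := by simpa using ha'
    have hmod : ∀ a, V a % 2 ^ t = c % 2 ^ t := by
      intro a
      simp only [hV]
      rw [Nat.mod_mod_of_dvd _ (pow_dvd_pow 2 (ht.trans hr)), Nat.mul_left_comm,
        Nat.add_mul_mod_self_left]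
    have hdiv : V a / 2 ^ t = V a' / 2 ^ t := by
      rw [hrt, ← Nat.div_div_eq_div_mul] at hva hva'
      rw [← Nat.div_add_mod (V a / 2 ^ t) (2 ^ (r - t)), hva, h₁, ← hva', Nat.div_add_mod]
    have hVV : V a = V a' := by
      rw [← Nat.div_add_mod (V a) (2 ^ t), hdiv, hmod, ← hmod a', Nat.div_add_mod]
    have h₃ : a * o ≡ a' * o [MOD 2 ^ (w - t)] := by
      have : c + 2 ^ t * (a * o) ≡ c + 2 ^ t * (a' * o) [MOD 2 ^ t * 2 ^ (w - t)] := by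
        rw [← hwt, Nat.mul_left_comm, Nat.mul_left_comm _ (a' : ℕ)]; exact hVV
      exact Nat.ModEq.mul_left_cancel' (Nat.two_pow_pos t).ne' (Nat.ModEq.add_left_cancel' c this)
    have h₄ : ∀ a, e a % 2 ^ (w - t) = a * o % 2 ^ (w - t) := fun a =>
      Nat.mod_mod_of_dvd _ (pow_dvd_pow 2 (by omega))
    have h₅ : e a = e a' := by
      rw [← Nat.div_add_mod (e a) (2 ^ (w - t)), h₂, h₄, h₃, ← h₄, Nat.div_add_mod]
    have h₆ : (a : ℕ) ≡ a' [MOD 2 ^ w] := Nat.ModEq.cancel_right_of_coprime hcop h₅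
    exact Fin.ext (Nat.ModEq.eq_of_lt_of_lt h₆ a.2 a'.2)

/-- Fix p = ay + b modulo 2^w, for which there are at most c · 2^r values. Then a determines b, and
a collision says that p + a(x - y) lies in the same block of length 2^r as p, which allows at most
2^r values of a. Bounding the common value by c combines collision and sampling in one count. -/
theorem card_mulShift_collision_le {w r x y : ℕ} (hr : r ≤ w) (hx : x < 2 ^ r) (hy : y < 2 ^ r)
    (hxy : x ≠ y) (c : ℕ) :
    (Finset.univ.filter fun q : Fin (2 ^ w) × Fin (2 ^ w) =>
      mulShift w q.1 q.2 r x = mulShift w q.1 q.2 r y ∧ mulShift w q.1 q.2 r y < c).card ≤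
      2 ^ r * (c * 2 ^ r) := by
  have hyw : y < 2 ^ w := hy.trans_le (Nat.pow_le_pow_right (by omega) hr)
  -- The natural number x + (2^w - y) stands for x - y modulo 2^w. Its 2-adic valuation is at most r
  -- because x and y are distinct and below 2^r.
  obtain ⟨t, o, ho, hd⟩ := Nat.exists_eq_two_pow_mul_odd (n := x + (2 ^ w - y)) (by omega)
  have htr : t ≤ r := by
    by_contra hcon
    have hdvd : 2 ^ r ∣ x + (2 ^ w - y) :=
      hd ▸ (pow_dvd_pow 2 (by omega : r ≤ t)).trans (dvd_mul_right _ _)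
    have hw : 2 ^ r ∣ 2 ^ w := pow_dvd_pow 2 hr
    have hmod : x ≡ y [MOD 2 ^ r] := by
      have h₁ : x + (2 ^ w - y) + y ≡ 0 + y [MOD 2 ^ r] :=
        Nat.ModEq.add_right y ((Nat.modEq_zero_iff_dvd).2 hdvd)
      have h₂ : x + (2 ^ w - y) + y = x + 2 ^ w := by omega
      rw [h₂, Nat.zero_add] at h₁
      exact (Nat.ModEq.add_left x ((Nat.modEq_zero_iff_dvd).2 hw)).symm.trans h₁
    exact hxy (Nat.ModEq.eq_of_lt_of_lt hmod hx hy)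
  have := Finset.card_le_mul_card_image_of_maps_to
    (s := Finset.univ.filter fun q : Fin (2 ^ w) × Fin (2 ^ w) =>
      mulShift w q.1 q.2 r x = mulShift w q.1 q.2 r y ∧ mulShift w q.1 q.2 r y < c)
    (t := Finset.range (c * 2 ^ r)) (f := fun q => (q.1 * y + q.2) % 2 ^ w) ?_ (2 ^ r) ?_
  · simpa using this
  · intro q hq
    have := (Finset.mem_filter.1 hq).2.2
    unfold mulShift at this
    rw [Nat.div_lt_iff_lt_mul (Nat.two_pow_pos r)] at this
    simpa using this
  · intro p _
    refine le_trans ?_ (card_mul_shift_le hr htr p o (p / 2 ^ r) ho)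
    refine Finset.card_le_card_of_injOn Prod.fst ?_ ?_
    · intro q hq
      simp only [Finset.coe_filter, Finset.mem_filter, Finset.mem_univ, true_and,
        Set.mem_ofPred_eq] at hq ⊢
      obtain ⟨⟨h₁, -⟩, h₂⟩ := hq
      unfold mulShift at h₁
      rw [← hd, ← h₂, ← h₁, Nat.mod_add_mod]
      have key : ∀ a b N z : ℕ, N = y + z → a * y + b + a * (x + z) = a * x + b + N * a := by
        rintro a b _ z rfl; ring
      rw [key _ _ (2 ^ w) _ (by omega), Nat.add_mul_mod_self_left]
    · intro q hq q' hq' h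
      have h₁ : (q.1 * y + q.2) % 2 ^ w = p := by
        simp only [Finset.coe_filter, Set.mem_ofPred_eq] at hq; exact hq.2
      have h₂ : (q'.1 * y + q'.2) % 2 ^ w = p := by
        simp only [Finset.coe_filter, Set.mem_ofPred_eq] at hq'; exact hq'.2
      refine Prod.ext h (Fin.ext ?_)
      have h₃ : (q.1 : ℕ) * y + q.2 ≡ q.1 * y + q'.2 [MOD 2 ^ w] := by
        rw [h] at h₁ ⊢; exact h₁.trans h₂.symm
      exact Nat.ModEq.eq_of_lt_of_lt (Nat.ModEq.add_left_cancel' _ h₃) q.2.2 q'.2.2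

/-- For fixed a the map b ↦ ax + b permutes the residues, so the sampling probability is exact. -/
theorem card_mulShift_lt {w r c : ℕ} (hc : c * 2 ^ r ≤ 2 ^ w) (x : ℕ) :
    (Finset.univ.filter fun q : Fin (2 ^ w) × Fin (2 ^ w) =>
      mulShift w q.1 q.2 r x < c).card = 2 ^ w * (c * 2 ^ r) := by
  have hfib : ∀ a : Fin (2 ^ w), (Finset.univ.filter fun b : Fin (2 ^ w) =>
      mulShift w a b r x < c).card = c * 2 ^ r := by
    intro a
    have hinj : Function.Injective fun b : Fin (2 ^ w) =>
        (⟨(a * x + b) % 2 ^ w, Nat.mod_lt _ (Nat.two_pow_pos w)⟩ : Fin (2 ^ w)) := by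
      intro b b' h
      have h' : (a : ℕ) * x + b ≡ a * x + b' [MOD 2 ^ w] := congrArg Fin.val h
      exact Fin.ext (Nat.ModEq.eq_of_lt_of_lt (Nat.ModEq.add_left_cancel' _ h') b.2 b'.2)
    rw [Finset.card_bijective _ (Finite.injective_iff_bijective.1 hinj)
      (t := Finset.univ.filter fun b : Fin (2 ^ w) => (b : ℕ) < c * 2 ^ r)]
    · rw [Fin.card_filter_val_lt, min_eq_right hc]
    · intro b
      simp [mulShift, Nat.div_lt_iff_lt_mul (Nat.two_pow_pos r)]
  rw [← Finset.univ_product_univ, Finset.card_filter, Finset.sum_product]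
  simp_rw [← Finset.card_filter, hfib]
  simp

end DynStream

/-! ### Independence of the seeds, and the recovery of one neighbour. -/

namespace DynStream

open WordRAM MeasureTheory
open scoped ENNReal

/-- The seeds of a sketch: those of the row hash and those of the column hash. -/
abbrev Seed (w : ℕ) : Type := (Fin (2 ^ w) × Fin (2 ^ w)) × (Fin (2 ^ w) × Fin (2 ^ w))

/-- The seeds of sketch `t`. -/
def seedOf {w : ℕ} (ω : ℕ → Fin (2 ^ w)) (t : ℕ) : Seed w :=
  ((ω (4 * t), ω (4 * t + 1)), (ω (4 * t + 2), ω (4 * t + 3)))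

/-- The component of a seed with a given index. -/
def Seed.word {w : ℕ} (q : Seed w) (i : ℕ) : Fin (2 ^ w) :=
  if i = 0 then q.1.1 else if i = 1 then q.1.2 else if i = 2 then q.2.1 else q.2.2

theorem word_seedOf {w : ℕ} (ω : ℕ → Fin (2 ^ w)) (t : ℕ) {i : ℕ} (hi : i < 4) :
    Seed.word (seedOf ω t) i = ω (4 * t + i) := by
  interval_cases i <;> rfl

theorem uniform_singleton {N : ℕ} [NeZero N] (x : Fin N) :
    (PMF.uniformOfFintype (Fin N)).toMeasure {x} = (N : ℝ≥0∞)⁻¹ := by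
  rw [PMF.toMeasure_apply_singleton _ _ (measurableSet_singleton x)]
  simp

/-- The event lies in a cylinder that prescribes the 4|T| distinct coordinates 4t + i with i < 4,
each with probability 2^(-w). -/
theorem coins_seed_eq_le {w : ℕ} (T : Finset ℕ) (f : ∀ t ∈ T, Seed w) :
    coins w {ω | ∀ t (h : t ∈ T), seedOf ω t = f t h} ≤ (((2 ^ w : ℕ) : ℝ≥0∞)⁻¹ ^ 4) ^ T.card := by
  classical
  set J := (T ×ˢ Finset.range 4).image fun p => 4 * p.1 + p.2 with hJ
  have hmemJ : ∀ j ∈ J, j / 4 ∈ T := by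
    intro j hj
    obtain ⟨⟨t, i⟩, hp, rfl⟩ := Finset.mem_image.1 hj
    rw [Finset.mem_product, Finset.mem_range] at hp
    have : (4 * t + i) / 4 = t := by have := hp.2; dsimp only at this; omega
    simpa only [this] using hp.1
  have hcard : J.card = 4 * T.card := by
    rw [hJ, Finset.card_image_of_injOn, Finset.card_product, Finset.card_range, Nat.mul_comm]
    rintro ⟨t, i⟩ hp ⟨t', i'⟩ hp' h
    simp only [Finset.coe_product, Finset.coe_range, Set.mem_prod, Set.mem_Iio] at hp hp'
    dsimp only at h
    have := hp.2
    have := hp'.2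
    rw [Prod.mk.injEq]
    omega
  set S : ℕ → Set (Fin (2 ^ w)) := fun j =>
    if h : j / 4 ∈ T then {Seed.word (f (j / 4) h) (j % 4)} else Set.univ with hS
  have hsub : {ω : ℕ → Fin (2 ^ w) | ∀ t (h : t ∈ T), seedOf ω t = f t h} ⊆ Set.pi J S := by
    intro ω hω j hj
    have hjT := hmemJ j hj
    simp only [hS, dif_pos hjT, Set.mem_singleton_iff]
    rw [← hω _ hjT, word_seedOf _ _ (Nat.mod_lt _ (by omega)), Nat.div_add_mod]
  refine (measure_mono hsub).trans ?_
  unfold coins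
  rw [Measure.infinitePi_pi _ (fun j _ => (Set.toFinite _).measurableSet),
    Finset.prod_congr rfl (g := fun _ => ((2 ^ w : ℕ) : ℝ≥0∞)⁻¹), Finset.prod_const, hcard, pow_mul]
  intro j hj
  simp only [hS, dif_pos (hmemJ j hj)]
  exact uniform_singleton _

theorem coins_seed_mem_le {w : ℕ} (T : Finset ℕ) (F : Finset (Seed w)) :
    coins w {ω | ∀ t ∈ T, seedOf ω t ∈ F} ≤
      (F.card * ((2 ^ w : ℕ) : ℝ≥0∞)⁻¹ ^ 4) ^ T.card := by
  classical
  have hsub : {ω : ℕ → Fin (2 ^ w) | ∀ t ∈ T, seedOf ω t ∈ F} ⊆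
      ⋃ f ∈ T.pi fun _ => F, {ω | ∀ t (h : t ∈ T), seedOf ω t = f t h} := by
    intro ω hω
    simp only [Set.mem_iUnion]
    exact ⟨fun t _ => seedOf ω t, Finset.mem_pi.2 fun t ht => hω t ht, fun _ _ => rfl⟩
  refine (measure_mono hsub).trans ((measure_biUnion_finset_le _ _).trans ?_)
  refine (Finset.sum_le_sum fun f _ => coins_seed_eq_le T f).trans ?_
  rw [Finset.sum_const, Finset.card_pi, Finset.prod_const, mul_pow, nsmul_eq_mul, Nat.cast_pow]

theorem coins_seed_mem_le_of_card {w : ℕ} (T : Finset ℕ) (F : Finset (Seed w))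
    (hF : 100 * (F.card : ℝ) ≤ 99 * (2 ^ w) ^ 4) :
    coins w {ω | ∀ t ∈ T, seedOf ω t ∈ F} ≤ ENNReal.ofReal ((99 / 100) ^ T.card) := by
  refine (coins_seed_mem_le T F).trans ?_
  rw [ENNReal.ofReal_pow (by norm_num)]
  refine pow_le_pow_left' ?_ _
  have hpos : (0 : ℝ) < 2 ^ w := by positivity
  have h1 : (((2 ^ w : ℕ) : ℝ≥0∞)⁻¹ ^ 4) = ENNReal.ofReal (((2 : ℝ) ^ w)⁻¹ ^ 4) := by
    rw [ENNReal.ofReal_pow (by positivity), ENNReal.ofReal_inv_of_pos hpos]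
    congr 2
    rw [ENNReal.ofReal_pow (by norm_num)]
    simp
  rw [h1, ← ENNReal.ofReal_natCast, ← ENNReal.ofReal_mul (by positivity)]
  refine ENNReal.ofReal_le_ofReal ?_
  rw [inv_pow, ← div_eq_mul_inv, div_le_iff₀ (by positivity)]
  linarith

/-- The seeds for which the neighbour `y` of `u` is recovered at level `j`. -/
def RecoveredBy {w : ℕ} (l j : ℕ) (P : Finset (ℕ × ℕ)) (u y : ℕ) (q : Seed w) : Prop :=
  mulShift w q.2.1 q.2.2 (w - l - j) y < 2 ^ l ∧
  ∀ p ∈ P, mulShift w q.1.1 q.1.2 (w - l) p.1 = mulShift w q.1.1 q.1.2 (w - l) u →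
    mulShift w q.2.1 q.2.2 (w - l - j) p.2 = mulShift w q.2.1 q.2.2 (w - l - j) y → p = (u, y)

/-- Recovery in sketch t depends only on the four words of that sketch and on its level, which is
what makes the sketches of one level independent trials. -/
theorem recovered_iff {w l : ℕ} {ω : ℕ → Fin (2 ^ w)} {P : Finset (ℕ × ℕ)} {t u y : ℕ}
    (h : (u, y) ∈ P) :
    Recovered l ω P t u y ↔ RecoveredBy l (t % w) P u y (seedOf ω t) := by
  unfold Recovered RecoveredBy
  refine and_congr Iff.rfl ⟨fun hb p hp h₁ h₂ => ?_, fun hq => ?_⟩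
  · have : p ∈ bucket l ω P t (rowOf l ω t u) (colOf l ω t y) :=
      Finset.mem_filter.2 ⟨hp, h₁, h₂⟩
    rw [hb] at this
    exact Finset.mem_singleton.1 this
  · refine Finset.eq_singleton_iff_unique_mem.2 ⟨Finset.mem_filter.2 ⟨h, rfl, rfl⟩, fun p hp => ?_⟩
    obtain ⟨hp, h₁, h₂⟩ := Finset.mem_filter.1 hp
    exact hq p hp h₁ h₂

/-- Arithmetic of the union bound with N = 2^w, B = 2^l, J = 2^j, R = 2^r. Of the seeds that sample
y, at most a fraction 6/256 + 2/256 + 1/8 < 1/4 is lost to collisions. -/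
theorem recovery_estimate {N B J R rec f₁ f₂ k d : ℝ} (hR : 0 ≤ R) (hJ : 1 ≤ J) (hB : 0 ≤ B)
    (hN : N = R * J * B) (hk : 256 * k ≤ B) (hd : 8 * d ≤ J * B) (hf₁ : f₁ ≤ 6 * k)
    (hf₂ : f₂ ≤ 2 * k + d)
    (h : N ^ 2 * (N * (B * R)) ≤ rec + f₁ * ((R * J * (B * (R * J))) * (N * (B * R))) +
      f₂ * (N ^ 2 * (R * (B * R)))) : 3 * N ^ 4 ≤ 4 * J * rec := by
  set K := N ^ 2 * (B * R) with hK
  have hK0 : 0 ≤ K := by positivity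
  have hRJ : 0 ≤ R * J := by positivity
  have e₁ : R * J * (B * (R * J)) * (N * (B * R)) = R * J * K := by rw [hK, hN]; ring
  have e₂ : N ^ 2 * (R * (B * R)) = R * K := by rw [hK]; ring
  have e₃ : N ^ 2 * (N * (B * R)) = N * K := by rw [hK]; ring
  have e₄ : N ^ 4 = N * K * J := by rw [hK, hN]; ring
  rw [e₁, e₂, e₃] at h
  have b₁ : f₁ * (R * J) ≤ 6 / 256 * N := by
    rw [hN]; nlinarith [mul_le_mul_of_nonneg_right (show f₁ ≤ 6 / 256 * B by linarith) hRJ]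
  have b₂ : f₂ * R ≤ (2 / 256 + 1 / 8) * N := by
    have hBJ : B ≤ J * B := by nlinarith
    rw [hN]
    nlinarith [mul_le_mul_of_nonneg_right
      (show f₂ ≤ (2 / 256 + 1 / 8) * (J * B) by linarith) hR]
  have b₃ : f₁ * (R * J * K) ≤ 6 / 256 * N * K := by nlinarith [mul_le_mul_of_nonneg_right b₁ hK0]
  have b₄ : f₂ * (R * K) ≤ (2 / 256 + 1 / 8) * N * K := by
    nlinarith [mul_le_mul_of_nonneg_right b₂ hK0]
  have b₅ : 3 / 4 * (N * K) ≤ rec := by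
    have : 0 ≤ N * K := mul_nonneg (by rw [hN]; positivity) hK0
    linarith
  rw [e₄]
  nlinarith

open Classical in
-- Let (x, z) ≠ (u, y) share the cell of (u, y). If x = u then z ∈ N(u), if z = y then x ∈ N(y), and
-- otherwise x or z lies in the cover. So x ≠ u collides from X ∪ N(y), or z ≠ y from X ∪ N(u). A
-- union bound over these few vertices suffices, although the cell competes with all edges of the
-- graph.
theorem card_recoveredBy_ge {w l j n k : ℕ} {P : Finset (ℕ × ℕ)} {X : Finset ℕ} {u y : ℕ}
    (hsub : P ⊆ Finset.range n ×ˢ Finset.range n) (hsymm : ∀ x y, (x, y) ∈ P → (y, x) ∈ P)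
    (hX : X.card ≤ 2 * k) (hcov : ∀ x y, (x, y) ∈ P → x ∈ X ∨ y ∈ X)
    (hlj : l + j ≤ w) (hn : n ≤ 2 ^ (w - l - j)) (hk : 256 * k ≤ 2 ^ l) (huy : (u, y) ∈ P)
    (hdy : (nbrs P y).card ≤ 4 * k) (hdu : 8 * (nbrs P u).card ≤ 2 ^ j * 2 ^ l) :
    3 * ((2 : ℝ) ^ w) ^ 4 ≤
      4 * 2 ^ j * ((Finset.univ.filter fun q : Seed w => RecoveredBy l j P u y q).card : ℝ) := by
  set r := w - l - j with hr
  have hr0 : w - l = r + j := by omega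
  have hw : w = r + j + l := by omega
  have hn0 : n ≤ 2 ^ (w - l) := hn.trans (Nat.pow_le_pow_right (by omega) (by omega))
  have hlt : ∀ x z, (x, z) ∈ P → x < n ∧ z < n := fun x z h => by simpa using hsub h
  set Rec := Finset.univ.filter fun q : Seed w => RecoveredBy l j P u y q with hRec
  set Samp := Finset.univ.filter fun q : Fin (2 ^ w) × Fin (2 ^ w) =>
    mulShift w q.1 q.2 r y < 2 ^ l with hSamp
  set C₁ : ℕ → Finset (Fin (2 ^ w) × Fin (2 ^ w)) := fun x => Finset.univ.filter fun q =>
    mulShift w q.1 q.2 (w - l) x = mulShift w q.1 q.2 (w - l) u ∧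
      mulShift w q.1 q.2 (w - l) u < 2 ^ l with hC₁
  set C₂ : ℕ → Finset (Fin (2 ^ w) × Fin (2 ^ w)) := fun z => Finset.univ.filter fun q =>
    mulShift w q.1 q.2 r z = mulShift w q.1 q.2 r y ∧ mulShift w q.1 q.2 r y < 2 ^ l with hC₂
  -- Cutting off at n keeps the vertices below 2^r, as the collision bound demands.
  set F₁ := ((X ∪ nbrs P y).filter (· < n)).erase u with hF₁
  set F₂ := ((X ∪ nbrs P u).filter (· < n)).erase y with hF₂
  have hrow : ∀ (q : Fin (2 ^ w) × Fin (2 ^ w)) x, mulShift w q.1 q.2 (w - l) x < 2 ^ l := by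
    intro q x
    unfold mulShift
    rw [Nat.div_lt_iff_lt_mul (Nat.two_pow_pos _), ← pow_add,
      show l + (w - l) = w by omega]
    exact Nat.mod_lt _ (Nat.two_pow_pos w)
  have hcover : Finset.univ ×ˢ Samp ⊆
      Rec ∪ F₁.biUnion (fun x => C₁ x ×ˢ Samp) ∪ F₂.biUnion (fun z => Finset.univ ×ˢ C₂ z) := by
    rintro ⟨q₁, q₂⟩ hq
    have hq₂ : q₂ ∈ Samp := (Finset.mem_product.1 hq).2
    have hs : mulShift w q₂.1 q₂.2 r y < 2 ^ l := (Finset.mem_filter.1 hq₂).2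
    by_contra hcon
    simp only [Finset.mem_union, Finset.mem_biUnion, not_or, not_exists, not_and] at hcon
    obtain ⟨⟨h₀, h₁⟩, h₂⟩ := hcon
    refine h₀ (Finset.mem_filter.2 ⟨Finset.mem_univ _, hs, ?_⟩)
    rintro ⟨x, z⟩ hp hx hz
    obtain ⟨hxn, hzn⟩ := hlt x z hp
    have hx' : x ≠ u → x ∉ X ∪ nbrs P y := fun hne hmem =>
      h₁ x (Finset.mem_erase.2 ⟨hne, Finset.mem_filter.2 ⟨hmem, hxn⟩⟩)
        (Finset.mem_product.2 ⟨Finset.mem_filter.2 ⟨Finset.mem_univ _, hx, hrow _ _⟩, hq₂⟩)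
    have hz' : z ≠ y → z ∉ X ∪ nbrs P u := fun hne hmem =>
      h₂ z (Finset.mem_erase.2 ⟨hne, Finset.mem_filter.2 ⟨hmem, hzn⟩⟩)
        (Finset.mem_product.2 ⟨Finset.mem_univ _,
          Finset.mem_filter.2 ⟨Finset.mem_univ _, hz, hs⟩⟩)
    rw [Prod.mk.injEq]
    by_cases hxu : x = u
    · subst hxu
      refine ⟨rfl, ?_⟩
      by_contra hne
      exact hz' hne (Finset.mem_union_right _ (mem_nbrs.2 hp))
    · exfalso
      have hx'' := hx' hxu
      rw [Finset.mem_union, not_or] at hx''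
      have hzX := (hcov x z hp).resolve_left hx''.1
      by_cases hzy : z = y
      · subst hzy
        exact hx''.2 (mem_nbrs.2 (hsymm _ _ hp))
      · exact hz' hzy (Finset.mem_union_left _ hzX)
  have hcardF₁ : F₁.card ≤ 6 * k := by
    exact Finset.card_erase_le.trans ((Finset.card_filter_le _ _).trans
      ((Finset.card_union_le _ _).trans (by omega)))
  have hcardF₂ : F₂.card ≤ 2 * k + (nbrs P u).card := by
    exact Finset.card_erase_le.trans ((Finset.card_filter_le _ _).trans
      ((Finset.card_union_le _ _).trans (by omega)))
  have hSampCard : Samp.card = 2 ^ w * (2 ^ l * 2 ^ r) :=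
    card_mulShift_lt (by rw [← pow_add]; exact Nat.pow_le_pow_right (by omega) (by omega)) y
  obtain ⟨hun, hyn⟩ := hlt u y huy
  have hC₁card : ∀ x ∈ F₁, (C₁ x ×ˢ Samp).card ≤
      2 ^ (w - l) * (2 ^ l * 2 ^ (w - l)) * (2 ^ w * (2 ^ l * 2 ^ r)) := by
    intro x hx
    rw [hF₁, Finset.mem_erase, Finset.mem_filter] at hx
    rw [Finset.card_product, hSampCard]
    exact Nat.mul_le_mul_right _ (card_mulShift_collision_le (by omega) (hx.2.2.trans_le hn0)
      (hun.trans_le hn0) hx.1 _)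
  have hC₂card : ∀ z ∈ F₂, ((Finset.univ : Finset (Fin (2 ^ w) × Fin (2 ^ w))) ×ˢ C₂ z).card ≤
      2 ^ w * 2 ^ w * (2 ^ r * (2 ^ l * 2 ^ r)) := by
    intro z hz
    rw [hF₂, Finset.mem_erase, Finset.mem_filter] at hz
    rw [Finset.card_product, Finset.card_univ, Fintype.card_prod, Fintype.card_fin]
    exact Nat.mul_le_mul_left _ (card_mulShift_collision_le (by omega) (hz.2.2.trans_le hn)
      (hyn.trans_le hn) hz.1 _)
  have hmain : 2 ^ w * 2 ^ w * (2 ^ w * (2 ^ l * 2 ^ r)) ≤ Rec.card +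
      F₁.card * (2 ^ (w - l) * (2 ^ l * 2 ^ (w - l)) * (2 ^ w * (2 ^ l * 2 ^ r))) +
      F₂.card * (2 ^ w * 2 ^ w * (2 ^ r * (2 ^ l * 2 ^ r))) := by
    have h₁ := Finset.card_le_card hcover
    rw [Finset.card_product, Finset.card_univ, Fintype.card_prod, Fintype.card_fin, hSampCard] at h₁
    refine h₁.trans ((Finset.card_union_le _ _).trans (Nat.add_le_add
      ((Finset.card_union_le _ _).trans (Nat.add_le_add_left ?_ _)) ?_))
    · exact Finset.card_biUnion_le_card_mul _ _ _ hC₁card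
    · exact Finset.card_biUnion_le_card_mul _ _ _ hC₂card
  have hmainR : ((2 : ℝ) ^ w) * 2 ^ w * (2 ^ w * (2 ^ l * 2 ^ r)) ≤ Rec.card +
      F₁.card * (2 ^ (w - l) * (2 ^ l * 2 ^ (w - l)) * (2 ^ w * (2 ^ l * 2 ^ r))) +
      F₂.card * (2 ^ w * 2 ^ w * (2 ^ r * (2 ^ l * 2 ^ r))) := by exact_mod_cast hmain
  refine recovery_estimate (B := 2 ^ l) (J := 2 ^ j) (R := 2 ^ r) (k := k)
    (d := (nbrs P u).card) (f₁ := F₁.card) (f₂ := F₂.card) (by positivity)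
    (one_le_pow₀ (by norm_num)) (by positivity) (by rw [← pow_add, ← pow_add, ← hw])
    (by exact_mod_cast hk) (by exact_mod_cast hdu) (by exact_mod_cast hcardF₁)
    (by exact_mod_cast hcardF₂) ?_
  rw [sq, ← pow_add 2 r j, ← hr0]
  exact hmainR

end DynStream

/-! ### From one sketch to all sketches of a level. -/

namespace DynStream

open WordRAM MeasureTheory
open scoped ENNReal

/-- The sketches of level `j`. -/
def levelReps (w j : ℕ) : Finset ℕ := (Finset.range w).image fun i => i * w + j

theorem card_levelReps {w : ℕ} (hw : 0 < w) (j : ℕ) : (levelReps w j).card = w := by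
  unfold levelReps
  rw [Finset.card_image_of_injective, Finset.card_range]
  intro i i' h
  exact Nat.eq_of_mul_eq_mul_right hw (Nat.add_right_cancel h)

theorem mem_levelReps {w j t : ℕ} (hj : j < w) (ht : t ∈ levelReps w j) :
    t < w * w ∧ t % w = j := by
  obtain ⟨i, hi, rfl⟩ := Finset.mem_image.1 ht
  rw [Finset.mem_range] at hi
  refine ⟨?_, ?_⟩
  · calc i * w + j < (i + 1) * w := by rw [Nat.add_one_mul]; omega
      _ ≤ w * w := Nat.mul_le_mul_right _ hi
  · rw [Nat.add_comm, Nat.add_mul_mod_self_right, Nat.mod_eq_of_lt hj]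

open Classical in
-- At level 0 every vertex is sampled and failure has probability at most 1/4; the weaker 99/100
-- matches the bound available at the other levels.
theorem card_not_recoveredBy_le {w l n k : ℕ} {P : Finset (ℕ × ℕ)} {u y : ℕ}
    (hP : CoveredGraph n k P) (hl : l ≤ w) (hn : n ≤ 2 ^ (w - l)) (hk : 256 * k ≤ 2 ^ l)
    (huy : (u, y) ∈ P) (hdy : (nbrs P y).card ≤ 4 * k) (hdu : 8 * (nbrs P u).card ≤ 2 ^ l) :
    100 * ((Finset.univ.filter fun q : Seed w => ¬ RecoveredBy l 0 P u y q).card : ℝ) ≤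
      99 * (2 ^ w) ^ 4 := by
  obtain ⟨X, hX, hcov⟩ := hP.cover
  have h := card_recoveredBy_ge (w := w) (j := 0) hP.subset hP.symm hX hcov (by omega) (by simpa) hk
    huy hdy (by simpa)
  have h' := Finset.card_filter_add_card_filter_not (s := (Finset.univ : Finset (Seed w)))
    (fun q => RecoveredBy l 0 P u y q)
  have hc : ((Finset.univ : Finset (Seed w)).card : ℝ) = (2 ^ w) ^ 4 := by
    rw [Finset.card_univ, Fintype.card_prod, Fintype.card_prod, Fintype.card_fin]
    push_cast; ring
  have h'' := congrArg (Nat.cast (R := ℝ)) h'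
  rw [hc, Nat.cast_add] at h''
  have : (0 : ℝ) ≤ (2 ^ w) ^ 4 := by positivity
  simp only [pow_zero, mul_one] at h
  linarith

/-- Recovered neighbours of u lie in the same row, hence in distinct ones of the 2^l columns. -/
theorem card_recoveredBy_le {w l j : ℕ} {P : Finset (ℕ × ℕ)} {u : ℕ} (q : Seed w) (Y : Finset ℕ)
    (hY : ∀ y ∈ Y, (u, y) ∈ P ∧ RecoveredBy l j P u y q) : Y.card ≤ 2 ^ l := by
  have := Finset.card_le_card_of_injOn (s := Y) (t := Finset.range (2 ^ l))
    (fun y => mulShift w q.2.1 q.2.2 (w - l - j) y) (fun y hy => ?_) ?_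
  · simpa using this
  · simpa using (hY y hy).2.1
  · intro y hy y' hy' h
    have := (hY y hy).2.2 (u, y') (hY y' hy').1 rfl h.symm
    rw [Prod.mk.injEq] at this
    exact this.2.symm

open Classical in
-- Markov's inequality in reverse for the number Z of recovered neighbours: Z is at most 512k and
-- its mean is at least 14k · 3/4 = 10.5k, so Z > 4k has probability at least 6.5/512 > 1/100. Only
-- first moments are needed.
theorem card_few_recoveredBy_le {w l j n k : ℕ} {P : Finset (ℕ × ℕ)} {u : ℕ}
    (hP : CoveredGraph n k P) (hlj : l + j ≤ w) (hn : n ≤ 2 ^ (w - l - j)) (hk1 : 1 ≤ k)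
    (hk : 256 * k ≤ 2 ^ l) (hk' : 2 ^ l ≤ 512 * k) (hdu : 8 * (nbrs P u).card ≤ 2 ^ j * 2 ^ l)
    (hdu' : 2 ^ j * 2 ^ l < 16 * (nbrs P u).card) :
    100 * ((Finset.univ.filter fun q : Seed w =>
      ((nbrs P u).filter fun y => RecoveredBy l j P u y q).card ≤ 4 * k).card : ℝ) ≤
      99 * (2 ^ w) ^ 4 := by
  obtain ⟨X, hX, hcov⟩ := hP.cover
  set Z : Seed w → ℕ := fun q => ((nbrs P u).filter fun y => RecoveredBy l j P u y q).card with hZ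
  set Few := Finset.univ.filter fun q : Seed w => Z q ≤ 4 * k with hFew
  have hc : ((Finset.univ : Finset (Seed w)).card : ℝ) = (2 ^ w) ^ 4 := by
    rw [Finset.card_univ, Fintype.card_prod, Fintype.card_prod, Fintype.card_fin]
    push_cast; ring
  have hcompl := Finset.card_filter_add_card_filter_not (s := (Finset.univ : Finset (Seed w)))
    (fun q => Z q ≤ 4 * k)
  have hcompl' := congrArg (Nat.cast (R := ℝ)) hcompl
  rw [hc, Nat.cast_add] at hcompl'
  set Many := Finset.univ.filter fun q : Seed w => ¬ Z q ≤ 4 * k with hMany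
  have hZB : ∀ q, Z q ≤ 2 ^ l := fun q => card_recoveredBy_le q _ fun y hy => by
    rw [Finset.mem_filter, mem_nbrs] at hy; exact hy
  have hupper : (∑ q, Z q : ℝ) ≤ 4 * k * (2 ^ w) ^ 4 + 2 ^ l * Many.card := by
    have hq : ∀ q ∈ (Finset.univ : Finset (Seed w)),
        (Z q : ℝ) ≤ 4 * k + if ¬ Z q ≤ 4 * k then 2 ^ l else 0 := by
      intro q _
      split_ifs with h
      · have : (Z q : ℝ) ≤ 4 * k := by exact_mod_cast h
        linarith
      · have : (Z q : ℝ) ≤ 2 ^ l := by exact_mod_cast hZB q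
        have : (0 : ℝ) ≤ k := by positivity
        linarith
    refine (Finset.sum_le_sum hq).trans ?_
    rw [Finset.sum_add_distrib, Finset.sum_const, nsmul_eq_mul, hc, ← Finset.sum_filter,
      Finset.sum_const, nsmul_eq_mul]
    linarith
  have hswap : (∑ q, Z q : ℝ) = ∑ y ∈ nbrs P u,
      ((Finset.univ.filter fun q : Seed w => RecoveredBy l j P u y q).card : ℝ) := by
    have : ∑ q, Z q = ∑ y ∈ nbrs P u,
        (Finset.univ.filter fun q : Seed w => RecoveredBy l j P u y q).card := by
      simp only [hZ, Finset.card_filter]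
      exact Finset.sum_comm
    exact_mod_cast this
  set J : ℝ := 2 ^ j with hJ
  have hJ1 : 1 ≤ J := one_le_pow₀ (by norm_num)
  set N4 : ℝ := ((2 : ℝ) ^ w) ^ 4 with hN4
  have hN0 : 0 ≤ N4 := by positivity
  -- A neighbour outside the cover has all its own neighbours in the cover, so it is light.
  -- Discarding X costs at most 2k neighbours.
  have hterm : ∀ y ∈ nbrs P u \ X, 3 / 4 * N4 / J ≤
      ((Finset.univ.filter fun q : Seed w => RecoveredBy l j P u y q).card : ℝ) := by
    intro y hy
    rw [Finset.mem_sdiff, mem_nbrs] at hy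
    have hdy : (nbrs P y).card ≤ 4 * k := by
      have : nbrs P y ⊆ X := fun x hx => (hcov y x (mem_nbrs.1 hx)).resolve_left hy.2
      have := Finset.card_le_card this
      omega
    have := card_recoveredBy_ge (w := w) (j := j) hP.subset hP.symm hX hcov hlj hn hk hy.1 hdy hdu
    rw [div_le_iff₀ (by linarith)]
    linarith
  have hlower : ((nbrs P u).card - 2 * k : ℝ) * (3 / 4 * N4 / J) ≤ ∑ q, (Z q : ℝ) := by
    rw [hswap]
    have h₁ : ((nbrs P u).card - 2 * k : ℝ) ≤ (nbrs P u \ X).card := by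
      have := Finset.le_card_sdiff X (nbrs P u)
      have : (nbrs P u).card ≤ (nbrs P u \ X).card + 2 * k := by omega
      have : ((nbrs P u).card : ℝ) ≤ (nbrs P u \ X).card + 2 * k := by exact_mod_cast this
      linarith
    calc ((nbrs P u).card - 2 * k : ℝ) * (3 / 4 * N4 / J)
        ≤ (nbrs P u \ X).card * (3 / 4 * N4 / J) :=
          mul_le_mul_of_nonneg_right h₁ (by positivity)
      _ ≤ ∑ y ∈ nbrs P u \ X,
          ((Finset.univ.filter fun q : Seed w => RecoveredBy l j P u y q).card : ℝ) := by
          rw [← nsmul_eq_mul]; exact Finset.card_nsmul_le_sum _ _ _ hterm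
      _ ≤ _ := Finset.sum_le_sum_of_subset_of_nonneg Finset.sdiff_subset
          fun _ _ _ => Nat.cast_nonneg _
  have hdu'' : J * (256 * k) ≤ 16 * (nbrs P u).card := by
    have h₁ : 2 ^ j * (256 * k) ≤ 16 * (nbrs P u).card :=
      (Nat.mul_le_mul_left _ hk).trans hdu'.le
    rw [hJ]; exact_mod_cast h₁
  have hkR : (1 : ℝ) ≤ k := by exact_mod_cast hk1
  -- From deg u ≥ 16kJ and J ≥ 1.
  have hd14 : 14 * k * J ≤ ((nbrs P u).card - 2 * k : ℝ) := by nlinarith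
  have h14 : 14 * k * (3 / 4 * N4) ≤ ∑ q, (Z q : ℝ) := by
    refine le_trans ?_ hlower
    calc 14 * k * (3 / 4 * N4) = 14 * k * J * (3 / 4 * N4 / J) := by
          field_simp
      _ ≤ _ := mul_le_mul_of_nonneg_right hd14 (by positivity)
  have hBR : (2 : ℝ) ^ l ≤ 512 * k := by exact_mod_cast hk'
  have hM0 : (0 : ℝ) ≤ Many.card := Nat.cast_nonneg _
  have h₁ : 6.5 * k * N4 ≤ 512 * k * Many.card := by
    have := mul_le_mul_of_nonneg_right hBR hM0
    linarith
  have h₂ : 6.5 * N4 ≤ 512 * Many.card := by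
    have hk0 : (0 : ℝ) < k := by linarith
    refine le_of_mul_le_mul_left ?_ hk0
    linarith
  linarith

/-- For small degree, level 0 with a union bound over the neighbours, which is where the factor n
comes from. For large degree, a single event at the level matching the degree; there the factor n is
only slack. -/
theorem coins_not_informative_le {w l n k : ℕ} (hS : Sizes w l k n) {P : Finset (ℕ × ℕ)}
    (hP : CoveredGraph n k P) (u : ℕ) :
    coins w {ω | ¬ Informative l k ω P u} ≤ n * ENNReal.ofReal ((99 / 100) ^ w) := by
  classical
  have hw := hS.word_pos
  have hcube := hS.cube
  have hnn := hS.n_le_cube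
  have hn1 := hS.one_le_n
  have hsq : n * n ≤ n * n * n := Nat.le_mul_of_pos_right _ hn1
  have hdn : (nbrs P u).card ≤ n := by
    have : nbrs P u ⊆ Finset.range n := fun y hy => by
      have := hP.subset (mem_nbrs.1 hy)
      rw [Finset.mem_product] at this
      exact this.2
    simpa using Finset.card_le_card this
  have hpow : ∀ i ≤ w, n * 2 ^ i ≤ 2 ^ w → n ≤ 2 ^ (w - i) := fun i hi h => by
    have h₁ : 2 ^ w = 2 ^ (w - i) * 2 ^ i := by rw [← pow_add]; congr 1; omega
    rw [h₁] at h
    exact Nat.le_of_mul_le_mul_right h (Nat.two_pow_pos i)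
  by_cases hlight : 8 * (nbrs P u).card ≤ 2 ^ l
  · have hnl : n ≤ 2 ^ (w - l) := by
      refine hpow l hS.le_word ?_
      rcases le_total n (2 ^ l) with h | h
      · have h₁ : n * 2 ^ l ≤ 2 ^ l * 2 ^ l := Nat.mul_le_mul_right _ h
        have h₂ : 2 ^ l * 2 ^ l ≤ w * w * (2 ^ l * 2 ^ l) :=
          Nat.le_mul_of_pos_left _ (Nat.mul_pos hw hw)
        have := hS.space
        omega
      · have h₁ : n * 2 ^ l ≤ n * n := Nat.mul_le_mul_left _ h
        omega
    have hsub : {ω : ℕ → Fin (2 ^ w) | ¬ Informative l k ω P u} ⊆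
        ⋃ y ∈ (nbrs P u).filter fun y => (nbrs P y).card ≤ 4 * k,
          {ω | ∀ t ∈ levelReps w 0, seedOf ω t ∈
            Finset.univ.filter fun q : Seed w => ¬ RecoveredBy l 0 P u y q} := by
      intro ω hω
      have h₁ : ¬ ∀ y ∈ nbrs P u, (nbrs P y).card ≤ 4 * k → ∃ t < w * w, Recovered l ω P t u y :=
        fun h => hω (.inl h)
      push Not at h₁
      obtain ⟨y, hy, hdy, hrec⟩ := h₁
      simp only [Set.mem_iUnion]
      refine ⟨y, Finset.mem_filter.2 ⟨hy, hdy⟩, fun t ht => ?_⟩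
      obtain ⟨htw, ht0⟩ := mem_levelReps hw ht
      refine Finset.mem_filter.2 ⟨Finset.mem_univ _, fun hr => hrec t htw ?_⟩
      rw [recovered_iff (mem_nbrs.1 hy), ht0]
      exact hr
    refine (measure_mono hsub).trans ((measure_biUnion_finset_le _ _).trans ?_)
    refine (Finset.sum_le_card_nsmul _ _ (ENNReal.ofReal ((99 / 100) ^ w)) fun y hy => ?_).trans ?_
    · rw [Finset.mem_filter] at hy
      have := coins_seed_mem_le_of_card (levelReps w 0) _ (card_not_recoveredBy_le (w := w) hP
        hS.le_word hnl hS.le_width (mem_nbrs.1 hy.1) hy.2 hlight)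
      rwa [card_levelReps hw] at this
    · rw [nsmul_eq_mul]
      gcongr
      exact (Finset.card_filter_le _ _).trans hdn
  · push Not at hlight
    have hex : ∃ j, 8 * (nbrs P u).card ≤ 2 ^ j * 2 ^ l :=
      ⟨8 * (nbrs P u).card, Nat.lt_two_pow_self.le.trans
        (Nat.le_mul_of_pos_right _ (Nat.two_pow_pos l))⟩
    -- The least j with 8 deg u ≤ 2^(l+j): at the previous level the inequality fails, which bounds
    -- 2^(l+j) by 16 deg u.
    obtain ⟨j, hj, hmin⟩ : ∃ j, 8 * (nbrs P u).card ≤ 2 ^ j * 2 ^ l ∧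
        2 ^ j * 2 ^ l < 16 * (nbrs P u).card := by
      refine ⟨Nat.find hex, Nat.find_spec hex, ?_⟩
      rcases h : Nat.find hex with _ | i
      · rw [pow_zero, Nat.one_mul]; omega
      · have := Nat.find_min hex (m := i) (by omega)
        rw [pow_succ, Nat.mul_right_comm]
        omega
    have h2lj : 2 ^ (l + j) ≤ 16 * n := by rw [pow_add, Nat.mul_comm]; omega
    have hnlj : n * 2 ^ (l + j) ≤ 2 ^ w := by
      have h₁ : n * 2 ^ (l + j) ≤ n * (16 * n) := Nat.mul_le_mul_left _ h2lj
      have h₂ : n * (16 * n) = 16 * (n * n) := by ring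
      omega
    have hlj : l + j ≤ w := by
      have h₁ : 2 ^ (l + j) ≤ 2 ^ w := (Nat.le_mul_of_pos_left _ hn1).trans hnlj
      exact (Nat.pow_le_pow_iff_right (by omega)).1 h₁
    -- Together with l + j ≤ w this gives j < w, so that the level j really occurs among the
    -- residues modulo w.
    have hl0 : 0 < l := by
      rcases Nat.eq_zero_or_pos l with h | h
      · have := hS.le_width
        have := hS.one_le_k
        rw [h] at *
        omega
      · exact h
    have hnr := hpow (l + j) hlj hnlj
    rw [← Nat.sub_sub] at hnr
    have hsub : {ω : ℕ → Fin (2 ^ w) | ¬ Informative l k ω P u} ⊆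
        {ω | ∀ t ∈ levelReps w j, seedOf ω t ∈ Finset.univ.filter fun q : Seed w =>
          ((nbrs P u).filter fun y => RecoveredBy l j P u y q).card ≤ 4 * k} := by
      intro ω hω t ht
      obtain ⟨htw, htj⟩ := mem_levelReps (by omega) ht
      refine Finset.mem_filter.2 ⟨Finset.mem_univ _, ?_⟩
      by_contra hcon
      refine hω (.inr ⟨t, htw, ?_⟩)
      rw [not_le] at hcon
      refine hcon.trans_le (Finset.card_le_card fun y hy => ?_)
      rw [Finset.mem_filter] at hy ⊢
      refine ⟨hy.1, ?_⟩
      rw [recovered_iff (mem_nbrs.1 hy.1), htj]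
      exact hy.2
    refine (measure_mono hsub).trans ?_
    have := coins_seed_mem_le_of_card (levelReps w j) _ (card_few_recoveredBy_le (w := w) hP hlj hnr
      hS.one_le_k hS.le_width hS.width_le hj hmin)
    rw [card_levelReps hw] at this
    refine this.trans ?_
    have h1 : (1 : ℝ≥0∞) ≤ n := by exact_mod_cast hn1
    exact le_mul_of_one_le_left' h1

end DynStream

/-! ## Streams -/

namespace DynStream

open WordRAM MeasureTheory
open scoped ENNReal

/-- The ordered pairs of adjacent vertices. -/
def pairs {n : ℕ} (E : Finset (Sym2 (Fin n))) : Finset (ℕ × ℕ) :=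
  (Finset.univ.filter fun p : Fin n × Fin n => s(p.1, p.2) ∈ E).image
    fun p => ((p.1 : ℕ), (p.2 : ℕ))

theorem mem_pairs {n : ℕ} {E : Finset (Sym2 (Fin n))} {p : ℕ × ℕ} :
    p ∈ pairs E ↔ ∃ x y : Fin n, s(x, y) ∈ E ∧ p = ((x : ℕ), (y : ℕ)) := by
  unfold pairs
  simp only [Finset.mem_image, Finset.mem_filter, Finset.mem_univ, true_and, Prod.exists]
  constructor <;> rintro ⟨x, y, h, rfl⟩ <;> exact ⟨x, y, h, rfl⟩

theorem coe_mem_pairs {n : ℕ} {E : Finset (Sym2 (Fin n))} {x y : Fin n} :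
    ((x : ℕ), (y : ℕ)) ∈ pairs E ↔ s(x, y) ∈ E := by
  rw [mem_pairs]
  constructor
  · rintro ⟨x', y', h, he⟩
    rw [Prod.mk.injEq] at he
    rwa [Fin.ext he.1, Fin.ext he.2]
  · intro h; exact ⟨x, y, h, rfl⟩

/-- The cover consists of the endpoints of the promised maximal matching: an edge avoiding all of
them could be added to it. -/
theorem coveredGraph_pairs {n k : ℕ} {E M : Finset (Sym2 (Fin n))} (hloop : ∀ x, s(x, x) ∉ E)
    (hM : IsMaximalMatching E M) (hk : M.card ≤ k) : CoveredGraph n k (pairs E) := by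
  classical
  refine ⟨fun p hp => ?_, fun x y h => ?_, fun x h => ?_,
    M.biUnion fun e => e.toFinset.image Fin.val, ?_, fun x y h => ?_⟩
  · obtain ⟨x, y, -, rfl⟩ := mem_pairs.1 hp
    simp
  · obtain ⟨x', y', h', he⟩ := mem_pairs.1 h
    rw [Prod.mk.injEq] at he
    rw [he.1, he.2, coe_mem_pairs, Sym2.eq_swap]
    exact h'
  · obtain ⟨x', y', h', he⟩ := mem_pairs.1 h
    rw [Prod.mk.injEq] at he
    have : x' = y' := Fin.ext (he.1.symm.trans he.2)
    exact hloop x' (by rwa [← this] at h')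
  · refine (Finset.card_biUnion_le_card_mul M _ 2 fun e _ => ?_).trans (by omega)
    refine Finset.card_image_le.trans ?_
    rw [Sym2.card_toFinset]
    split_ifs <;> omega
  · obtain ⟨x', y', h', he⟩ := mem_pairs.1 h
    rw [Prod.mk.injEq] at he
    obtain ⟨rfl, rfl⟩ := he
    by_contra hcon
    simp only [Finset.mem_biUnion, Finset.mem_image, Sym2.mem_toFinset, not_or, not_exists,
      not_and] at hcon
    have hx : ∀ e ∈ M, x' ∉ e := fun e he hx => hcon.1 e he x' hx rfl
    have hy : ∀ e ∈ M, y' ∉ e := fun e he hy => hcon.2 e he y' hy rfl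
    have hmatch : IsMatching E (insert s(x', y') M) := by
      refine ⟨Finset.insert_subset h' hM.prop.1, fun e he f hf v hve hvf => ?_⟩
      rw [Finset.mem_insert] at he hf
      rcases he with rfl | he <;> rcases hf with rfl | hf
      · rfl
      · rcases Sym2.mem_iff.1 hve with rfl | rfl
        · exact absurd hvf (hx f hf)
        · exact absurd hvf (hy f hf)
      · rcases Sym2.mem_iff.1 hvf with rfl | rfl
        · exact absurd hve (hx e he)
        · exact absurd hve (hy e he)
      · exact hM.prop.2 e he f hf v hve hvf
    have := hM.le_of_ge hmatch (Finset.subset_insert _ _) (Finset.mem_insert_self _ _)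
    exact hx _ this (Sym2.mem_mk_left _ _)

/-- Code of the kind of an update. -/
def Update.op {n : ℕ} : Update n → ℕ
  | .insert _ _ => 0
  | .delete _ _ => 1

/-- First end point of an update. -/
def Update.left {n : ℕ} : Update n → Fin n
  | .insert u _ => u
  | .delete u _ => u

/-- Second end point of an update. -/
def Update.right {n : ℕ} : Update n → Fin n
  | .insert _ v => v
  | .delete _ v => v

theorem Update.args_eq {n : ℕ} (a : Update n) : a.args = [a.op, (a.left : ℕ), (a.right : ℕ)] := by
  cases a <;> rfl

theorem Update.op_le {n : ℕ} (a : Update n) : a.op ≤ 1 := by cases a <;> simp [Update.op]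

theorem Update.left_ne_right {n : ℕ} {a : Update n} {E : Finset (Sym2 (Fin n))}
    (h : a.Admissible E) (hloop : ∀ x, s(x, x) ∉ E) : a.left ≠ a.right := by
  cases a with
  | insert u v => exact h.1
  | delete u v =>
    rintro (rfl : u = v)
    exact hloop _ h

theorem Update.apply_loopless {n : ℕ} {a : Update n} {E : Finset (Sym2 (Fin n))}
    (h : a.Admissible E) (hloop : ∀ x, s(x, x) ∉ E) : ∀ x, s(x, x) ∉ a.apply E := by
  intro x hx
  cases a with
  | insert u v =>
    rcases Finset.mem_insert.1 hx with hx | hx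
    · rw [Sym2.eq_iff] at hx
      exact h.1 (by rcases hx with ⟨rfl, rfl⟩ | ⟨rfl, rfl⟩ <;> rfl)
    · exact hloop x hx
  | delete u v => exact hloop x (Finset.mem_of_mem_erase hx)

theorem Update.edgeStep {n : ℕ} {a : Update n} {E : Finset (Sym2 (Fin n))}
    (h : a.Admissible E) : EdgeStep a.op a.left a.right (pairs E) (pairs (a.apply E)) := by
  have hpair : ∀ x y u v : Fin n, s(x, y) = s(u, v) ↔
      (((x : ℕ), (y : ℕ)) = ((v : ℕ), (u : ℕ)) ∨ ((x : ℕ), (y : ℕ)) = ((u : ℕ), (v : ℕ))) := by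
    intro x y u v
    rw [Sym2.eq_iff, Prod.mk.injEq, Prod.mk.injEq, Fin.ext_iff, Fin.ext_iff, Fin.ext_iff,
      Fin.ext_iff]
    tauto
  cases a with
  | insert u v =>
    refine .inl ⟨rfl, fun hmem => h.2 (coe_mem_pairs.1 hmem), ?_⟩
    ext p
    rw [Finset.mem_insert, Finset.mem_insert, mem_pairs]
    constructor
    · rintro ⟨x, y, hxy, rfl⟩
      rcases Finset.mem_insert.1 hxy with hxy | hxy
      · rw [hpair] at hxy
        rcases hxy with h | h
        · exact .inl h
        · exact .inr (.inl h)
      · exact .inr (.inr (coe_mem_pairs.2 hxy))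
    · rintro (rfl | rfl | hp)
      · exact ⟨v, u, Finset.mem_insert.2 (.inl Sym2.eq_swap), rfl⟩
      · exact ⟨u, v, Finset.mem_insert_self _ _, rfl⟩
      · obtain ⟨x, y, hxy, rfl⟩ := mem_pairs.1 hp
        exact ⟨x, y, Finset.mem_insert_of_mem hxy, rfl⟩
  | delete u v =>
    refine .inr ⟨rfl, coe_mem_pairs.2 h, ?_⟩
    ext p
    rw [Finset.mem_erase, Finset.mem_erase, mem_pairs]
    constructor
    · rintro ⟨x, y, hxy, rfl⟩
      have hxy' := Finset.mem_erase.1 hxy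
      have hne := hxy'.1
      rw [Ne, hpair, not_or] at hne
      exact ⟨hne.1, hne.2, coe_mem_pairs.2 hxy'.2⟩
    · rintro ⟨h₁, h₂, hp⟩
      obtain ⟨x, y, hxy, rfl⟩ := mem_pairs.1 hp
      refine ⟨x, y, Finset.mem_erase.2 ⟨?_, hxy⟩, rfl⟩
      rw [Ne, hpair, not_or]
      exact ⟨h₁, h₂⟩

theorem edges_take_succ {n : ℕ} (S : List (Update n)) {i : ℕ} (h : i < S.length) :
    edges (S.take (i + 1)) = S[i].apply (edges (S.take i)) := by
  unfold edges
  rw [List.take_succ_eq_append_getElem h, List.foldl_append]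
  rfl

theorem edges_loopless {n : ℕ} {S : List (Update n)} (hS : IsStream S) :
    ∀ i ≤ S.length, ∀ x, s(x, x) ∉ edges (S.take i) := by
  intro i
  induction i with
  | zero => intro _ x; simp [edges]
  | succ i ih =>
    intro hi
    rw [edges_take_succ S hi]
    exact Update.apply_loopless (hS i hi) (ih (by omega))

/-- An edge of a larger matching meets a stored edge by saturation. Both belong to the larger
matching, so they coincide. -/
theorem listsMaximalMatching_of_saturated {n k m : ℕ} {E : Finset (Sym2 (Fin n))} {mem : ℕ → ℕ}
    (hP : CoveredGraph n k (pairs E)) (hst : Stored (pairs E) mem m)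
    (hsat : Saturated (pairs E) mem m) :
    ListsMaximalMatching E ((List.range m).flatMap fun i =>
      [mem (16 * i + 2), mem (16 * i + 3)]) := by
  classical
  have hlt : ∀ i : Fin m, mem (16 * i + 2) < n ∧ mem (16 * i + 3) < n := fun i => by
    simpa using hP.subset (hst.edge i i.2)
  set f : Fin m → Fin n × Fin n := fun i => (⟨_, (hlt i).1⟩, ⟨_, (hlt i).2⟩) with hf
  have hedge : ∀ i, s((f i).1, (f i).2) ∈ E := fun i => coe_mem_pairs.1 (hst.edge i i.2)
  have hshare : ∀ i j v, v ∈ s((f i).1, (f i).2) → v ∈ s((f j).1, (f j).2) → i = j := by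
    intro i j v hi hj
    by_contra hne
    have hne' : (i : ℕ) ≠ j := fun h => hne (Fin.ext h)
    have h₁ := hst.disjoint i i.2 j j.2 hne'
    have h₂ := hst.disjoint j j.2 i i.2 (Ne.symm hne')
    rw [Sym2.mem_iff, Fin.ext_iff, Fin.ext_iff] at hi hj
    simp only [hf] at hi hj
    omega
  have hM : ∀ e, e ∈ (((List.finRange m).map f).map fun p => s(p.1, p.2)).toFinset ↔
      ∃ i, s((f i).1, (f i).2) = e := by
    intro e; simp
  refine ⟨(List.finRange m).map f, ?_, ?_, ⟨?_, ?_⟩, ?_⟩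
  · rw [List.flatMap_map, ← List.map_coe_finRange_eq_range, List.flatMap_map]
  · rw [List.map_map]
    refine (List.nodup_finRange m).map fun i j hij => ?_
    exact hshare i j (f i).1 (Sym2.mem_mk_left _ _)
      (by rw [← show s((f i).1, (f i).2) = s((f j).1, (f j).2) from hij]; exact Sym2.mem_mk_left _ _)
  · intro e he
    obtain ⟨i, rfl⟩ := (hM e).1 he
    exact hedge i
  · intro e he e' he' v hv hv'
    obtain ⟨i, rfl⟩ := (hM e).1 he
    obtain ⟨j, rfl⟩ := (hM e').1 he'
    rw [hshare i j v hv hv']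
  · intro M' hM' hle e he
    induction e using Sym2.ind with
    | _ x y =>
    have hxy := coe_mem_pairs.2 (hM'.1 he)
    have key : ∀ v, v ∈ s(x, y) → Matched mem m v →
        s(x, y) ∈ (((List.finRange m).map f).map fun p => s(p.1, p.2)).toFinset := by
      rintro v hv ⟨i, hi, h⟩
      rw [hM]
      refine ⟨⟨i, hi⟩, hM'.2 _ (hle ((hM _).2 ⟨⟨i, hi⟩, rfl⟩)) _ he v ?_ hv⟩
      rw [Sym2.mem_iff, Fin.ext_iff, Fin.ext_iff]
      exact h.imp Eq.symm Eq.symm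
    rcases hsat _ _ hxy with h | h
    · exact key x (Sym2.mem_mk_left _ _) h
    · exact key y (Sym2.mem_mk_right _ _) h

/-! ### Runs of the algorithm on a stream. -/

/-- The algorithm. -/
def sketchAlgorithm : Algorithm := ⟨setupProgram, updateProgram, queryProgram⟩

/-- Dependent choice for steps that are available only before time L; where no step is guaranteed,
the sequence is continued arbitrarily. -/
theorem exists_seq_of_step {α : Type*} {L : ℕ} {p : ℕ → α → Prop} {R : ℕ → α → α → Prop} {x₀ : α}
    (h₀ : p 0 x₀) (hstep : ∀ i < L, ∀ x, p i x → ∃ y, R i x y ∧ p (i + 1) y) :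
    ∃ σ : ℕ → α, σ 0 = x₀ ∧ (∀ i < L, R i (σ i) (σ (i + 1))) ∧ ∀ i ≤ L, p i (σ i) := by
  have hstep' : ∀ i x, ∃ y, i < L → p i x → R i x y ∧ p (i + 1) y := by
    intro i x
    by_cases h : i < L ∧ p i x
    · obtain ⟨y, hy⟩ := hstep i h.1 x h.2
      exact ⟨y, fun _ _ => hy⟩
    · exact ⟨x, fun h₁ h₂ => absurd ⟨h₁, h₂⟩ h⟩
  choose f hf using hstep'
  let σ : ℕ → α := fun i => Nat.rec x₀ f i
  have hp : ∀ i ≤ L, p i (σ i) := by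
    intro i
    induction i with
    | zero => exact fun _ => h₀
    | succ i ih => exact fun hi => (hf i (σ i) hi (ih (by omega))).2
  exact ⟨σ, rfl, fun i hi => (hf i (σ i) hi (hp i hi.le)).1, hp⟩

variable {w l k n : ℕ}

/-- Time bound for all programs. -/
def timeBound (w l k : ℕ) : ℕ := updateTime w l k + (w * 4 + w * w * 12 + 20) + (2 * k * 8 + 5)

/-- The run and its time bounds exist for every ω. Correctness is conditional on the sketches being
informative, after each update, about the two endpoints of that update. -/
theorem exists_run (hS : Sizes w l k n) (hl : l = Nat.clog 2 (256 * k)) (d : ℕ)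
    (ω : ℕ → Fin (2 ^ w)) {S : List (Update n)} (hst : IsStream S) (hpr : Promise k S) {T : ℝ}
    (hT : (timeBound w l k : ℝ) ≤ T) (hkn : k ≤ n) :
    ∃ σ : ℕ → Config, IsRun sketchAlgorithm w (memSize w l) ω [n, k, d, w] S T σ ∧
      ∀ i ≤ S.length, ∃ out, Answers sketchAlgorithm w (memSize w l) ω T (σ i) out ∧
        ((∀ (i : ℕ) (h : i < S.length),
          Informative l k ω (pairs (edges (S.take (i + 1)))) S[i].left ∧
          Informative l k ω (pairs (edges (S.take (i + 1)))) S[i].right) →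
          ListsMaximalMatching (edges (S.take i)) out) := by
  have hcube := hS.cube
  have hnn := hS.n_le_cube
  have hn1 := hS.one_le_n
  have hcov : ∀ i ≤ S.length, CoveredGraph n k (pairs (edges (S.take i))) := by
    intro i hi
    obtain ⟨M, hM, hk⟩ := hpr i hi
    exact coveredGraph_pairs (edges_loopless hst i hi) hM hk
  have hTle : ∀ t : ℕ, t ≤ timeBound w l k → (t : ℝ) ≤ T := fun t ht =>
    le_trans (by exact_mod_cast ht) hT
  set Inf : Prop := ∀ (i : ℕ) (h : i < S.length),
    Informative l k ω (pairs (edges (S.take (i + 1)))) S[i].left ∧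
    Informative l k ω (pairs (edges (S.take (i + 1)))) S[i].right with hInf
  set p : ℕ → Config → Prop := fun i σ => ∃ m, Invariant l ω (pairs (edges (S.take i))) σ.mem m ∧
    (Inf → Saturated (pairs (edges (S.take i))) σ.mem m) with hp
  have hempty : pairs (edges (S.take 0)) = ∅ := by simp [edges, pairs]
  obtain ⟨t₀, σ₀, ht₀, hx₀, hI₀⟩ := reaches_setup (ω := ω) hS hl
    (σ := Config.blank.call w [n, k, d, w])
    (show k % 2 ^ w = k from Nat.mod_eq_of_lt (by omega))
    (show w % 2 ^ w = w from Nat.mod_eq_of_lt Nat.lt_two_pow_self)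
    (fun _ => rfl) rfl
  have hp₀ : p 0 σ₀ := ⟨0, by rw [hempty]; exact hI₀, fun _ x y hxy => by
    rw [hempty] at hxy; simp at hxy⟩
  obtain ⟨σ, hσ₀, hσ, hpσ⟩ := exists_seq_of_step (L := S.length) (p := p)
    (R := fun i x y => ∀ h : i < S.length, ∃ t : ℕ, (t : ℝ) ≤ T ∧
      Exec w (memSize w l) ω updateProgram (x.call w S[i].args) t y) hp₀ (by
    rintro i hi x ⟨m, hI, hsat⟩
    have hadm := hst i hi
    have hloop := edges_loopless hst i hi.le
    have hl' := (S[i].left).2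
    have hr' := (S[i].right).2
    have h1w : 1 < 2 ^ w := Nat.one_lt_two_pow hS.word_pos.ne'
    have hop := (S[i]).op_le
    obtain ⟨t, y, ht, hx, m', hI', hsat'⟩ := reaches_update (ω := ω) hS
      (σ := x.call w S[i].args) (op := S[i].op) (u := S[i].left) (v := S[i].right) (m := m)
      (hcov i hi.le) (hcov (i + 1) hi)
      (by rw [edges_take_succ S hi]; exact Update.edgeStep hadm) hl' hr'
      (fun h => Update.left_ne_right hadm hloop (Fin.ext h))
      (by rw [Update.args_eq]; exact Nat.mod_eq_of_lt (a := S[i].op) (by omega))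
      (by rw [Update.args_eq]; exact Nat.mod_eq_of_lt (a := (S[i].left : ℕ)) (by omega))
      (by rw [Update.args_eq]; exact Nat.mod_eq_of_lt (a := (S[i].right : ℕ)) (by omega)) hI
    exact ⟨y, fun _ => ⟨t, hTle t (by unfold timeBound; omega), hx⟩, m', hI',
      fun hinf => hsat' (hsat hinf) fun _ => hinf i hi⟩)
  refine ⟨σ, ⟨⟨t₀, hTle t₀ (by unfold timeBound; omega), hσ₀ ▸ hx₀⟩,
    fun i hi => hσ i hi hi⟩, fun i hi => ?_⟩
  obtain ⟨m, hI, hsat⟩ := hpσ i hi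
  have hm := hI.stored.le_of_covered (hcov i hi)
  obtain ⟨t, τ, ht, hx, hmem, hpos, hout⟩ := reaches_query (ω := ω) hS (σ := (σ i).call w [])
    (m := m) hm hI.size rfl
  exact ⟨_, ⟨t, τ, hTle t (by unfold timeBound; omega), hx, hmem, hpos, hout⟩, fun hinf =>
    listsMaximalMatching_of_saturated (hcov i hi) hI.stored (hsat hinf)⟩

/-- Obliviousness enters here: the bad events are indexed by the updates of the fixed stream and
depend on ω through the seeds only, not through the stored matching. The factor 2 counts the
endpoints. -/
theorem coins_bad_le (hS : Sizes w l k n) (hl : l = Nat.clog 2 (256 * k)) (d : ℕ)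
    {S : List (Update n)} (hst : IsStream S) (hpr : Promise k S) {T : ℝ}
    (hT : (timeBound w l k : ℝ) ≤ T) (hkn : k ≤ n) :
    coins w {ω | ¬ ∃ σ : ℕ → Config,
        IsRun sketchAlgorithm w (memSize w l) ω [n, k, d, w] S T σ ∧
        ∀ i ≤ S.length, ∃ out, Answers sketchAlgorithm w (memSize w l) ω T (σ i) out ∧
          ListsMaximalMatching (edges (S.take i)) out} ≤
      ENNReal.ofReal (S.length * (2 * (n * (99 / 100) ^ w))) := by
  set bad : ℕ → Fin n → Set (ℕ → Fin (2 ^ w)) := fun i x =>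
    {ω | ¬ Informative l k ω (pairs (edges (S.take (i + 1)))) x} with hbad
  have hsub : {ω | ¬ ∃ σ : ℕ → Config,
        IsRun sketchAlgorithm w (memSize w l) ω [n, k, d, w] S T σ ∧
        ∀ i ≤ S.length, ∃ out, Answers sketchAlgorithm w (memSize w l) ω T (σ i) out ∧
          ListsMaximalMatching (edges (S.take i)) out} ⊆
      ⋃ i ∈ (Finset.univ : Finset (Fin S.length)),
        (bad i S[i].left ∪ bad i S[i].right) := by
    intro ω hω
    by_contra hcon
    simp only [Set.mem_iUnion, Finset.mem_univ, exists_true_left, not_exists, Set.mem_union,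
      not_or] at hcon
    refine hω ?_
    obtain ⟨σ, hrun, hans⟩ := exists_run hS hl d ω hst hpr hT hkn
    refine ⟨σ, hrun, fun i hi => ?_⟩
    obtain ⟨out, hout, hmax⟩ := hans i hi
    exact ⟨out, hout, hmax fun i h =>
      ⟨not_not.1 (hcon ⟨i, h⟩).1, not_not.1 (hcon ⟨i, h⟩).2⟩⟩
  have hone : ∀ (i : Fin S.length) (x : Fin n),
      coins w (bad i x) ≤ ENNReal.ofReal (n * (99 / 100) ^ w) := by
    intro i x
    obtain ⟨M, hM, hk⟩ := hpr (i + 1) i.2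
    refine (coins_not_informative_le hS
      (coveredGraph_pairs (edges_loopless hst (i + 1) i.2) hM hk) x).trans (le_of_eq ?_)
    rw [ENNReal.ofReal_mul (by positivity), ENNReal.ofReal_natCast]
  refine (measure_mono hsub).trans ((measure_biUnion_finset_le _ _).trans ?_)
  refine (Finset.sum_le_card_nsmul _ _ (ENNReal.ofReal (2 * (n * (99 / 100) ^ w)))
    fun i _ => ?_).trans ?_
  · refine (measure_union_le _ _).trans ((add_le_add (hone i _) (hone i _)).trans (le_of_eq ?_))
    rw [← ENNReal.ofReal_add (by positivity) (by positivity), two_mul]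
  · rw [Finset.card_univ, Fintype.card_fin, nsmul_eq_mul, ← ENNReal.ofReal_natCast,
      ← ENNReal.ofReal_mul (by positivity)]

end DynStream

/-! ## Choice of the constants -/

namespace DynStream

open WordRAM MeasureTheory
open scoped ENNReal

/-- Makes the factor w² in the memory size cost only about w/4 bits of an address. -/
theorem self_lt_two_pow_div (w : ℕ) : w < 2 ^ (w / 8 + 3) := by
  have h : w / 8 < 2 ^ (w / 8) := Nat.lt_two_pow_self
  rw [pow_add]
  omega

/-- Since k ≤ n ≤ 2^lam, both 2^l and n have lam + O(1) bits, while w ≥ 140 · lam leaves ample room.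
-/
theorem sizes_of_word {n k lam w : ℕ} (hk : 1 ≤ k) (hkn : k ≤ n) (hn : n ≤ 2 ^ lam)
    (hlam : 2 ≤ lam) (hw : 140 * lam ≤ w) : Sizes w (Nat.clog 2 (256 * k)) k n := by
  set l := Nat.clog 2 (256 * k) with hl
  have h256 : 256 * k ≤ 2 ^ l := Nat.le_pow_clog (by omega) _
  have h512 : 2 ^ l ≤ 512 * k := by
    have h := Nat.pow_pred_clog_lt_self (b := 2) (x := 256 * k) (by omega) (by omega)
    rw [← hl] at h
    have hl0 : l ≠ 0 := by rintro h0; rw [h0] at h256; omega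
    obtain ⟨l', hl'⟩ := Nat.exists_eq_succ_of_ne_zero hl0
    rw [hl', Nat.pred_succ] at h
    rw [hl', pow_succ]
    omega
  have hll : l ≤ lam + 9 := by
    have : 2 ^ l ≤ 2 ^ (lam + 9) := by rw [pow_add]; omega
    exact (Nat.pow_le_pow_iff_right (by omega)).1 this
  refine ⟨hk, h256, h512, by omega, by omega, ?_, by omega, ?_⟩
  · have h₁ := (self_lt_two_pow_div w).le
    have h₂ : 2 ^ l ≤ 2 ^ (lam + 9) := Nat.pow_le_pow_right (by omega) hll
    calc 32 * (w * w * (2 ^ l * 2 ^ l))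
        ≤ 2 ^ 5 * (2 ^ (w / 8 + 3) * 2 ^ (w / 8 + 3) * (2 ^ (lam + 9) * 2 ^ (lam + 9))) :=
          Nat.mul_le_mul le_rfl (Nat.mul_le_mul (Nat.mul_le_mul h₁ h₁) (Nat.mul_le_mul h₂ h₂))
      _ = 2 ^ (5 + (w / 8 + 3 + (w / 8 + 3) + (lam + 9 + (lam + 9)))) := by
          simp only [pow_add]
      _ ≤ 2 ^ w := Nat.pow_le_pow_right (by omega) (by omega)
  · calc 16 * (n * n * n) ≤ 2 ^ 4 * (2 ^ lam * 2 ^ lam * 2 ^ lam) :=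
          Nat.mul_le_mul le_rfl (Nat.mul_le_mul (Nat.mul_le_mul hn hn) hn)
      _ = 2 ^ (4 + (lam + lam + lam)) := by simp only [pow_add]
      _ ≤ 2 ^ w := Nat.pow_le_pow_right (by omega) (by omega)

theorem failure_le {c n lam L : ℕ} {δ : ℝ} (hn : 2 ≤ n) (hδ : 0 < δ) (hδ1 : δ < 1)
    (hlam : n / δ ≤ 2 ^ lam) (hL : L ≤ n ^ c) :
    (L : ℝ) * (2 * (n * (99 / 100) ^ (140 * (c + 1) * lam))) ≤ δ / n ^ c := by
  have hn0 : (0 : ℝ) < n := by positivity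
  have hn2 : (2 : ℝ) ≤ n := by exact_mod_cast hn
  -- Seventy repetitions halve the failure probability, so 140(c + 1) · lam of them give
  -- (δ/n)^(2c+2): one n^c for the stream length, one for the target, and n² for the factors n and 2
  -- ≤ n.
  have h70 : (99 / 100 : ℝ) ^ 70 ≤ 1 / 2 := by norm_num
  have hlam' : ((1 : ℝ) / 2) ^ lam ≤ δ / n := by
    rw [one_div, inv_pow, inv_le_comm₀ (by positivity) (by positivity), inv_div]
    exact hlam
  have h₁ : (99 / 100 : ℝ) ^ (140 * (c + 1) * lam) ≤ δ / n ^ (2 * c + 2) := by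
    calc (99 / 100 : ℝ) ^ (140 * (c + 1) * lam) = (((99 / 100) ^ 70) ^ lam) ^ (2 * c + 2) := by
          rw [← pow_mul, ← pow_mul]; congr 1; ring
      _ ≤ ((1 / 2) ^ lam) ^ (2 * c + 2) := by gcongr
      _ ≤ (δ / n) ^ (2 * c + 2) := by gcongr
      _ = δ ^ (2 * c + 2) / n ^ (2 * c + 2) := div_pow ..
      _ ≤ δ / n ^ (2 * c + 2) := by
          gcongr
          exact pow_le_of_le_one hδ.le hδ1.le (by omega)
  have hL' : (L : ℝ) ≤ n ^ c := by exact_mod_cast hL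
  calc (L : ℝ) * (2 * (n * (99 / 100) ^ (140 * (c + 1) * lam)))
      ≤ n ^ c * (n * (n * (δ / n ^ (2 * c + 2)))) := by gcongr
    _ = δ / n ^ c := by
        rw [show 2 * c + 2 = c + c + 1 + 1 by ring]
        field_simp
        ring

theorem Maintains.mono {A : Algorithm} {c n k w : ℕ} {δ B T Q B' T' Q' : ℝ}
    (h : Maintains A c n k δ w B T Q) (hB : B ≤ B') (hT : T ≤ T') (hQ : Q ≤ Q') :
    Maintains A c n k δ w B' T' Q' := by
  obtain ⟨s, hs, h⟩ := h
  have hrun : ∀ {ω : ℕ → Fin (2 ^ w)} {ps : List ℕ} {S : List (Update n)} {σ : ℕ → Config},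
      IsRun A w s ω ps S T σ → IsRun A w s ω ps S T' σ := by
    rintro ω ps S σ ⟨⟨t, ht, hx⟩, hi⟩
    refine ⟨⟨t, ht.trans hT, hx⟩, fun i h => ?_⟩
    obtain ⟨t, ht, hx⟩ := hi i h
    exact ⟨t, ht.trans hT, hx⟩
  have hans : ∀ {ω : ℕ → Fin (2 ^ w)} {σ : Config} {out : List ℕ},
      Answers A w s ω Q σ out → Answers A w s ω Q' σ out := by
    rintro ω σ out ⟨t, τ, ht, hx⟩
    exact ⟨t, τ, ht.trans hQ, hx⟩
  refine ⟨s, hs.trans hB, fun S hS hlen hpr => ⟨fun ω => ?_, ?_⟩⟩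
  · obtain ⟨σ, h₁, h₂⟩ := (h S hS hlen hpr).1 ω
    refine ⟨σ, hrun h₁, fun i hi => ?_⟩
    obtain ⟨out, hout⟩ := h₂ i hi
    exact ⟨out, hans hout⟩
  · refine (measure_mono ?_).trans (h S hS hlen hpr).2
    refine fun ω hω hex => hω ?_
    obtain ⟨σ, h₁, h₂⟩ := hex
    refine ⟨σ, hrun h₁, fun i hi => ?_⟩
    obtain ⟨out, hout, hm⟩ := h₂ i hi
    exact ⟨out, hans hout, hm⟩

theorem timeBound_le {w l k n : ℕ} (hS : Sizes w l k n) : timeBound w l k ≤ 20000 * (k * (w * w)) := by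
  have hk := hS.one_le_k
  have hw := hS.word_pos
  have hB := hS.width_le
  have h₁ : w ≤ w * w := Nat.le_mul_of_pos_right _ hw
  have h₂ : w * w ≤ k * (w * w) := Nat.le_mul_of_pos_left _ hk
  have h₃ : k ≤ k * (w * w) := Nat.le_mul_of_pos_right _ (Nat.mul_pos hw hw)
  -- 8773 = 17 · 512 + 48 + 21, with 2^l ≤ 512k and 1 ≤ k.
  have h₄ : w * w * (2 ^ l * 17 + 2 * k * 24 + 21) ≤ w * w * (8773 * k) :=
    Nat.mul_le_mul_left _ (by omega)
  have h₅ : w * w * (8773 * k) = 8773 * (k * (w * w)) := by ring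
  unfold timeBound updateTime repairTime
  omega

theorem time_arith {τ k w x K : ℝ} (hτ : τ ≤ 20000 * (k * (w * w))) (hk : 0 ≤ k) (hw : 0 ≤ w)
    (hwx : w ≤ x) (hx : 1 ≤ x) (hK : 20000 ≤ K) : τ ≤ k * (K * x ^ 3) := by
  have h₁ : w * w ≤ x ^ 3 :=
    calc w * w ≤ x * x := mul_le_mul hwx hwx hw (hw.trans hwx)
      _ = x ^ 2 := (sq x).symm
      _ ≤ x ^ 3 := pow_le_pow_right₀ hx (by norm_num)
  calc τ ≤ k * (20000 * (w * w)) := by linarith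
    _ ≤ k * (K * x ^ 3) := by
        refine mul_le_mul_of_nonneg_left (mul_le_mul hK h₁ (mul_nonneg hw hw) (by linarith)) hk

/-- The constant is 4194304 = 16 · 512², and r counts the registers. -/
theorem space_arith {r k w B x K : ℝ} (hr : 0 ≤ r) (hk : 1 ≤ k) (hw : 1 ≤ w) (hB0 : 0 ≤ B)
    (hB : B ≤ 512 * k) (hwx : w ≤ x) (hK : 4194304 + r ≤ K) :
    (16 * (w * w * (B * B)) + r) * w ≤ k ^ 2 * (K * x ^ 3) := by
  have hw0 : 0 ≤ w := by linarith
  have hk0 : 0 ≤ k := by linarith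
  have h₁ : B * B ≤ 262144 * k ^ 2 :=
    calc B * B ≤ (512 * k) * (512 * k) := mul_le_mul hB hB hB0 (by linarith)
      _ = 262144 * k ^ 2 := by ring
  have hkw : 1 ≤ k ^ 2 * w ^ 2 :=
    one_le_mul_of_one_le_of_one_le (one_le_pow₀ hk) (one_le_pow₀ hw)
  have h₂ : w * w * (B * B) ≤ w * w * (262144 * k ^ 2) :=
    mul_le_mul_of_nonneg_left h₁ (mul_nonneg hw0 hw0)
  have h₃ : r ≤ r * (k ^ 2 * w ^ 2) := le_mul_of_one_le_right hr hkw
  have h₄ : w ^ 3 ≤ x ^ 3 := pow_le_pow_left₀ hw0 hwx 3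
  calc (16 * (w * w * (B * B)) + r) * w
      ≤ (16 * (w * w * (262144 * k ^ 2)) + r * (k ^ 2 * w ^ 2)) * w :=
        mul_le_mul_of_nonneg_right (by linarith) hw0
    _ = k ^ 2 * ((4194304 + r) * w ^ 3) := by ring
    _ ≤ k ^ 2 * (K * x ^ 3) := mul_le_mul_of_nonneg_left
        (mul_le_mul hK h₄ (pow_nonneg hw0 3) (by linarith)) (sq_nonneg k)

theorem exists_maintains (c : ℕ) : ∃ C : ℕ, ∀ (n k : ℕ) (δ : ℝ), 2 ≤ n → 1 ≤ k → k ≤ n → 0 < δ →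
    δ < 1 → Maintains sketchAlgorithm c n k δ (140 * (c + 1) * ⌈Real.logb 2 (n / δ)⌉₊)
      (C * (k : ℝ) ^ 2 * Real.logb 2 (n / δ) ^ 3)
      (C * (k : ℝ) * Real.logb 2 (n / δ) ^ 3)
      (C * (k : ℝ) * Real.logb 2 (n / δ) ^ 3) := by
  obtain ⟨r, hr⟩ : ∃ r, sketchAlgorithm.numRegs = r := ⟨_, rfl⟩
  obtain ⟨K, hKR⟩ : ∃ K : ℕ, (4194304 : ℝ) + r ≤ K := exists_nat_ge _
  obtain ⟨U, hU⟩ : ∃ U, 140 * (c + 1) = U := ⟨_, rfl⟩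
  -- The word length is U times the rounded-up logarithm, hence at most 2UΛ as Λ > 1; its cube
  -- enters the space bound.
  refine ⟨K * (2 * U) ^ 3, fun n k δ hn hk hkn hδ hδ1 => ?_⟩
  set Λ := Real.logb 2 (n / δ) with hΛ
  set lam := ⌈Λ⌉₊ with hlam
  obtain ⟨w, hw⟩ : ∃ w, 140 * (c + 1) * lam = w := ⟨_, rfl⟩
  obtain ⟨l, hl⟩ : ∃ l, l = Nat.clog 2 (256 * k) := ⟨_, rfl⟩
  have hn2 : (2 : ℝ) ≤ n := by exact_mod_cast hn
  have hnδ : (n : ℝ) < n / δ := by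
    rw [lt_div_iff₀ hδ]; nlinarith
  have hnδ0 : (0 : ℝ) < n / δ := by linarith
  have hΛ1 : 1 < Λ := by
    rw [hΛ, Real.lt_logb_iff_rpow_lt (by norm_num) hnδ0, Real.rpow_one]
    linarith
  have hlam2 : 2 ≤ lam := by
    have : 1 < lam := Nat.lt_ceil.2 (by simpa using hΛ1)
    omega
  have hpow : n / δ ≤ (2 : ℝ) ^ lam := by
    rw [← Real.rpow_natCast, ← Real.logb_le_iff_le_rpow (by norm_num) hnδ0]
    exact Nat.le_ceil _
  have hnlam : n ≤ 2 ^ lam := by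
    have : (n : ℝ) ≤ 2 ^ lam := hnδ.le.trans hpow
    exact_mod_cast this
  have hwlam : 140 * lam ≤ w := by
    rw [← hw]; exact Nat.mul_le_mul_right _ (by omega)
  have hS := sizes_of_word hk hkn hnlam hlam2 hwlam
  rw [← hl] at hS
  have hlamΛ : (lam : ℝ) ≤ 2 * Λ := by
    have := (Nat.ceil_lt_add_one (by linarith : 0 ≤ Λ)).le
    rw [← hlam] at this
    linarith
  have hwR : (w : ℝ) ≤ 2 * U * Λ := by
    rw [← hw, hU, Nat.cast_mul]
    have := mul_le_mul_of_nonneg_left hlamΛ (Nat.cast_nonneg (α := ℝ) U)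
    linarith
  have hw1 : (1 : ℝ) ≤ w := by exact_mod_cast hS.word_pos
  have hk1 : (1 : ℝ) ≤ k := by exact_mod_cast hk
  have hr0 : (0 : ℝ) ≤ r := Nat.cast_nonneg _
  have hT : (timeBound w l k : ℝ) ≤ (K * (2 * U) ^ 3 : ℕ) * (k : ℝ) * Λ ^ 3 := by
    have h₁ : (timeBound w l k : ℝ) ≤ 20000 * (k * (w * w)) := by exact_mod_cast timeBound_le hS
    refine (time_arith h₁ (by linarith) (by linarith) hwR (by linarith)
      (by linarith : 20000 ≤ (K : ℝ))).trans (le_of_eq ?_)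
    push_cast; ring
  have hB : (2 : ℝ) ^ l ≤ 512 * k := by exact_mod_cast hS.width_le
  rw [hw]
  refine ⟨memSize w l, ?_, fun S hst hlen hpr => ⟨fun ω => ?_, ?_⟩⟩
  · have h₁ := space_arith hr0 hk1 hw1 (by positivity) hB hwR hKR
    have h₂ : (((memSize w l + sketchAlgorithm.numRegs) * w : ℕ) : ℝ) =
        (16 * (w * w * (2 ^ l * 2 ^ l)) + r) * w := by
      rw [hr, memSize]; push_cast; ring
    rw [h₂]
    refine h₁.trans (le_of_eq ?_)
    push_cast; ring
  · obtain ⟨σ, h₁, h₂⟩ := exists_run hS hl ⌈1 / δ⌉₊ ω hst hpr hT hkn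
    refine ⟨σ, h₁, fun i hi => ?_⟩
    obtain ⟨out, hout, -⟩ := h₂ i hi
    exact ⟨out, hout⟩
  · refine (coins_bad_le hS hl ⌈1 / δ⌉₊ hst hpr hT hkn).trans (ENNReal.ofReal_le_ofReal ?_)
    rw [← hw]
    exact failure_le hn hδ hδ1 hpow hlen

end DynStream

theorem mainTheorem4 (c : ℕ) :
    ∃ (A : DynStream.Algorithm) (W C p : ℕ),
      (∀ (n k : ℕ) (δ : ℝ), 2 ≤ n → 1 ≤ k → k ≤ n → 0 < δ → δ < 1 →
        DynStream.Maintains A c n k δ (W * ⌈Real.logb 2 (n / δ)⌉₊)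
          (C * (k : ℝ) ^ 2 * Real.logb 2 (n / δ) ^ p)
          (C * (k : ℝ) * Real.logb 2 (n / δ) ^ p)
          (C * (k : ℝ) * Real.logb 2 (n / δ) ^ p)) ∧
      (∀ (a : ℝ) (q : ℕ), ∃ C' p' : ℕ,
        ∀ (n k : ℕ) (δ : ℝ), 2 ≤ n → 1 ≤ k → k ≤ n → 0 < δ → δ < 1 →
          (k : ℝ) ≤ a * Real.sqrt n * Real.logb 2 n ^ q →
          DynStream.Maintains A c n k δ (W * ⌈Real.logb 2 (n / δ)⌉₊)
            (C' * (n : ℝ) * Real.logb 2 (n / δ) ^ p')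
            (C' * Real.sqrt n * Real.logb 2 (n / δ) ^ p')
            (C' * Real.sqrt n * Real.logb 2 (n / δ) ^ p')) := by
  obtain ⟨C, hC⟩ := DynStream.exists_maintains c
  refine ⟨DynStream.sketchAlgorithm, 140 * (c + 1), C, 3, hC,
    -- The constant must be a natural number and at least a, whatever the sign of a. The square and
    -- the exponent 2q come from k² in the space bound; for the time bound they are slack, absorbed
    -- by b ≥ 1 and Λ ≥ 1.
    fun a q => ⟨C * (⌈|a|⌉₊ + 1) ^ 2, 3 + 2 * q,
      fun n k δ hn hk hkn hδ hδ1 hka => ?_⟩⟩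
  have hn2 : (2 : ℝ) ≤ n := by exact_mod_cast hn
  have hlogn : 1 ≤ Real.logb 2 n := by
    rw [Real.le_logb_iff_rpow_le (by norm_num) (by positivity), Real.rpow_one]
    exact hn2
  have hlog : Real.logb 2 n ≤ Real.logb 2 (n / δ) := by
    refine Real.logb_le_logb_of_le (by norm_num) (by positivity) ?_
    rw [le_div_iff₀ hδ]; nlinarith
  set Λ := Real.logb 2 (n / δ) with hΛ
  set b : ℝ := ((⌈|a|⌉₊ + 1 : ℕ) : ℝ) with hb
  have hab : a ≤ b := by
    have h₁ := Nat.le_ceil |a|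
    have h₂ := le_abs_self a
    rw [hb]; push_cast; linarith
  have hb1 : 1 ≤ b := by rw [hb]; push_cast; linarith [Nat.cast_nonneg (α := ℝ) ⌈|a|⌉₊]
  have hkb : (k : ℝ) ≤ b * Real.sqrt n * Λ ^ q :=
    hka.trans (by gcongr)
  have hΛ1 : 1 ≤ Λ := hlogn.trans hlog
  have hsq : Real.sqrt n ^ 2 = n := Real.sq_sqrt (by positivity)
  have hT : (C : ℝ) * k * Λ ^ 3 ≤
      (C * (⌈|a|⌉₊ + 1) ^ 2 : ℕ) * Real.sqrt n * Λ ^ (3 + 2 * q) :=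
    calc (C : ℝ) * k * Λ ^ 3
        ≤ C * (b * Real.sqrt n * Λ ^ q) * Λ ^ 3 := by gcongr
      _ = C * b * Real.sqrt n * Λ ^ (3 + q) := by rw [pow_add]; ring
      _ ≤ C * b ^ 2 * Real.sqrt n * Λ ^ (3 + 2 * q) := by
          gcongr
          · exact le_self_pow₀ hb1 (by norm_num)
          · omega
      _ = _ := by rw [hb]; push_cast; ring
  refine (hC n k δ hn hk hkn hδ hδ1).mono ?_ hT hT
  calc (C : ℝ) * (k : ℝ) ^ 2 * Λ ^ 3
      ≤ C * (b * Real.sqrt n * Λ ^ q) ^ 2 * Λ ^ 3 := by gcongr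
    _ = C * b ^ 2 * Real.sqrt n ^ 2 * Λ ^ (3 + 2 * q) := by
        rw [pow_add, mul_comm 2 q, pow_mul]; ring
    _ = _ := by rw [hsq, hb]; push_cast; ring
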